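/- Let $G$ be a connected three-dimensional real Lie group with Lie algebra $\mathfrak g$. A left-invariant sub-Riemannian structure on $G$ is given by a plane $\Delta\subset\mathfrak g$ that generates $\mathfrak g$ as a Lie algebra, with an inner product on $\Delta$. For an orthonormal basis $f_1,f_2$ of $\Delta$ let $f_0$ be the unique element of $\mathfrak g$ with $$[f_1,f_0]=c_{01}^1f_1+c_{01}^2f_2,\qquad [f_2,f_0]=c_{02}^1f_1+c_{02}^2f_2,\qquad [f_2,f_1]=c_{12}^1f_1+c_{12}^2f_2+f_0 ,$$ and put $$\chi=\sqrt{-\Bigl(c_{01}^1c_{02}^2-\bigl(\tfrac{c_{01}^2+c_{02}^1}{2}\bigr)^2\Bigr)},\qquad \kappa=-(c_{12}^1)^2-(c_{12}^2)^2+\frac{c_{01}^2-c_{02}^1}{2}.$$ Two structures are locally isometric if around every point of the first group there is a diffeomorphism from an open neighbourhood onto an open subset of the second group whose differential maps the (left-translated) planes isometrically onto each other. The dilation by $c>0$ of a structure keeps $\Delta$ and multiplies orthonormal frames by $c$. A structure is normalized if $\chi=\kappa=0$ or $\chi^2+\kappa^2=1$. $G$ is unimodular if $|\det \mathrm{Ad}_g|=1$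 for all $g\in G$. **Theorem.** The numbers $\kappa,\chi$ do not depend on the orthonormal basis. Every structure has a normalized dilation, and if a dilation of one normalized structure is locally isometric to another normalized structure, then the two normalized structures are locally isometric. Each structure has exactly one of the following types, its point $(\kappa,\chi)$ satisfies the stated condition, and each type occurs at every point satisfying its condition: * middle arc: $\mathfrak h_3$ ($\chi=\kappa=0$); $\mathfrak a^+(\mathbb R)\oplus\mathbb R$, where $\mathfrak a^+(\mathbb R)$ is the Lie algebra of the group of orientation-preserving affine maps of $\mathbb R$ ($\chi=0$, $\kappa<0$); $\mathfrak{se}(2)$ ($\kappa=\chi>0$); $\mathfrak{sh}(2)$ ($\kappa=-\chi<0$); $\mathfrak{su}(2)$ ($\kappa>\chi\ge0$); $\mathfrak{sl}_e(2)$, i.e. $\mathfrak{sl}(2,\mathbb R)$ with Killing form definite on $\Delta$ ($\chi\ge0$, $\kappa<-\chi$); $\mathfrak{sl}_h(2)$, i.e. $\mathfrak{sl}(2,\mathbb R)$ with Killing form indefinite on $\Delta$ ($\chi>0$, $-\chi<\kappa<\chi$); * second arc: $\mathfrak{solv}^+$ ($\chi>0$, $\kappa<\chi$); * third arc: $\mathfrak{solv}^-$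 ($\chi>0$, $\kappa<-\chi$). Here $\mathfrak{solv}^{\pm}$ means a semidirect product $\mathbb R\ltimes_A\mathbb R^2$ with $A$ a nonscalar operator with $\operatorname{tr}A\neq0$ and $\pm\det A>0$. Two structures are locally isometric if and only if they have the same $(\kappa,\chi)$ and lie on the same arc; in particular structures with distinct $(\kappa,\chi)$ are not locally isometric. Moreover: 1. If $\chi=\kappa=0$, the structure is locally isometric to every left-invariant structure on the Heisenberg group $H_3$ (and such structures exist). 2. If $\chi\ge0$ and $\chi^2+\kappa^2=1$, then among any four structures with invariants $(\kappa,\chi)$ two are locally isometric; and there is, up to local isometry, exactly one structure with these invariants on a unimodular Lie group. 3. Two structures with the same invariants $(\kappa,\chi)$, where $\chi\ne0$, or $\chi=0$ and $\kappa\ge0$, are locally isometric if and only if their Lie algebras are isomorphic. -/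

import Mathlib

open scoped Manifold ContDiff

universe u v

noncomputable section

/-- A (real, smooth, connected) Lie group of dimension three. -/
structure LieGroup3 : Type (u + 1) where
  carrier : Type u
  [group : Group carrier]
  [topology : TopologicalSpace carrier]
  [charts : ChartedSpace (EuclideanSpace ℝ (Fin 3)) carrier]
  [lieGroup : LieGroup (𝓡 3) ∞ carrier]
  [t2 : T2Space carrier]
  [secondCountable : SecondCountableTopology carrier]
  [connected : ConnectedSpace carrier]

attribute [instance] LieGroup3.group LieGroup3.topology LieGroup3.charts LieGroup3.lieGroup
  LieGroup3.t2 LieGroup3.secondCountable LieGroup3.connected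

namespace LieGroup3

/-- The smoothness class in which Mathlib defines the Lie bracket on the tangent space at `1`. -/
instance (G : LieGroup3.{u}) : LieGroup (𝓡 3) (minSmoothness ℝ 3) G.carrier := by
  rw [minSmoothness_of_isRCLikeNormedField]
  infer_instance

/-- The Lie algebra of `G`: the tangent space at the identity, with the bracket of left-invariant
vector fields. -/
abbrev Lie (G : LieGroup3.{u}) : Type := GroupLieAlgebra (𝓡 3) G.carrier

/-- The differential at the identity of the conjugation `x ↦ g x g⁻¹`; all tangent spaces are
copies of the model space `ℝ³`, and `g 1 g⁻¹ = 1`. -/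
def Ad (G : LieGroup3.{u}) (g : G.carrier) :
    EuclideanSpace ℝ (Fin 3) →L[ℝ] EuclideanSpace ℝ (Fin 3) :=
  mfderiv (𝓡 3) (𝓡 3) (fun x : G.carrier => g * x * g⁻¹) 1

/-- A Lie group is unimodular when `|det Ad g| = 1` for every `g`. -/
def IsUnimodular (G : LieGroup3.{u}) : Prop :=
  ∀ g : G.carrier, |(G.Ad g).det| = 1

end LieGroup3

/-- A left-invariant (bracket generating) sub-Riemannian structure on a three dimensional Lie group:
a plane in the Lie algebra that generates it, with an inner product on this plane. The distribution
at `g` consists of the values at `g` of the left-invariant vector fields `v^L` with `v ∈ dist`, and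
`⟨v^L(g), w^L(g)⟩ = metric v w`. -/
structure LeftInvariantSR (G : LieGroup3.{u}) where
  dist : Submodule ℝ G.Lie
  rank_two : Module.finrank ℝ dist = 2
  metric : dist →ₗ[ℝ] dist →ₗ[ℝ] ℝ
  metric_symm : ∀ v w, metric v w = metric w v
  metric_pos : ∀ v, v ≠ 0 → 0 < metric v v
  bracket_generating : LieSubalgebra.lieSpan ℝ G.Lie (dist : Set G.Lie) = ⊤

namespace LeftInvariantSR

variable {G : LieGroup3.{u}} {H : LieGroup3.{v}}

/-- The structure dilated by `c > 0`: orthonormal frames get multiplied by `c`. -/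
def dilate (S : LeftInvariantSR G) (c : ℝ) (hc : 0 < c) : LeftInvariantSR G where
  dist := S.dist
  rank_two := S.rank_two
  metric := (c ^ 2)⁻¹ • S.metric
  metric_symm v w := by simp [S.metric_symm v w]
  metric_pos v hv := by
    have := S.metric_pos v hv
    simp only [LinearMap.smul_apply, smul_eq_mul]
    positivity
  bracket_generating := S.bracket_generating

/-- The differential of `φ` at `p` maps the distribution of `S` at `p` isometrically onto the
distribution of `T` at `φ p`. -/
def IsIsometricAt (S : LeftInvariantSR G) (T : LeftInvariantSR H) (φ : G.carrier → H.carrier)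
    (p : G.carrier) : Prop :=
  ∃ A : S.dist ≃ₗ[ℝ] T.dist,
    (∀ v : S.dist, mfderiv (𝓡 3) (𝓡 3) φ p (mulInvariantVectorField (v : G.Lie) p) =
      mulInvariantVectorField (A v : H.Lie) (φ p)) ∧
    ∀ v w : S.dist, T.metric (A v) (A w) = S.metric v w

/-- `S` and `T` are locally isometric: around every point of the first group there is a
sub-Riemannian isometry from an open neighbourhood onto an open subset of the second group. -/
def LocallyIsometric (S : LeftInvariantSR G) (T : LeftInvariantSR H) : Prop :=
  ∀ p : G.carrier, ∃ φ : OpenPartialHomeomorph G.carrier H.carrier, p ∈ φ.source ∧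
    ContMDiffOn (𝓡 3) (𝓡 3) ∞ φ φ.source ∧ ContMDiffOn (𝓡 3) (𝓡 3) ∞ φ.symm φ.target ∧
    ∀ q ∈ φ.source, S.IsIsometricAt T φ q

/-- `S` has the invariants `κ` and `χ`, computed in a left-invariant orthonormal frame `f₁, f₂` of
the distribution and the Reeb field `f₀`, which is characterized by `⁅f₂, f₁⁆ - f₀`, `⁅f₁, f₀⁆` and
`⁅f₂, f₀⁆` being horizontal. The structure constants are constant, so that their derivatives do not
appear in `κ`; `χ` is the square root of minus the determinant of the quadratic form
`c₀₁¹ h₁² + (c₀₁² + c₀₂¹) h₁ h₂ + c₀₂² h₂²`. -/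
def HasInvariants (S : LeftInvariantSR G) (κ χ : ℝ) : Prop :=
  ∃ (f₀ : G.Lie) (f₁ f₂ : S.dist) (c₀₁_1 c₀₁_2 c₀₂_1 c₀₂_2 c₁₂_1 c₁₂_2 : ℝ),
    S.metric f₁ f₁ = 1 ∧ S.metric f₂ f₂ = 1 ∧ S.metric f₁ f₂ = 0 ∧
    ⁅(f₁ : G.Lie), f₀⁆ = c₀₁_1 • (f₁ : G.Lie) + c₀₁_2 • (f₂ : G.Lie) ∧
    ⁅(f₂ : G.Lie), f₀⁆ = c₀₂_1 • (f₁ : G.Lie) + c₀₂_2 • (f₂ : G.Lie) ∧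
    ⁅(f₂ : G.Lie), (f₁ : G.Lie)⁆ = c₁₂_1 • (f₁ : G.Lie) + c₁₂_2 • (f₂ : G.Lie) + f₀ ∧
    χ = √(-(c₀₁_1 * c₀₂_2 - ((c₀₁_2 + c₀₂_1) / 2) ^ 2)) ∧
    κ = -c₁₂_1 ^ 2 - c₁₂_2 ^ 2 + (c₀₁_2 - c₀₂_1) / 2

/-- The point `(κ, χ)` is normalized. -/
def IsNormalizedPoint (κ χ : ℝ) : Prop :=
  (κ = 0 ∧ χ = 0) ∨ χ ^ 2 + κ ^ 2 = 1

/-- `S` is normalized: `χ = κ = 0` or `χ² + κ² = 1`. -/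
def IsNormalized (S : LeftInvariantSR G) : Prop :=
  ∃ κ χ : ℝ, S.HasInvariants κ χ ∧ IsNormalizedPoint κ χ

end LeftInvariantSR

section LieAlgebras

variable (L : Type*) [LieRing L] [LieAlgebra ℝ L]

/-- `L` is the Heisenberg algebra. -/
def IsHeisenbergAlg : Prop :=
  ∃ b : Module.Basis (Fin 3) ℝ L, ⁅b 0, b 1⁆ = b 2 ∧ ⁅b 0, b 2⁆ = 0 ∧ ⁅b 1, b 2⁆ = 0

/-- `L` is the Lie algebra of `A⁺(ℝ) ⊕ ℝ`. -/
def IsAffAlg : Prop :=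
  ∃ b : Module.Basis (Fin 3) ℝ L, ⁅b 0, b 1⁆ = b 0 ∧ ⁅b 0, b 2⁆ = 0 ∧ ⁅b 1, b 2⁆ = 0

/-- `L` is the semidirect product of `ℝ` with `ℝ²` in which the generator of `ℝ` acts on `ℝ²` by a
nonscalar operator (in companion form) of trace `t` and determinant `d`. -/
def IsSolvAlg (t d : ℝ) : Prop :=
  ∃ b : Module.Basis (Fin 3) ℝ L, ⁅b 0, b 1⁆ = b 2 ∧ ⁅b 0, b 2⁆ = -d • b 1 + t • b 2 ∧
    ⁅b 1, b 2⁆ = 0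

/-- `L` is the Lie algebra `se(2)` of the Euclidean motions of the plane. -/
def IsSE2Alg : Prop :=
  ∃ b : Module.Basis (Fin 3) ℝ L, ⁅b 0, b 1⁆ = b 2 ∧ ⁅b 0, b 2⁆ = -b 1 ∧ ⁅b 1, b 2⁆ = 0

/-- `L` is the Lie algebra `sh(2)` of the hyperbolic motions of the plane. -/
def IsSH2Alg : Prop :=
  ∃ b : Module.Basis (Fin 3) ℝ L, ⁅b 0, b 1⁆ = b 2 ∧ ⁅b 0, b 2⁆ = b 1 ∧ ⁅b 1, b 2⁆ = 0

/-- `L` is isomorphic to `sl(2, ℝ)`. -/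
def IsSL2Alg : Prop :=
  Nonempty (L ≃ₗ⁅ℝ⁆ LieAlgebra.SpecialLinear.sl (Fin 2) ℝ)

end LieAlgebras

section Unitary

open Matrix

attribute [local instance 100] LieRing.ofAssociativeRing

/-- The real Lie algebra `su(2)` of traceless skew-Hermitian complex matrices. -/
def su2 : LieSubalgebra ℝ (Matrix (Fin 2) (Fin 2) ℂ) where
  carrier := {A | Aᴴ = -A ∧ A.trace = 0}
  add_mem' := by
    rintro A B ⟨hA, hA'⟩ ⟨hB, hB'⟩
    exact ⟨by rw [conjTranspose_add, hA, hB, neg_add], by rw [trace_add, hA', hB', add_zero]⟩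
  zero_mem' := ⟨by simp, by simp⟩
  smul_mem' := by
    rintro c A ⟨hA, hA'⟩
    exact ⟨by rw [conjTranspose_smul, hA]; simp, by rw [trace_smul, hA', smul_zero]⟩
  lie_mem' := by
    rintro A B ⟨hA, hA'⟩ ⟨hB, hB'⟩
    refine ⟨?_, ?_⟩
    · rw [Ring.lie_def, conjTranspose_sub, conjTranspose_mul, conjTranspose_mul, hA, hB]
      simp
    · rw [Ring.lie_def, trace_sub, trace_mul_comm, sub_self]

end Unitary

/-- The labels of the points in the classification picture. -/
inductive Label
  | H3 | AffR | SolvPlus | SolvMinus | SE2 | SH2 | SLe2 | SLh2 | SU2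

/-- The three concentric arcs of the picture. -/
inductive Arc
  | middle | plus | minus

/-- The arc on which a label sits. -/
def Label.arc : Label → Arc
  | .SolvPlus => .plus
  | .SolvMinus => .minus
  | _ => .middle

/-- The points `(κ, χ)` over which a label occurs. -/
def Label.OccursAt : Label → ℝ → ℝ → Prop
  | .H3, κ, χ => κ = 0 ∧ χ = 0
  | .AffR, κ, χ => κ < 0 ∧ χ = 0
  | .SolvPlus, κ, χ => 0 < χ ∧ κ < χ
  | .SolvMinus, κ, χ => 0 < χ ∧ κ < -χ
  | .SE2, κ, χ => 0 < χ ∧ κ = χ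
  | .SH2, κ, χ => 0 < χ ∧ κ = -χ
  | .SLe2, κ, χ => 0 ≤ χ ∧ κ < -χ
  | .SLh2, κ, χ => 0 < χ ∧ -χ < κ ∧ κ < χ
  | .SU2, κ, χ => 0 ≤ χ ∧ χ < κ

namespace LeftInvariantSR

variable {G : LieGroup3.{u}}

/-- The Killing form is sign-definite on the distribution. -/
def IsElliptic (S : LeftInvariantSR G) : Prop :=
  (∀ v ∈ S.dist, v ≠ 0 → 0 < killingForm ℝ G.Lie v v) ∨
    ∀ v ∈ S.dist, v ≠ 0 → killingForm ℝ G.Lie v v < 0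

/-- The Killing form is sign-indefinite on the distribution. -/
def IsHyperbolic (S : LeftInvariantSR G) : Prop :=
  (∃ v ∈ S.dist, 0 < killingForm ℝ G.Lie v v) ∧ ∃ v ∈ S.dist, killingForm ℝ G.Lie v v < 0

/-- The Lie algebra of the group, with the type of the distribution for `sl(2)`, is the one that the
label names. The algebras `solv⁺` and `solv⁻` are the non-unimodular ones with an operator of
positive, respectively negative, determinant (normalized to `±1` by scaling the generator). -/
def HasLabel (S : LeftInvariantSR G) : Label → Prop
  | .H3 => IsHeisenbergAlg G.Lie
  | .AffR => IsAffAlg G.Lie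
  | .SolvPlus => ∃ t : ℝ, t ≠ 0 ∧ IsSolvAlg G.Lie t 1
  | .SolvMinus => ∃ t : ℝ, t ≠ 0 ∧ IsSolvAlg G.Lie t (-1)
  | .SE2 => IsSE2Alg G.Lie
  | .SH2 => IsSH2Alg G.Lie
  | .SLe2 => IsSL2Alg G.Lie ∧ S.IsElliptic
  | .SLh2 => IsSL2Alg G.Lie ∧ S.IsHyperbolic
  | .SU2 => Nonempty (G.Lie ≃ₗ⁅ℝ⁆ su2)

end LeftInvariantSR

/-- The underlying manifold `ℝ³` of the Heisenberg group. -/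
def Heis : Type := EuclideanSpace ℝ (Fin 3)

namespace Heis

instance : TopologicalSpace Heis := inferInstanceAs (TopologicalSpace (EuclideanSpace ℝ (Fin 3)))
instance : T2Space Heis := inferInstanceAs (T2Space (EuclideanSpace ℝ (Fin 3)))
instance : SecondCountableTopology Heis :=
  inferInstanceAs (SecondCountableTopology (EuclideanSpace ℝ (Fin 3)))
instance : ConnectedSpace Heis := inferInstanceAs (ConnectedSpace (EuclideanSpace ℝ (Fin 3)))
instance : ChartedSpace (EuclideanSpace ℝ (Fin 3)) Heis :=
  inferInstanceAs (ChartedSpace (EuclideanSpace ℝ (Fin 3)) (EuclideanSpace ℝ (Fin 3)))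
instance : IsManifold (𝓡 3) ∞ Heis :=
  inferInstanceAs (IsManifold (𝓡 3) ∞ (EuclideanSpace ℝ (Fin 3)))

/-- The multiplication of upper unitriangular matrices with entries `x` and `y` above the diagonal
and `z` in the corner. -/
def mulFun (a b : EuclideanSpace ℝ (Fin 3)) : EuclideanSpace ℝ (Fin 3) :=
  !₂[a 0 + b 0, a 1 + b 1, a 2 + b 2 + a 0 * b 1]

/-- The inverse for `mulFun`. -/
def invFun (a : EuclideanSpace ℝ (Fin 3)) : EuclideanSpace ℝ (Fin 3) :=
  !₂[-a 0, -a 1, -a 2 + a 0 * a 1]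

instance : Mul Heis := ⟨mulFun⟩
instance : Inv Heis := ⟨invFun⟩
instance : One Heis := ⟨(0 : EuclideanSpace ℝ (Fin 3))⟩

instance : Group Heis := by
  refine Group.ofLeftAxioms ?_ ?_ ?_
  · intro a b c
    change mulFun (mulFun a b) c = mulFun a (mulFun b c)
    ext i
    fin_cases i <;> simp [mulFun] <;> ring
  · intro a
    change mulFun 0 a = a
    ext i
    fin_cases i <;> simp [mulFun]
  · intro a
    change mulFun (invFun a) a = 0
    ext i
    fin_cases i <;> simp [mulFun, invFun]

theorem contDiff_mulFun : ContDiff ℝ ∞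
    (fun p : EuclideanSpace ℝ (Fin 3) × EuclideanSpace ℝ (Fin 3) => mulFun p.1 p.2) := by
  rw [contDiff_euclidean]
  intro i
  fin_cases i <;> simp [mulFun] <;> fun_prop

theorem contDiff_invFun : ContDiff ℝ ∞ invFun := by
  rw [contDiff_euclidean]
  intro i
  fin_cases i <;> simp [invFun] <;> fun_prop

instance : LieGroup (𝓡 3) ∞ Heis where
  contMDiff_mul := by
    have h := contDiff_mulFun.contMDiff
    rw [modelWithCornersSelf_prod, ← chartedSpaceSelf_prod] at h
    exact h
  contMDiff_inv := contDiff_invFun.contMDiff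

end Heis

/-- The three dimensional Heisenberg group. -/
def heisenbergGroup : LieGroup3.{0} where
  carrier := Heis

end

/-!
The classification rests on *canonical frames*. The symmetric part of `ad f₀` on the distribution is
trace free, so some orthonormal frame `f₁, f₂`, together with the Reeb vector `f₀`, satisfies
`⁅f₁, f₀⁆ = (χ + w) f₂`, `⁅f₂, f₀⁆ = (χ - w) f₁` and `⁅f₂, f₁⁆ = a₁ f₁ + a₂ f₂ + f₀`, with
`κ = w - a₁² - a₂²`. The Jacobi identity says `a₁ (χ + w) = 0 = a₂ (χ - w)`; hence, up to the frames
with `χ = 0` that a rotation simplifies, `a₁ = a₂ = 0` (the middle arc), or `a₁ = 0` and `w = χ` (the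
second arc), or `a₂ = 0` and `w = -χ` (the third arc). In each case `(κ, χ)` and the arc determine the
structure constants up to a change of frame (`LeftInvariantSR.HasInvariants.exists_isOnArc`), and the
Lie algebra can be read off from them (`LeftInvariantSR.IsOnArc.exists_hasLabel`).

*Invariance.* A local isometry carries the left-invariant canonical frame of the first structure to
a frame that differs from the one of the second structure by a rotation depending on the point. The
Reeb field is preserved, and comparing brackets gives `κ = κ'` and `χ = χ'`; for `χ > 0` the rotation
is `±1`, so that `|a₁|` and `|a₂|`, and with them the arc, are preserved too
(`IsLieFrame.rigidity`, `LeftInvariantSR.IsCanonicalFrame.invariant`).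

*Construction of isometries.* For curves `γᵢ` in a group, with logarithmic derivatives constantly
`aᵢ`, the map `Ψ (x₁, x₂, x₃) = γ₁ x₁ * γ₂ x₂ * γ₃ x₃` is a chart near the identity whose logarithmic
derivative is determined, through the Maurer–Cartan equation, by linear differential equations with
coefficients in the Lie algebra. An isomorphism of Lie algebras that respects the structures turns
the equations of one group into those of the other, so that `Ψ_G ∘ Ψ_H⁻¹` is a local isometry.
The same comparison with an additional rotation in the third coordinate identifies the structure
on `A⁺(ℝ) ⊕ ℝ` with the one on the universal cover of `SL(2)` that has the same `κ < 0 = χ`, although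
the Lie algebras differ (`LeftInvariantSR.IsCanonicalFrame.locallyIsometric_of_reeb_central`).

*Labels.* The trace of `ad` and the Killing form separate the algebras
(`LeftInvariantSR.HasLabel.unique`), and the trace of `ad` vanishes exactly for unimodular groups
(`LieGroup3.isUnimodular_iff`, by Jacobi's formula for the derivative of `det (Ad g)`).

*Realization.* Every canonical frame lives on one of three kinds of groups: `ℝ ⋉ ℝ²` with the
exponential of a companion matrix as the action, the unit quaternions, and the universal cover of
`SU(1,1)`, written on `ℝ × ℂ` with an explicit cocycle. Their Lie algebras, and that of the Heisenberg
group, are computed from matrix representations: the differential of a smooth multiplicative map into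
a normed algebra turns brackets into commutators (`LieGroup3.exists_basis_of_rep`).
-/

/-! ### Left-invariant frames in charts -/

noncomputable section

open Set Filter Topology VectorField

/-- The model space of the three-dimensional Lie groups. -/
abbrev E3 : Type := EuclideanSpace ℝ (Fin 3)

namespace LieGroup3

/-- The Lie bracket of `G`, as a continuous bilinear map on the model space. -/
def br (G : LieGroup3.{u}) : E3 →L[ℝ] E3 →L[ℝ] E3 :=
  LinearMap.toContinuousLinearMap
    ((LinearMap.toContinuousLinearMap : (E3 →ₗ[ℝ] E3) ≃ₗ[ℝ] (E3 →L[ℝ] E3)).toLinearMap ∘ₗ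
      (LieModule.toEnd ℝ G.Lie G.Lie : G.Lie →ₗ[ℝ] Module.End ℝ G.Lie))

/-- The differential at the identity of the left translation by `g`, on the model space. -/
def dL (G : LieGroup3.{u}) (g : G.carrier) : E3 →L[ℝ] E3 :=
  mfderiv (𝓡 3) (𝓡 3) (fun x : G.carrier => g * x) 1

end LieGroup3

/-- `M` is a frame of vector fields on the open set `U`, parametrized by a Lie algebra with bracket
`br`: the fields `x ↦ M x a` are pointwise independent and bracket like the vectors `a`. -/
structure IsLieFrame (br : E3 →L[ℝ] E3 →L[ℝ] E3) (U : Set E3) (M : E3 → E3 →L[ℝ] E3) : Prop where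
  isOpen : IsOpen U
  contDiffOn : ContDiffOn ℝ ∞ M U
  bijective : ∀ x ∈ U, Function.Bijective (M x)
  bracket : ∀ x ∈ U, ∀ a b,
    fderiv ℝ M x (M x a) b - fderiv ℝ M x (M x b) a = M x (br a b)

theorem two_le_infty : (2 : WithTop ℕ∞) ≤ ∞ :=
  WithTop.coe_le_coe.2 (le_top : (2 : ℕ∞) ≤ ⊤)

theorem mlieBracket_model_eq_lieBracket (V W : E3 → E3) (x : E3) :
    mlieBracket (𝓡 3) V W x = lieBracket ℝ V W x := by
  have h : ∀ V W : ∀ y : E3, TangentSpace (𝓡 3) y,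
      mlieBracket (𝓡 3) V W = lieBracketWithin ℝ V W univ := fun V W => by
    rw [← mlieBracketWithin_univ, mlieBracketWithin_eq_lieBracketWithin]
  rw [← lieBracketWithin_univ]
  exact congrFun (h V W) x

namespace LieGroup3

variable (G : LieGroup3.{u})

theorem mdifferentiable_mul_left (g h : G.carrier) :
    MDifferentiableAt (𝓡 3) (𝓡 3) (fun x : G.carrier => g * x) h :=
  (contMDiff_mul_left (I := 𝓡 3) (n := ∞) (a := g)).mdifferentiableAt (by simp)

theorem dL_one : G.dL 1 = ContinuousLinearMap.id ℝ E3 := by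
  have : (fun x : G.carrier => 1 * x) = id := by ext; simp
  unfold dL; rw [this]; exact mfderiv_id

theorem mfderiv_mul_left_dL (g h : G.carrier) :
    (mfderiv (𝓡 3) (𝓡 3) (fun x : G.carrier => g * x) h : E3 →L[ℝ] E3) ∘L G.dL h
      = G.dL (g * h) := by
  have h1 : (fun x : G.carrier => g * h * x) = (fun x => g * x) ∘ (fun x => h * x) := by
    ext; simp [mul_assoc]
  unfold dL
  rw [h1, mfderiv_comp (I' := 𝓡 3) _ (G.mdifferentiable_mul_left _ _)
    (G.mdifferentiable_mul_left _ _), mul_one]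
  rfl

theorem dL_bijective (g : G.carrier) : Function.Bijective (G.dL g) := by
  have h1 := G.mfderiv_mul_left_dL g⁻¹ g
  have h2 : (mfderiv (𝓡 3) (𝓡 3) (fun x : G.carrier => g * x) 1 : E3 →L[ℝ] E3) ∘L
      (mfderiv (𝓡 3) (𝓡 3) (fun x : G.carrier => g⁻¹ * x) g : E3 →L[ℝ] E3) =
      ContinuousLinearMap.id ℝ E3 := by
    have h3 : (fun x : G.carrier => g * x) ∘ (fun x => g⁻¹ * x) = id := by ext; simp
    have h4 := mfderiv_comp (I := 𝓡 3) (I' := 𝓡 3) (I'' := 𝓡 3) g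
      (G.mdifferentiable_mul_left g (g⁻¹ * g)) (G.mdifferentiable_mul_left g⁻¹ g)
    rw [h3, mfderiv_id, inv_mul_cancel] at h4
    exact h4.symm
  rw [inv_mul_cancel, dL_one] at h1
  exact ⟨Function.LeftInverse.injective (fun x => DFunLike.congr_fun h1 x),
    Function.RightInverse.surjective (fun x => DFunLike.congr_fun h2 x)⟩

/-- The left-invariant frame read in the chart at `p`. -/
def chartFrame (p : G.carrier) (x : E3) : E3 →L[ℝ] E3 :=
  (mfderiv (𝓡 3) (𝓡 3) (chartAt E3 p) ((chartAt E3 p).symm x) : E3 →L[ℝ] E3) ∘L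
    G.dL ((chartAt E3 p).symm x)

instance : IsManifold (𝓡 3) ∞ G.carrier := ContMDiffMul.toIsManifold (I := 𝓡 3) (G := G.carrier)
instance : IsManifold (𝓡 3) 1 G.carrier := IsManifold.of_le (n := ∞) (by simp)

theorem contDiffAt_mul_chart (p : G.carrier) {x : E3} (hx : x ∈ (chartAt E3 p).target)
    (q r : G.carrier) {y : E3} (hy : y ∈ (chartAt E3 q).target)
    (h : (chartAt E3 p).symm x * (chartAt E3 q).symm y ∈ (chartAt E3 r).source) :
    ContDiffAt ℝ ∞ (fun z : E3 × E3 => chartAt E3 r ((chartAt E3 p).symm z.1 *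
      (chartAt E3 q).symm z.2)) (x, y) := by
  rw [← contMDiffAt_iff_contDiffAt]
  have h1 : ContMDiffAt 𝓘(ℝ, E3 × E3) (𝓡 3) ∞
      (fun z : E3 × E3 => (chartAt E3 p).symm z.1) (x, y) :=
    ((contMDiffOn_chart_symm (n := ∞) (x := p)).contMDiffAt
      ((chartAt E3 p).open_target.mem_nhds hx)).comp (x, y)
      (contDiff_fst.contMDiff.contMDiffAt)
  have h2 : ContMDiffAt 𝓘(ℝ, E3 × E3) (𝓡 3) ∞
      (fun z : E3 × E3 => (chartAt E3 q).symm z.2) (x, y) :=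
    ((contMDiffOn_chart_symm (n := ∞) (x := q)).contMDiffAt
      ((chartAt E3 q).open_target.mem_nhds hy)).comp (x, y)
      (contDiff_snd.contMDiff.contMDiffAt)
  exact ((contMDiffOn_chart (n := ∞) (x := r)).contMDiffAt
      ((chartAt E3 r).open_source.mem_nhds h)).comp (x, y) (h1.mul h2)

theorem chartFrame_eq (p : G.carrier) {x : E3} (hx : x ∈ (chartAt E3 p).target) :
    G.chartFrame p x = fderiv ℝ (fun y => chartAt E3 p ((chartAt E3 p).symm x *
      (chartAt E3 (1 : G.carrier)).symm y)) (chartAt E3 (1 : G.carrier) 1) := by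
  have A : MDifferentiableAt (𝓡 3) (𝓡 3) (chartAt E3 p) ((chartAt E3 p).symm x * 1) := by
    rw [mul_one]
    exact (mdifferentiable_chart (I := 𝓡 3) p).mdifferentiableAt ((chartAt E3 p).map_target hx)
  have C := G.mdifferentiable_mul_left ((chartAt E3 p).symm x) 1
  have D := mfderiv_comp (I := 𝓡 3) (I' := 𝓡 3) (I'' := 𝓡 3) (1 : G.carrier) A C
  have E := MDifferentiableAt.comp (I := 𝓡 3) (I' := 𝓡 3) (I'' := 𝓡 3) (1 : G.carrier) A C
  have h1 : G.chartFrame p x = mfderiv (𝓡 3) (𝓡 3)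
      (chartAt E3 p ∘ fun y => (chartAt E3 p).symm x * y) (1 : G.carrier) := by
    rw [D]
    unfold chartFrame dL
    rw [mul_one]
    rfl
  rw [h1, E.mfderiv]
  simp only [writtenInExtChartAt, ModelWithCorners.range_eq_univ, fderivWithin_univ]
  rfl

theorem contDiffOn_chartFrame (p : G.carrier) :
    ContDiffOn ℝ ∞ (G.chartFrame p) (chartAt E3 p).target := by
  have h1 : (1 : G.carrier) ∈ (chartAt E3 (1 : G.carrier)).source := mem_chart_source _ _
  refine ContDiffOn.congr (fun x hx => ContDiffAt.contDiffWithinAt ?_)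
    (fun x hx => G.chartFrame_eq p hx)
  refine ContDiffAt.fderiv (n := ∞) (f := fun x y => chartAt E3 p ((chartAt E3 p).symm x *
      (chartAt E3 (1 : G.carrier)).symm y)) (g := fun _ => chartAt E3 (1 : G.carrier) 1)
      ?_ contDiffAt_const (by simp)
  refine G.contDiffAt_mul_chart p hx 1 p (OpenPartialHomeomorph.map_source _ h1) ?_
  rw [OpenPartialHomeomorph.left_inv _ h1, mul_one]
  exact OpenPartialHomeomorph.map_target _ hx

theorem mpullback_chart_symm (p : G.carrier) {x : E3} (hx : x ∈ (chartAt E3 p).target)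
    (V : ∀ g : G.carrier, TangentSpace (𝓡 3) g) :
    mpullback (𝓡 3) (𝓡 3) (chartAt E3 p).symm V x =
      mfderiv (𝓡 3) (𝓡 3) (chartAt E3 p) ((chartAt E3 p).symm x) (V ((chartAt E3 p).symm x)) := by
  have h := mdifferentiable_chart (I := 𝓡 3) p
  rw [mpullback_apply]
  have h1 := h.comp_symm_deriv hx
  have h2 := h.symm_comp_deriv ((chartAt E3 p).map_target hx)
  rw [(chartAt E3 p).right_inv hx] at h2
  rw [ContinuousLinearMap.inverse_eq h2 h1]
  rfl

theorem mpullback_mulInvariantVectorField_chart (p : G.carrier) {x : E3}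
    (hx : x ∈ (chartAt E3 p).target) (v : G.Lie) :
    mpullback (𝓡 3) (𝓡 3) (chartAt E3 p).symm (mulInvariantVectorField v) x =
      G.chartFrame p x v := G.mpullback_chart_symm p hx _

theorem isLieFrame_chartFrame (p : G.carrier) :
    IsLieFrame G.br (chartAt E3 p).target (G.chartFrame p) where
  isOpen := (chartAt E3 p).open_target
  contDiffOn := G.contDiffOn_chartFrame p
  bijective x hx := ((mdifferentiable_chart (I := 𝓡 3) p).mfderiv_bijective
    ((chartAt E3 p).map_target hx)).comp (G.dL_bijective _)
  bracket x hx a b := by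
    have hd : DifferentiableAt ℝ (G.chartFrame p) x :=
      ((G.contDiffOn_chartFrame p).contDiffAt
        ((chartAt E3 p).open_target.mem_nhds hx)).differentiableAt (by simp)
    have h1 := mpullback_mlieBracket (n := ∞) (I := 𝓡 3) (I' := 𝓡 3) (f := (chartAt E3 p).symm)
      (x₀ := x) (V := mulInvariantVectorField (G := G.carrier) (I := 𝓡 3) a)
      (W := mulInvariantVectorField (G := G.carrier) (I := 𝓡 3) b)
      (mdifferentiableAt_mulInvariantVectorField _)
      (mdifferentiableAt_mulInvariantVectorField _)
      ((contMDiffOn_chart_symm (n := ∞)).contMDiffAt ((chartAt E3 p).open_target.mem_nhds hx))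
      (by rw [minSmoothness_of_isRCLikeNormedField]; exact two_le_infty)
    rw [← mulInvariantVector_mlieBracket (I := 𝓡 3) (G := G.carrier) (a : G.Lie) (b : G.Lie),
      G.mpullback_mulInvariantVectorField_chart p hx] at h1
    have h2 : ∀ v : G.Lie, mpullback (𝓡 3) (𝓡 3) (chartAt E3 p).symm (mulInvariantVectorField v)
        =ᶠ[𝓝 x] fun y => G.chartFrame p y v := fun v => by
      filter_upwards [(chartAt E3 p).open_target.mem_nhds hx] with y hy
      exact G.mpullback_mulInvariantVectorField_chart p hy v
    rw [(h2 a).mlieBracket_vectorField_eq (h2 b)] at h1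
    have h3 : ∀ v, fderiv ℝ (fun y => G.chartFrame p y v) x =
        (fderiv ℝ (G.chartFrame p) x).flip v := fun v => by
      ext w
      rw [fderiv_clm_apply hd (differentiableAt_const v)]
      simp
    refine Eq.trans ?_ (h1.trans (mlieBracket_model_eq_lieBracket _ _ x)).symm
    rw [lieBracket, h3, h3]
    rfl

end LieGroup3

end

/-! ### The logarithmic derivative and the Maurer–Cartan equation -/

noncomputable section

open Set Filter Topology VectorField

theorem ContinuousLinearMap.isInvertible_of_bijective {M : E3 →L[ℝ] E3}
    (h : Function.Bijective M) : M.IsInvertible :=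
  ⟨(LinearEquiv.ofBijective M.toLinearMap h).toContinuousLinearEquiv, by ext; rfl⟩

namespace LieGroup3

variable (G : LieGroup3.{u}) {F F' : Type*} [NormedAddCommGroup F] [NormedSpace ℝ F]
  [NormedAddCommGroup F'] [NormedSpace ℝ F']

/-- `θ` is the logarithmic derivative of `Ψ : F → G` at `x`, i.e. the differential of `Ψ` at `x` is
`θ` followed by the left translation by `Ψ x`. -/
def HasLogDerivAt (Ψ : F → G.carrier) (θ : F →L[ℝ] E3) (x : F) : Prop :=
  HasMFDerivAt 𝓘(ℝ, F) (𝓡 3) Ψ x (G.dL (Ψ x) ∘L θ : F →L[ℝ] E3)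

/-- The logarithmic derivative of `Ψ : F → G`, that is, the pullback by `Ψ` of the Maurer–Cartan
form of `G`. -/
def logDeriv (Ψ : F → G.carrier) (x : F) : F →L[ℝ] E3 :=
  (G.dL (Ψ x)).inverse ∘L (mfderiv 𝓘(ℝ, F) (𝓡 3) Ψ x : F →L[ℝ] E3)

variable {G} {Ψ : F → G.carrier} {θ θ' : F →L[ℝ] E3} {x : F}

theorem HasLogDerivAt.unique (h : G.HasLogDerivAt Ψ θ x) (h' : G.HasLogDerivAt Ψ θ' x) :
    θ = θ' := by
  have := hasMFDerivAt_unique h h'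
  ext1 v
  exact (G.dL_bijective _).1 (DFunLike.congr_fun this v)

theorem HasLogDerivAt.of_hasMFDerivAt {D : F →L[ℝ] E3} (h : HasMFDerivAt 𝓘(ℝ, F) (𝓡 3) Ψ x D)
    (hD : D = G.dL (Ψ x) ∘L θ) : G.HasLogDerivAt Ψ θ x := by
  subst hD
  exact h

theorem hasLogDerivAt_logDeriv (h : MDifferentiableAt 𝓘(ℝ, F) (𝓡 3) Ψ x) :
    G.HasLogDerivAt Ψ (G.logDeriv Ψ x) x := by
  refine HasLogDerivAt.of_hasMFDerivAt h.hasMFDerivAt ?_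
  have key : ∀ D : F →L[ℝ] E3, D = G.dL (Ψ x) ∘L (G.dL (Ψ x)).inverse ∘L D := fun D => by
    rw [← ContinuousLinearMap.comp_assoc, ContinuousLinearMap.IsInvertible.self_comp_inverse
      (ContinuousLinearMap.isInvertible_of_bijective (G.dL_bijective _)),
      ContinuousLinearMap.id_comp]
  exact key _

theorem HasLogDerivAt.mul_left (h : G.HasLogDerivAt Ψ θ x) (g : G.carrier) :
    G.HasLogDerivAt (fun y => g * Ψ y) θ x := by
  have := (G.mdifferentiable_mul_left g (Ψ x)).hasMFDerivAt.comp x h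
  unfold HasLogDerivAt
  rw [← G.mfderiv_mul_left_dL]
  exact this

theorem HasLogDerivAt.comp {f : F' → F} {f' : F' →L[ℝ] F} {y : F'}
    (h : G.HasLogDerivAt Ψ θ (f y)) (hf : HasFDerivAt f f' y) :
    G.HasLogDerivAt (Ψ ∘ f) (θ ∘L f') y := by
  have h1 : HasMFDerivAt 𝓘(ℝ, F) (𝓡 3) Ψ (f y) (G.dL (Ψ (f y)) ∘L θ : F →L[ℝ] E3) := h
  exact h1.comp y hf.hasMFDerivAt

theorem HasLogDerivAt.hasFDerivAt_chart (h : G.HasLogDerivAt Ψ θ x) {p : G.carrier}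
    (hp : Ψ x ∈ (chartAt E3 p).source) :
    HasFDerivAt (fun y => chartAt E3 p (Ψ y)) (G.chartFrame p (chartAt E3 p (Ψ x)) ∘L θ) x := by
  have := ((mdifferentiable_chart (I := 𝓡 3) p).mdifferentiableAt hp).hasMFDerivAt.comp x h
  unfold chartFrame
  rw [(chartAt E3 p).left_inv hp]
  exact hasMFDerivAt_iff_hasFDerivAt.1 this

theorem hasLogDerivAt_of_hasFDerivAt_chart {p : G.carrier}
    (hp : Ψ x ∈ (chartAt E3 p).source) (hc : ContinuousAt Ψ x)
    (h : HasFDerivAt (fun y => chartAt E3 p (Ψ y))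
      (G.chartFrame p (chartAt E3 p (Ψ x)) ∘L θ) x) : G.HasLogDerivAt Ψ θ x := by
  have hch := mdifferentiable_chart (I := 𝓡 3) p
  have hx := (chartAt E3 p).map_source hp
  have h1 : HasMFDerivAt 𝓘(ℝ, F) (𝓡 3) ((chartAt E3 p).symm ∘ fun y => chartAt E3 p (Ψ y)) x _ :=
    (hch.mdifferentiableAt_symm hx).hasMFDerivAt.comp x h.hasMFDerivAt
  have h2 : Ψ =ᶠ[𝓝 x] (chartAt E3 p).symm ∘ fun y => chartAt E3 p (Ψ y) := by
    filter_upwards [hc.preimage_mem_nhds ((chartAt E3 p).open_source.mem_nhds hp)] with y hy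
    exact ((chartAt E3 p).left_inv hy).symm
  have h3 := h1.congr_of_eventuallyEq h2
  refine HasLogDerivAt.of_hasMFDerivAt h3 ?_
  have h4 := hch.symm_comp_deriv hp
  ext1 v
  unfold chartFrame
  rw [(chartAt E3 p).left_inv hp]
  exact DFunLike.congr_fun h4 (G.dL (Ψ x) (θ v))

theorem contDiffAt_chart_comp (h : ContMDiffAt 𝓘(ℝ, F) (𝓡 3) ∞ Ψ x) {p : G.carrier}
    (hp : Ψ x ∈ (chartAt E3 p).source) : ContDiffAt ℝ ∞ (fun y => chartAt E3 p (Ψ y)) x := by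
  rw [← contMDiffAt_iff_contDiffAt]
  exact ((contMDiffOn_chart (n := ∞) (x := p)).contMDiffAt
      ((chartAt E3 p).open_source.mem_nhds hp)).comp x h

theorem contDiffAt_logDeriv (h : ContMDiffAt 𝓘(ℝ, F) (𝓡 3) ∞ Ψ x) :
    ContDiffAt ℝ ∞ (G.logDeriv Ψ) x := by
  set p := Ψ x with hp
  have hps : Ψ x ∈ (chartAt E3 p).source := mem_chart_source _ _
  have hev : ∀ᶠ y in 𝓝 x, ContMDiffAt 𝓘(ℝ, F) (𝓡 3) 1 Ψ y ∧ Ψ y ∈ (chartAt E3 p).source := by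
    refine Filter.Eventually.and ?_ (h.continuousAt.preimage_mem_nhds
      ((chartAt E3 p).open_source.mem_nhds hps))
    obtain ⟨s, hs, hs'⟩ := (contMDiffAt_iff_contMDiffOn_nhds (by simp)).1 (h.of_le (m := 1) (by simp))
    filter_upwards [eventually_mem_nhds_iff.2 hs] with y hy using hs'.contMDiffAt hy
  have hM : ContDiffAt ℝ ∞ (fun y => G.chartFrame p (chartAt E3 p (Ψ y))) x :=
    ContDiffAt.comp (g := G.chartFrame p) x
      ((G.contDiffOn_chartFrame p).contDiffAt ((chartAt E3 p).open_target.mem_nhds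
        ((chartAt E3 p).map_source hps))) (contDiffAt_chart_comp h hps)
  have hinv : ∀ y, Ψ y ∈ (chartAt E3 p).source →
      (G.chartFrame p (chartAt E3 p (Ψ y))).IsInvertible := fun y hy =>
    ContinuousLinearMap.isInvertible_of_bijective
      ((G.isLieFrame_chartFrame p).bijective _ ((chartAt E3 p).map_source hy))
  have hI : ContDiffAt ℝ ∞ (fun y => (G.chartFrame p (chartAt E3 p (Ψ y))).inverse) x := by
    obtain ⟨e, he⟩ := hinv x hps
    exact ContDiffAt.comp x (by rw [← he]; exact contDiffAt_map_inverse e) hM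
  have hD : ContDiffAt ℝ ∞ (fderiv ℝ (fun y => chartAt E3 p (Ψ y))) x :=
    (contDiffAt_chart_comp h hps).fderiv_right (by simp)
  refine (hI.clm_comp hD).congr_of_eventuallyEq ?_
  filter_upwards [hev] with y ⟨hy1, hy2⟩
  have := (hasLogDerivAt_logDeriv (hy1.mdifferentiableAt (by simp))).hasFDerivAt_chart hy2
  rw [this.fderiv, ← ContinuousLinearMap.comp_assoc,
    ContinuousLinearMap.IsInvertible.inverse_comp_self (hinv y hy2), ContinuousLinearMap.id_comp]

/-- The Maurer–Cartan equation `dθ + ½[θ, θ] = 0` for the logarithmic derivative of a map. -/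
theorem maurerCartan {Θ : F → F →L[ℝ] E3} (h : ∀ᶠ y in 𝓝 x, G.HasLogDerivAt Ψ (Θ y) y)
    {Θ' : F →L[ℝ] F →L[ℝ] E3} (hd : HasFDerivAt Θ Θ' x) (u v : F) :
    Θ' u v - Θ' v u + G.br (Θ x u) (Θ x v) = 0 := by
  set p := Ψ x with hp
  have hps : Ψ x ∈ (chartAt E3 p).source := mem_chart_source _ _
  have hx := (chartAt E3 p).map_source hps
  have hc : ContinuousAt Ψ x := HasMFDerivAt.continuousAt h.self_of_nhds
  have h1 : ∀ᶠ y in 𝓝 x, HasFDerivAt (fun y => chartAt E3 p (Ψ y))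
      (G.chartFrame p (chartAt E3 p (Ψ y)) ∘L Θ y) y := by
    filter_upwards [h, hc.preimage_mem_nhds ((chartAt E3 p).open_source.mem_nhds hps)]
      with y hy1 hy2 using hy1.hasFDerivAt_chart hy2
  have hM := ((G.contDiffOn_chartFrame p).contDiffAt ((chartAt E3 p).open_target.mem_nhds
      hx)).differentiableAt (by simp) |>.hasFDerivAt
  have h2 := (hM.comp x h1.self_of_nhds).clm_comp hd
  have h3 := second_derivative_symmetric_of_eventually h1 h2 u v
  have h4 := (G.isLieFrame_chartFrame p).bracket _ hx (Θ x u) (Θ x v)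
  apply ((G.isLieFrame_chartFrame p).bijective _ hx).1
  simp only [map_add, map_sub, map_zero, ← h4]
  simp at h3
  rw [← sub_eq_zero] at h3
  refine Eq.trans ?_ h3
  abel

end LieGroup3

end

/-! ### Coordinates of the second kind -/

noncomputable section

open Set Filter Topology VectorField Metric

namespace LieGroup3

variable (G : LieGroup3.{u})

/-- Left-invariant vector fields have smooth local integral curves through the identity. -/
theorem exists_integralCurve (a : E3) : ∃ ε > 0, ∃ γ : ℝ → G.carrier, γ 0 = 1 ∧
    ∀ t ∈ ball (0 : ℝ) ε, G.HasLogDerivAt γ (ContinuousLinearMap.toSpanSingleton ℝ a) t ∧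
      ContMDiffAt 𝓘(ℝ, ℝ) (𝓡 3) ∞ γ t := by
  set c := chartAt E3 (1 : G.carrier) with hc
  have h1 : (1 : G.carrier) ∈ c.source := mem_chart_source _ _
  have hF := G.isLieFrame_chartFrame 1
  have hx := c.map_source h1
  have hsm : ContDiffOn ℝ ∞ (fun x => G.chartFrame 1 x a) c.target :=
    hF.contDiffOn.clm_apply contDiffOn_const
  obtain ⟨α, hα0, ε, hε, hα⟩ :=
    ((hsm.contDiffAt (hF.isOpen.mem_nhds hx)).of_le
      (m := 1) (by simp)).exists_forall_mem_closedBall_exists_eq_forall_mem_Ioo_hasDerivAt₀ 0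
  have hcont : ContinuousAt α 0 := (hα 0 (by constructor <;> linarith)).continuousAt
  have hev : ∀ᶠ t in 𝓝 (0 : ℝ), α t ∈ c.target :=
    hcont.preimage_mem_nhds (by rw [hα0]; exact c.open_target.mem_nhds hx)
  obtain ⟨δ, hδ, hball⟩ := Metric.eventually_nhds_iff_ball.1 hev
  set η := min (ε / 2) (δ / 2) with hη
  have hη0 : 0 < η := by positivity
  have hηε : η < ε := (min_le_left _ _).trans_lt (by linarith)
  have hηδ : η < δ := (min_le_right _ _).trans_lt (by linarith)
  have hder : ∀ t ∈ Icc (-η) η, HasDerivAt α (G.chartFrame 1 (α t) a) t ∧ α t ∈ c.target := by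
    intro t ht
    refine ⟨hα t ⟨by linarith [ht.1], by linarith [ht.2]⟩, hball t ?_⟩
    rw [Metric.mem_ball, dist_zero_right, Real.norm_eq_abs, abs_lt]
    exact ⟨by linarith [ht.1], by linarith [ht.2]⟩
  have hαs : ContDiffOn ℝ ∞ α (Icc (-η) η) :=
    ODE.contDiffOn_enat_Icc_of_hasDerivWithinAt (n := ⊤) (f := fun _ x => G.chartFrame 1 x a)
      (u := c.target)
      (hsm.comp contDiffOn_snd (fun x hx => hx.2))
      (fun t ht => (hder t ht).1.hasDerivWithinAt) (fun t ht => (hder t ht).2)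
  refine ⟨η, hη0, fun t => c.symm (α t), by simp only [hα0, c.left_inv h1], fun t ht => ?_⟩
  rw [Real.ball_eq_Ioo, zero_sub, zero_add] at ht
  have ht' := Ioo_subset_Icc_self ht
  have hcm : ContMDiffAt 𝓘(ℝ, ℝ) (𝓡 3) ∞ (fun t => c.symm (α t)) t :=
    ContMDiffAt.comp (g := c.symm) t ((contMDiffOn_chart_symm (n := ∞)).contMDiffAt
      (c.open_target.mem_nhds (hder t ht').2))
      (hαs.contDiffAt (Icc_mem_nhds ht.1 ht.2)).contMDiffAt
  refine ⟨hasLogDerivAt_of_hasFDerivAt_chart (p := 1) (c.map_target (hder t ht').2)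
    hcm.continuousAt ?_, hcm⟩
  have he : (fun y => chartAt E3 (1 : G.carrier) (c.symm (α y))) =ᶠ[𝓝 t] α := by
    filter_upwards [Icc_mem_nhds ht.1 ht.2] with y hy using c.right_inv (hder y hy).2
  have hd := (hder t ht').1.hasFDerivAt.congr_of_eventuallyEq he
  rw [he.eq_of_nhds]
  refine hd.congr_fderiv ?_
  ext1
  simp

variable {G}

/-- `Ψ` is a local parametrization of `G` near the identity by coordinates of the second kind
`exp (x₁ a₁) exp (x₂ a₂) exp (x₃ a₃)`; its logarithmic derivative is described by initial values and
linear differential equations. -/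
structure IsSecondKind (G : LieGroup3.{u}) (a₁ a₂ a₃ : E3) (ε : ℝ)
    (Ψ : ℝ × ℝ × ℝ → G.carrier) : Prop where
  smooth : ∀ x ∈ ball (0 : ℝ × ℝ × ℝ) ε, ContMDiffAt 𝓘(ℝ, ℝ × ℝ × ℝ) (𝓡 3) ∞ Ψ x
  third : ∀ x ∈ ball (0 : ℝ × ℝ × ℝ) ε, G.logDeriv Ψ x (0, 0, 1) = a₃
  second : ∀ x y, (x, y, (0 : ℝ)) ∈ ball (0 : ℝ × ℝ × ℝ) ε →
    G.logDeriv Ψ (x, y, 0) (0, 1, 0) = a₂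
  first : ∀ x, (x, (0 : ℝ), (0 : ℝ)) ∈ ball (0 : ℝ × ℝ × ℝ) ε →
    G.logDeriv Ψ (x, 0, 0) (1, 0, 0) = a₁
  ode_third : ∀ v, v = (0, 1, 0) ∨ v = (1, 0, 0) → ∀ x y z, (x, y, z) ∈ ball (0 : ℝ × ℝ × ℝ) ε →
    HasDerivAt (fun t => G.logDeriv Ψ (x, y, t) v) (-G.br a₃ (G.logDeriv Ψ (x, y, z) v)) z
  ode_second : ∀ x y, (x, y, (0 : ℝ)) ∈ ball (0 : ℝ × ℝ × ℝ) ε →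
    HasDerivAt (fun t => G.logDeriv Ψ (x, t, 0) (1, 0, 0))
      (-G.br a₂ (G.logDeriv Ψ (x, y, 0) (1, 0, 0))) y

theorem mem_ball_prod3 {x y z ε : ℝ} : (x, y, z) ∈ ball (0 : ℝ × ℝ × ℝ) ε ↔
    x ∈ ball (0 : ℝ) ε ∧ y ∈ ball (0 : ℝ) ε ∧ z ∈ ball (0 : ℝ) ε := by
  simp [Prod.norm_def]

theorem hasDerivAt_clm_comp {F E : Type*} [NormedAddCommGroup F] [NormedSpace ℝ F]
    [NormedAddCommGroup E] [NormedSpace ℝ E] {θ : F → F →L[ℝ] E} {θ' : F →L[ℝ] F →L[ℝ] E}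
    {c : ℝ → F} {c' : F} {t : ℝ} (h : HasFDerivAt θ θ' (c t)) (hc : HasDerivAt c c' t) (v : F) :
    HasDerivAt (fun s => θ (c s) v) (θ' c' v) t := by
  have := (h.comp_hasDerivAt t hc).clm_apply (hasDerivAt_const t v)
  simpa using this

theorem hasDerivAt_curve_third (x y z : ℝ) :
    HasDerivAt (fun t : ℝ => (x, y, t)) ((0 : ℝ), (0 : ℝ), (1 : ℝ)) z :=
  (hasDerivAt_const z x).prodMk ((hasDerivAt_const z y).prodMk (hasDerivAt_id z))

theorem hasDerivAt_curve_second (x y z : ℝ) :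
    HasDerivAt (fun t : ℝ => (x, t, z)) ((0 : ℝ), (1 : ℝ), (0 : ℝ)) y :=
  (hasDerivAt_const y x).prodMk ((hasDerivAt_id y).prodMk (hasDerivAt_const y z))

theorem hasDerivAt_curve_first (x y z : ℝ) :
    HasDerivAt (fun t : ℝ => (t, y, z)) ((1 : ℝ), (0 : ℝ), (0 : ℝ)) x :=
  (hasDerivAt_id x).prodMk ((hasDerivAt_const x y).prodMk (hasDerivAt_const x z))

theorem exists_isSecondKind (a₁ a₂ a₃ : E3) : ∃ ε > 0, ∃ Ψ, IsSecondKind G a₁ a₂ a₃ ε Ψ := by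
  obtain ⟨ε₁, h₁, γ₁, hγ₁, H₁⟩ := G.exists_integralCurve a₁
  obtain ⟨ε₂, h₂, γ₂, hγ₂, H₂⟩ := G.exists_integralCurve a₂
  obtain ⟨ε₃, h₃, γ₃, hγ₃, H₃⟩ := G.exists_integralCurve a₃
  obtain ⟨ε, hε, hε₁, hε₂, hε₃⟩ : ∃ ε > 0, ε ≤ ε₁ ∧ ε ≤ ε₂ ∧ ε ≤ ε₃ :=
    ⟨min ε₁ (min ε₂ ε₃), by positivity, by simp, by simp, by simp⟩
  set Ψ : ℝ × ℝ × ℝ → G.carrier := fun x => γ₁ x.1 * γ₂ x.2.1 * γ₃ x.2.2 with hΨ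
  have hsm : ∀ x ∈ ball (0 : ℝ × ℝ × ℝ) ε, ContMDiffAt 𝓘(ℝ, ℝ × ℝ × ℝ) (𝓡 3) ∞ Ψ x := by
    rintro ⟨x, y, z⟩ hx
    obtain ⟨hx, hy, hz⟩ := mem_ball_prod3.1 hx
    refine ContMDiffAt.mul (ContMDiffAt.mul ?_ ?_) ?_
    · exact ContMDiffAt.comp (g := γ₁) (x, y, z) (H₁ x (ball_subset_ball hε₁ hx)).2
        (contDiff_fst.contMDiff.contMDiffAt)
    · exact ContMDiffAt.comp (g := γ₂) (f := fun x : ℝ × ℝ × ℝ => x.2.1) (x, y, z)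
        (H₂ y (ball_subset_ball hε₂ hy)).2
        ((contDiff_fst.comp contDiff_snd).contMDiff.contMDiffAt)
    · exact ContMDiffAt.comp (g := γ₃) (f := fun x : ℝ × ℝ × ℝ => x.2.2) (x, y, z)
        (H₃ z (ball_subset_ball hε₃ hz)).2
        ((contDiff_snd.comp contDiff_snd).contMDiff.contMDiffAt)
  have hlog : ∀ x ∈ ball (0 : ℝ × ℝ × ℝ) ε, G.HasLogDerivAt Ψ (G.logDeriv Ψ x) x :=
    fun x hx => hasLogDerivAt_logDeriv ((hsm x hx).mdifferentiableAt (by simp))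
  have third : ∀ x ∈ ball (0 : ℝ × ℝ × ℝ) ε, G.logDeriv Ψ x (0, 0, 1) = a₃ := by
    rintro ⟨x, y, z⟩ hx
    have hz := (mem_ball_prod3.1 hx).2.2
    have e1 := ((H₃ z (ball_subset_ball hε₃ hz)).1.mul_left (γ₁ x * γ₂ y))
    have e2 := (hlog _ hx).comp (f := fun t : ℝ => (x, y, t))
      ((hasFDerivAt_const x z).prodMk ((hasFDerivAt_const y z).prodMk (hasFDerivAt_id z)))
    have := DFunLike.congr_fun (e2.unique e1) 1
    simpa using this
  have second : ∀ x y, (x, y, (0 : ℝ)) ∈ ball (0 : ℝ × ℝ × ℝ) ε →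
      G.logDeriv Ψ (x, y, 0) (0, 1, 0) = a₂ := by
    intro x y hx
    have hy := (mem_ball_prod3.1 hx).2.1
    have e1 := ((H₂ y (ball_subset_ball hε₂ hy)).1.mul_left (γ₁ x))
    have e2 := (hlog _ hx).comp (f := fun t : ℝ => (x, t, (0 : ℝ)))
      ((hasFDerivAt_const x y).prodMk ((hasFDerivAt_id y).prodMk (hasFDerivAt_const 0 y)))
    have e3 : Ψ ∘ (fun t : ℝ => (x, t, (0 : ℝ))) = fun t => γ₁ x * γ₂ t := by
      ext; simp [hΨ, hγ₃]
    rw [e3] at e2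
    have := DFunLike.congr_fun (e2.unique e1) 1
    simpa using this
  have first : ∀ x, (x, (0 : ℝ), (0 : ℝ)) ∈ ball (0 : ℝ × ℝ × ℝ) ε →
      G.logDeriv Ψ (x, 0, 0) (1, 0, 0) = a₁ := by
    intro x hx
    have e1 := (H₁ x (ball_subset_ball hε₁ (mem_ball_prod3.1 hx).1)).1
    have e2 := (hlog _ hx).comp (f := fun t : ℝ => (t, (0 : ℝ), (0 : ℝ)))
      ((hasFDerivAt_id x).prodMk ((hasFDerivAt_const 0 x).prodMk (hasFDerivAt_const 0 x)))
    have e3 : Ψ ∘ (fun t : ℝ => (t, (0 : ℝ), (0 : ℝ))) = γ₁ := by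
      ext; simp [hΨ, hγ₂, hγ₃]
    rw [e3] at e2
    have := DFunLike.congr_fun (e2.unique e1) 1
    simpa using this
  have hd : ∀ x ∈ ball (0 : ℝ × ℝ × ℝ) ε,
      HasFDerivAt (G.logDeriv Ψ) (fderiv ℝ (G.logDeriv Ψ) x) x := fun x hx =>
    ((contDiffAt_logDeriv (hsm x hx)).differentiableAt (by simp)).hasFDerivAt
  have mc : ∀ x ∈ ball (0 : ℝ × ℝ × ℝ) ε, ∀ u v, fderiv ℝ (G.logDeriv Ψ) x u v -
      fderiv ℝ (G.logDeriv Ψ) x v u + G.br (G.logDeriv Ψ x u) (G.logDeriv Ψ x v) = 0 :=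
    fun x hx => maurerCartan (by
      filter_upwards [isOpen_ball.mem_nhds hx] with y hy using hlog y hy) (hd x hx)
  obtain ⟨θ, hθ⟩ : ∃ θ, θ = G.logDeriv Ψ := ⟨_, rfl⟩
  rw [← hθ] at hd mc third second first
  refine ⟨ε, hε, Ψ, hsm, ?_, ?_, ?_, ?_, ?_⟩ <;> rw [← hθ]
  · exact third
  · exact second
  · exact first
  · intro v hv x y z hx
    have e1 := hasDerivAt_clm_comp (hd _ hx) (hasDerivAt_curve_third x y z) v
    have e2 := mc _ hx (0, 0, 1) v
    -- the last component is constant, so its derivative drops out of the Maurer–Cartan equation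
    have e3 : fderiv ℝ θ (x, y, z) v (0, 0, 1) = 0 := by
      have c1 := (hd _ hx).clm_apply (hasFDerivAt_const ((0, 0, 1) : ℝ × ℝ × ℝ) (x, y, z))
      have c2 : (fun y => θ y (0, 0, 1)) =ᶠ[𝓝 (x, y, z)] fun _ => a₃ := by
        filter_upwards [isOpen_ball.mem_nhds hx] with y hy using third y hy
      have c3 := c1.unique ((hasFDerivAt_const a₃ _).congr_of_eventuallyEq c2)
      simpa using DFunLike.congr_fun c3 v
    rw [e3, third _ hx, sub_zero] at e2
    rw [← eq_neg_of_add_eq_zero_left e2]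
    exact e1
  · intro x y hx
    have e1 := hasDerivAt_clm_comp (hd _ hx) (hasDerivAt_curve_second x y 0) (1, 0, 0)
    have e2 := mc _ hx (0, 1, 0) (1, 0, 0)
    -- likewise for the second component on the plane where the last coordinate vanishes
    have e3 : fderiv ℝ θ (x, y, 0) (1, 0, 0) (0, 1, 0) = 0 := by
      have c1 := hasDerivAt_clm_comp (hd _ hx) (hasDerivAt_curve_first x y 0) (0, 1, 0)
      have c2 : (fun t => θ (t, y, 0) (0, 1, 0)) =ᶠ[𝓝 x] fun _ => a₂ := by
        obtain ⟨b1, b2, b3⟩ := mem_ball_prod3.1 hx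
        filter_upwards [isOpen_ball.mem_nhds b1] with t ht
          using second t y (mem_ball_prod3.2 ⟨ht, b2, b3⟩)
      have c3 := c1.unique ((hasDerivAt_const x a₂).congr_of_eventuallyEq c2)
      exact c3
    rw [e3, second _ _ hx, sub_zero] at e2
    rw [← eq_neg_of_add_eq_zero_left e2]
    exact e1

/-- Uniqueness for linear differential equations with constant coefficients. -/
theorem eqOn_of_hasDerivAt_linear {A : E3 →L[ℝ] E3} {f g : ℝ → E3} {ε : ℝ}
    (hf : ∀ t ∈ ball (0 : ℝ) ε, HasDerivAt f (-A (f t)) t)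
    (hg : ∀ t ∈ ball (0 : ℝ) ε, HasDerivAt g (-A (g t)) t) (h : f 0 = g 0) {t : ℝ}
    (ht : t ∈ ball (0 : ℝ) ε) : f t = g t := by
  rw [Real.ball_eq_Ioo] at *
  refine ODE_solution_unique_of_mem_Ioo (v := fun _ x => (-A) x) (s := fun _ => univ)
    (K := ‖-A‖₊) (t₀ := 0)
    (fun t _ => (-A).lipschitz.lipschitzOnWith) ?_ (fun t ht => ⟨hf t ht, mem_univ _⟩)
    (fun t ht => ⟨hg t ht, mem_univ _⟩) h ht
  exact ⟨by linarith [ht.1, ht.2], by linarith [ht.1, ht.2]⟩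

/-- Comparison of coordinates of the second kind on two groups. The family `Q` intertwines the
equations along the last coordinate, driven by `ad b₃` and `ad a₃`; the curve `z` solves the equation
along the second coordinate, and `Q 0` has to map it to a solution of the other one. -/
theorem IsSecondKind.logDeriv_eq {H : LieGroup3.{v}} {a₁ a₂ a₃ b₁ b₂ b₃ : E3} {ε : ℝ}
    {Ψ : ℝ × ℝ × ℝ → G.carrier} {Φ : ℝ × ℝ × ℝ → H.carrier} (hΨ : IsSecondKind G a₁ a₂ a₃ ε Ψ)
    (hΦ : IsSecondKind H b₁ b₂ b₃ ε Φ) (Q : ℝ → E3 →L[ℝ] E3) (h₁ : Q 0 b₁ = a₁) (h₂ : Q 0 b₂ = a₂)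
    (h₃ : ∀ t, Q t b₃ = a₃)
    (hQ : ∀ t, HasDerivAt Q (Q t ∘L H.br b₃ - G.br a₃ ∘L Q t) t)
    (z : ℝ → E3) (hz : z 0 = b₁) (hz₁ : ∀ t, HasDerivAt z (-H.br b₂ (z t)) t)
    (hz₂ : ∀ t, HasDerivAt (fun t => Q 0 (z t)) (-G.br a₂ (Q 0 (z t))) t)
    {x : ℝ × ℝ × ℝ} (hx : x ∈ ball (0 : ℝ × ℝ × ℝ) ε) :
    G.logDeriv Ψ x = Q x.2.2 ∘L H.logDeriv Φ x := by
  obtain ⟨x, y, t⟩ := x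
  obtain ⟨hx1, hx2, hx3⟩ := mem_ball_prod3.1 hx
  have h0 : (0 : ℝ) ∈ ball (0 : ℝ) ε := mem_ball_self (dist_nonneg.trans_lt (mem_ball.1 hx1))
  have key : ∀ v, v = (0, 1, 0) ∨ v = (1, 0, 0) →
      G.logDeriv Ψ (x, y, 0) v = Q 0 (H.logDeriv Φ (x, y, 0) v) →
      G.logDeriv Ψ (x, y, t) v = Q t (H.logDeriv Φ (x, y, t) v) := by
    intro v hv h
    refine eqOn_of_hasDerivAt_linear (A := G.br a₃)
      (g := fun t => Q t (H.logDeriv Φ (x, y, t) v))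
      (fun t ht => hΨ.ode_third v hv x y t (mem_ball_prod3.2 ⟨hx1, hx2, ht⟩)) (fun t ht => ?_) h hx3
    have := (hQ t).clm_apply (hΦ.ode_third v hv x y t (mem_ball_prod3.2 ⟨hx1, hx2, ht⟩))
    refine this.congr_deriv ?_
    simp
    abel
  have e2 := key (0, 1, 0) (Or.inl rfl) (by
    rw [hΨ.second _ _ (mem_ball_prod3.2 ⟨hx1, hx2, h0⟩),
      hΦ.second _ _ (mem_ball_prod3.2 ⟨hx1, hx2, h0⟩), h₂])
  have e1 := key (1, 0, 0) (Or.inr rfl) (by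
    have c1 : H.logDeriv Φ (x, y, 0) (1, 0, 0) = z y :=
      eqOn_of_hasDerivAt_linear (f := fun y => H.logDeriv Φ (x, y, 0) (1, 0, 0))
        (fun t ht => hΦ.ode_second x t (mem_ball_prod3.2 ⟨hx1, ht, h0⟩)) (fun t _ => hz₁ t)
        (by rw [hz, ← hΦ.first x (mem_ball_prod3.2 ⟨hx1, h0, h0⟩)]) hx2
    have c2 : G.logDeriv Ψ (x, y, 0) (1, 0, 0) = Q 0 (z y) :=
      eqOn_of_hasDerivAt_linear (f := fun y => G.logDeriv Ψ (x, y, 0) (1, 0, 0))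
        (fun t ht => hΨ.ode_second x t (mem_ball_prod3.2 ⟨hx1, ht, h0⟩)) (fun t _ => hz₂ t)
        (by rw [hz, h₁, ← hΨ.first x (mem_ball_prod3.2 ⟨hx1, h0, h0⟩)]) hx2
    rw [c1, c2])
  have e3 : G.logDeriv Ψ (x, y, t) (0, 0, 1) = Q t (H.logDeriv Φ (x, y, t) (0, 0, 1)) := by
    rw [hΨ.third _ hx, hΦ.third _ hx, h₃]
  refine ContinuousLinearMap.ext fun ⟨v₁, v₂, v₃⟩ => ?_
  have hv : ((v₁, v₂, v₃) : ℝ × ℝ × ℝ) =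
      v₁ • (1, 0, 0) + v₂ • (0, 1, 0) + v₃ • (0, 0, 1) := by simp
  rw [hv]
  simp only [map_add, map_smul, ContinuousLinearMap.comp_apply, e1, e2, e3]

end LieGroup3

end

/-! ### Local isometries from maps with prescribed logarithmic derivatives -/

noncomputable section

open Set Filter Topology VectorField Metric

namespace LieGroup3

instance (G : LieGroup3.{u}) : IsTopologicalGroup G.carrier :=
  topologicalGroup_of_lieGroup (𝓡 3) ∞

variable {G : LieGroup3.{u}} {F : Type*} [NormedAddCommGroup F] [NormedSpace ℝ F]

/-- The inverse function theorem for maps into `G`. -/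
theorem exists_openPartialHomeomorph [CompleteSpace F] {Ψ : F → G.carrier} {U : Set F} {x : F}
    (hU : IsOpen U) (hx : x ∈ U) (hΨ : ∀ y ∈ U, ContMDiffAt 𝓘(ℝ, F) (𝓡 3) ∞ Ψ y)
    (hb : Function.Bijective (G.logDeriv Ψ x)) :
    ∃ e : OpenPartialHomeomorph F G.carrier, x ∈ e.source ∧ e.source ⊆ U ∧ EqOn e Ψ e.source ∧
      ContMDiffOn (𝓡 3) 𝓘(ℝ, F) ∞ e.symm e.target := by
  set c := chartAt E3 (Ψ x) with hc
  have hs : Ψ x ∈ c.source := mem_chart_source _ _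
  set f : F → E3 := fun y => c (Ψ y) with hf
  have hlog : G.HasLogDerivAt Ψ (G.logDeriv Ψ x) x :=
    hasLogDerivAt_logDeriv ((hΨ x hx).mdifferentiableAt (by simp))
  have hd := hlog.hasFDerivAt_chart hs
  have hbij : Function.Bijective (G.chartFrame (Ψ x) (c (Ψ x)) ∘L G.logDeriv Ψ x) :=
    ((G.isLieFrame_chartFrame (Ψ x)).bijective _ (c.map_source hs)).comp hb
  set f' : F ≃L[ℝ] E3 := ContinuousLinearEquiv.ofBijective
    (G.chartFrame (Ψ x) (c (Ψ x)) ∘L G.logDeriv Ψ x)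
    (LinearMap.ker_eq_bot.2 hbij.1) (LinearMap.range_eq_top.2 hbij.2) with hf'
  have hd' : HasFDerivAt f (f' : F →L[ℝ] E3) x := by
    rw [hf', ContinuousLinearEquiv.coe_ofBijective]; exact hd
  have hsm : ContDiffAt ℝ ∞ f x := contDiffAt_chart_comp (hΨ x hx) hs
  set e := hsm.toOpenPartialHomeomorph f hd' (by simp) with he
  have hinv : ∀ᶠ y in 𝓝 x, fderiv ℝ f y ∈ range ((↑) : (F ≃L[ℝ] E3) → F →L[ℝ] E3) := by
    have h1 : ContinuousAt (fderiv ℝ f) x := (hsm.fderiv_right (m := ∞) (by simp)).continuousAt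
    refine h1.preimage_mem_nhds ?_
    rw [hd'.fderiv]
    exact ContinuousLinearEquiv.nhds f'
  have hsrc : ∀ᶠ y in 𝓝 x, Ψ y ∈ c.source :=
    (hΨ x hx).continuousAt.preimage_mem_nhds (c.open_source.mem_nhds hs)
  obtain ⟨W, hW, hWo, hxW⟩ := _root_.eventually_nhds_iff.1 (hinv.and (hsrc.and (hU.mem_nhds hx)))
  set e₁ := (e.restrOpen W hWo).trans c.symm with he₁
  have hcoe : ∀ y, e y = f y := fun y => rfl
  have hsource : ∀ y ∈ e₁.source, y ∈ e.source ∧ y ∈ W := by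
    intro y hy
    simpa using hy.1
  refine ⟨e₁, ?_, fun y hy => (hW y (hsource y hy).2).2.2, fun y hy => ?_, ?_⟩
  · have h1 : x ∈ e.source := hsm.mem_toOpenPartialHomeomorph_source hd' (by simp)
    simp only [he₁, OpenPartialHomeomorph.trans_source, OpenPartialHomeomorph.restrOpen_source,
      OpenPartialHomeomorph.symm_source, mem_inter_iff, mem_preimage]
    exact ⟨⟨h1, hxW⟩, c.map_source hs⟩
  · exact c.left_inv (hW y (hsource y hy).2).2.1
  · intro g hg
    have hg1 : g ∈ c.source := hg.1
    have hg2 : c g ∈ (e.restrOpen W hWo).target := hg.2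
    have hy := (e.restrOpen W hWo).map_target hg2
    rw [OpenPartialHomeomorph.restrOpen_source] at hy
    set y := (e.restrOpen W hWo).symm (c g) with hyd
    have hg3 : c g ∈ e.target := by
      have := e.map_source hy.1
      have h4 := (e.restrOpen W hWo).right_inv hg2
      rw [← hyd] at h4
      rwa [show e y = c g from h4] at this
    obtain ⟨f₁, hf₁⟩ := (hW y hy.2).1
    have hys : ContDiffAt ℝ ∞ f y := by
      rw [← contMDiffAt_iff_contDiffAt]
      exact ((contMDiffOn_chart (n := ∞) (x := Ψ x)).contMDiffAt
        (c.open_source.mem_nhds (hW y hy.2).2.1)).comp y (hΨ y (hW y hy.2).2.2)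
    have h5 : ContDiffAt ℝ ∞ e.symm (c g) :=
      e.contDiffAt_symm hg3 (f₀' := f₁) (by
        rw [hf₁]; exact (hys.differentiableAt (by simp)).hasFDerivAt) hys
    exact (h5.contMDiffAt.comp g ((contMDiffOn_chart (n := ∞) (x := Ψ x)).contMDiffAt
        (c.open_source.mem_nhds hg1))).contMDiffWithinAt

end LieGroup3

namespace LeftInvariantSR

variable {G : LieGroup3.{u}} {H : LieGroup3.{v}} {S : LeftInvariantSR G} {T : LeftInvariantSR H}

/-- By homogeneity of the source, a single local isometry is enough. -/
theorem locallyIsometric_of_exists (φ : OpenPartialHomeomorph G.carrier H.carrier)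
    (hne : φ.source.Nonempty) (h1 : ContMDiffOn (𝓡 3) (𝓡 3) ∞ φ φ.source)
    (h2 : ContMDiffOn (𝓡 3) (𝓡 3) ∞ φ.symm φ.target)
    (h3 : ∀ q ∈ φ.source, S.IsIsometricAt T φ q) : S.LocallyIsometric T := by
  obtain ⟨q₀, hq₀⟩ := hne
  intro p
  set g := q₀ * p⁻¹ with hg
  have hmul : ∀ q, (Homeomorph.mulLeft g) q = g * q := fun q => rfl
  refine ⟨(Homeomorph.mulLeft g).toOpenPartialHomeomorph.trans φ, ?_, ?_, ?_, ?_⟩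
  · simp [hg, hq₀]
  · refine h1.comp (contMDiff_mul_left (I := 𝓡 3) (n := ∞) (a := g)).contMDiffOn ?_
    intro q hq
    simpa using hq
  · refine (contMDiff_mul_left (I := 𝓡 3) (n := ∞) (a := g⁻¹)).contMDiffOn.comp
      (t := univ) (h2.mono ?_) (fun _ _ => mem_univ _)
    intro q hq
    simpa using hq
  · intro q hq
    have hq' : g * q ∈ φ.source := by simpa [hmul] using hq
    obtain ⟨A, hA, hm⟩ := h3 (g * q) hq'
    refine ⟨A, fun v => ?_, hm⟩
    have e1 : MDifferentiableAt (𝓡 3) (𝓡 3) φ (g * q) :=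
      (h1.contMDiffAt (φ.open_source.mem_nhds hq')).mdifferentiableAt (by simp)
    have e2 := mfderiv_comp (I := 𝓡 3) (I' := 𝓡 3) (I'' := 𝓡 3) q e1 (G.mdifferentiable_mul_left g q)
    have e3 := DFunLike.congr_fun (G.mfderiv_mul_left_dL g q) (v : G.Lie)
    refine Eq.trans (DFunLike.congr_fun e2 (mulInvariantVectorField (v : G.Lie) q)) ?_
    refine Eq.trans ?_ (hA v)
    exact congrArg (mfderiv (𝓡 3) (𝓡 3) φ (g * q)) e3

theorem LocallyIsometric.symm (h : S.LocallyIsometric T) : T.LocallyIsometric S := by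
  obtain ⟨φ, hp, h1, h2, h3⟩ := h 1
  refine locallyIsometric_of_exists φ.symm ⟨φ 1, φ.map_source hp⟩ h2 (by simpa using h1) ?_
  intro r hr
  obtain ⟨A, hA, hm⟩ := h3 (φ.symm r) (φ.map_target hr)
  refine ⟨A.symm, fun w => ?_, fun v w => by rw [← hm]; simp⟩
  have d1 : MDifferentiableAt (𝓡 3) (𝓡 3) φ (φ.symm r) :=
    (h1.contMDiffAt (φ.open_source.mem_nhds (φ.map_target hr))).mdifferentiableAt (by simp)
  have hrr := φ.right_inv hr
  have d2 : MDifferentiableAt (𝓡 3) (𝓡 3) φ.symm (φ (φ.symm r)) := by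
    rw [hrr]
    exact (h2.contMDiffAt (φ.open_target.mem_nhds hr)).mdifferentiableAt (by simp)
  have d3 := mfderiv_comp (I := 𝓡 3) (I' := 𝓡 3) (I'' := 𝓡 3) _ d2 d1
  have d4 : φ.symm ∘ φ =ᶠ[𝓝 (φ.symm r)] id := by
    filter_upwards [φ.open_source.mem_nhds (φ.map_target hr)] with q hq using φ.left_inv hq
  rw [d4.mfderiv_eq, mfderiv_id] at d3
  have d5 := hA (A.symm w)
  rw [LinearEquiv.apply_symm_apply, hrr] at d5
  rw [hrr] at d3
  have d6 := DFunLike.congr_fun d3 (mulInvariantVectorField ((A.symm w : S.dist) : G.Lie) (φ.symm r))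
  refine Eq.trans ?_ d6.symm
  exact congrArg (mfderiv (𝓡 3) (𝓡 3) φ.symm r) d5.symm

variable {F : Type*} [NormedAddCommGroup F] [NormedSpace ℝ F] [CompleteSpace F]

open LieGroup3 in
/-- Two parametrizations whose logarithmic derivatives correspond under isometries of the
distributions give a local isometry. -/
theorem locallyIsometric_of_logDeriv {Φ : F → G.carrier} {Ψ : F → H.carrier} {U : Set F} {x : F}
    (hU : IsOpen U) (hx : x ∈ U) (hΦ : ∀ y ∈ U, ContMDiffAt 𝓘(ℝ, F) (𝓡 3) ∞ Φ y)
    (hΨ : ∀ y ∈ U, ContMDiffAt 𝓘(ℝ, F) (𝓡 3) ∞ Ψ y)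
    (hbΦ : Function.Bijective (G.logDeriv Φ x)) (hbΨ : Function.Bijective (H.logDeriv Ψ x))
    (hQ : ∀ y ∈ U, ∃ Q : E3 →L[ℝ] E3, H.logDeriv Ψ y = Q ∘L G.logDeriv Φ y ∧
      ∃ A : S.dist ≃ₗ[ℝ] T.dist, (∀ v, ((A v : H.Lie) : E3) = Q (v : G.Lie)) ∧
        ∀ v w, T.metric (A v) (A w) = S.metric v w) :
    S.LocallyIsometric T := by
  -- shrink so that the logarithmic derivative of `Φ` is surjective throughout
  obtain ⟨f₀, hf₀⟩ : ∃ f₀ : F ≃L[ℝ] E3, (f₀ : F →L[ℝ] E3) = G.logDeriv Φ x :=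
    ⟨ContinuousLinearEquiv.ofBijective (G.logDeriv Φ x)
      (LinearMap.ker_eq_bot.2 hbΦ.1) (LinearMap.range_eq_top.2 hbΦ.2), ContinuousLinearEquiv.coe_ofBijective _ _ _⟩
  have hinv : ∀ᶠ y in 𝓝 x, G.logDeriv Φ y ∈ range ((↑) : (F ≃L[ℝ] E3) → F →L[ℝ] E3) :=
    (contDiffAt_logDeriv (hΦ x hx)).continuousAt.preimage_mem_nhds
      (by rw [← hf₀]; exact ContinuousLinearEquiv.nhds f₀)
  obtain ⟨W, hW, hWo, hxW⟩ := _root_.eventually_nhds_iff.1 (hinv.and (hU.mem_nhds hx))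
  obtain ⟨e, hxe, heW, hee, hes⟩ := exists_openPartialHomeomorph hWo hxW
    (fun y hy => hΦ y (hW y hy).2) hbΦ
  obtain ⟨e', hxe', heW', hee', hes'⟩ := exists_openPartialHomeomorph hWo hxW
    (fun y hy => hΨ y (hW y hy).2) hbΨ
  have hsΦ : ContMDiffOn 𝓘(ℝ, F) (𝓡 3) ∞ e e.source :=
    ContMDiffOn.congr (fun y hy => (hΦ y (hW y (heW hy)).2).contMDiffWithinAt) hee
  have hsΨ : ContMDiffOn 𝓘(ℝ, F) (𝓡 3) ∞ e' e'.source :=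
    ContMDiffOn.congr (fun y hy => (hΨ y (hW y (heW' hy)).2).contMDiffWithinAt) hee'
  have h1 : ContMDiffOn (𝓡 3) (𝓡 3) ∞ (e.symm.trans e') (e.symm.trans e').source :=
    hsΨ.comp (hes.mono (fun q hq => hq.1)) (fun q hq => hq.2)
  have h2 : ContMDiffOn (𝓡 3) (𝓡 3) ∞ (e.symm.trans e').symm (e.symm.trans e').target := by
    refine hsΦ.comp (hes'.mono (fun q hq => hq.1)) (fun q hq => ?_)
    simpa using hq.2
  refine locallyIsometric_of_exists (e.symm.trans e') ⟨e x, ?_⟩ h1 h2 ?_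
  · simp [hxe, hxe']
  intro q hq
  set y := e.symm q with hy
  have hye : y ∈ e.source := e.map_target hq.1
  have hye' : y ∈ e'.source := hq.2
  have hqy : Φ y = q := by rw [← hee hye]; exact e.right_inv hq.1
  obtain ⟨Q, hQ1, A, hA, hm⟩ := hQ y (hW y (heW hye)).2
  obtain ⟨f, hf⟩ := (hW y (heW hye)).1
  refine ⟨A, fun v => ?_, hm⟩
  obtain ⟨u, hu⟩ := f.surjective (v : G.Lie)
  have hu' : G.logDeriv Φ y u = (v : G.Lie) := by rw [← hf]; exact hu
  have d1 : G.HasLogDerivAt Φ (G.logDeriv Φ y) y :=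
    hasLogDerivAt_logDeriv ((hΦ y (hW y (heW hye)).2).mdifferentiableAt (by simp))
  have d2 : H.HasLogDerivAt Ψ (H.logDeriv Ψ y) y :=
    hasLogDerivAt_logDeriv ((hΨ y (hW y (heW hye)).2).mdifferentiableAt (by simp))
  have d3 : MDifferentiableAt (𝓡 3) (𝓡 3) (e.symm.trans e') (Φ y) := by
    rw [hqy]
    exact (h1.contMDiffAt ((e.symm.trans e').open_source.mem_nhds hq)).mdifferentiableAt (by simp)
  have d4 := d3.hasMFDerivAt.comp y d1
  have d5 : Ψ =ᶠ[𝓝 y] (e.symm.trans e') ∘ Φ := by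
    filter_upwards [e.open_source.mem_nhds hye, e'.open_source.mem_nhds hye'] with z hz hz'
    simp [← hee hz, hz, hee' hz']
  have d6 := hasMFDerivAt_unique (d4.congr_of_eventuallyEq d5) d2
  have d7 := DFunLike.congr_fun d6 u
  have d8 : (mfderiv (𝓡 3) (𝓡 3) (e.symm.trans e') (Φ y) : E3 →L[ℝ] E3) (G.dL (Φ y) (v : G.Lie)) =
      H.dL (Ψ y) (A v : H.Lie) := by
    rw [hA, ← hu', ← ContinuousLinearMap.comp_apply Q, ← hQ1]
    exact d7
  have d9 : (e.symm.trans e') q = Ψ y := by rw [d5.eq_of_nhds, ← hqy]; rfl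
  rw [d9, ← hqy]
  exact d8

end LeftInvariantSR

end

/-! ### Rigidity of canonical frames -/

noncomputable section

open Set Filter Topology VectorField

/-- The derivation of functions along a frame represents the Lie algebra. -/
theorem IsLieFrame.commutator {B : E3 →L[ℝ] E3 →L[ℝ] E3} {U : Set E3} {M : E3 → E3 →L[ℝ] E3}
    (hM : IsLieFrame B U M) {W : Type*} [NormedAddCommGroup W] [NormedSpace ℝ W] {F : E3 → W}
    {x : E3} (hx : x ∈ U) (hF : ContDiffAt ℝ ∞ F x) (a b : E3) :
    fderiv ℝ (fun y => fderiv ℝ F y (M y b)) x (M x a) -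
      fderiv ℝ (fun y => fderiv ℝ F y (M y a)) x (M x b) = fderiv ℝ F x (M x (B a b)) := by
  have hd : DifferentiableAt ℝ M x :=
    (hM.contDiffOn.contDiffAt (hM.isOpen.mem_nhds hx)).differentiableAt (by simp)
  have hv : ∀ v, HasFDerivAt (fun y => M y v) ((fderiv ℝ M x).flip v) x := fun v => by
    have := hd.hasFDerivAt.clm_apply (hasFDerivAt_const v x)
    simpa using this
  have h := fderiv_apply_lieBracket (V := fun y => M y a) (W := fun y => M y b) hF
    (by rw [minSmoothness_of_isRCLikeNormedField]; exact two_le_infty) (hv b).differentiableAt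
    (hv a).differentiableAt
  rw [← h, lieBracket, (hv a).fderiv, (hv b).fderiv, ← hM.bracket x hx]
  rfl

/-- Let `ψ` be the Lie algebra valued coframe obtained by transporting a Lie frame to a second Lie
algebra by a local diffeomorphism, so that `ψ` satisfies the Maurer–Cartan equation `hMC`. If `ψ`
rotates the horizontal vectors `f₁, f₂` to `g₁, g₂` (at each point by some angle with cosine `c` and
sine `s`), and both frames are in canonical form, then the invariants of the two frames agree. -/
theorem IsLieFrame.rigidity {B B' : E3 →L[ℝ] E3 →L[ℝ] E3} {U : Set E3} {M : E3 → E3 →L[ℝ] E3}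
    (hM : IsLieFrame B U M) {x₀ : E3} (hx₀ : x₀ ∈ U) {f₀ f₁ f₂ g₀ g₁ g₂ : E3}
    {χ w a₁ a₂ χ' w' a₁' a₂' : ℝ} (hχ : 0 ≤ χ) (hχ' : 0 ≤ χ')
    (hf₁₀ : B f₁ f₀ = (χ + w) • f₂) (hf₂₀ : B f₂ f₀ = (χ - w) • f₁)
    (hf₂₁ : B f₂ f₁ = a₁ • f₁ + a₂ • f₂ + f₀)
    (halt : ∀ v, B' v v = 0)
    (hg₁₀ : B' g₁ g₀ = (χ' + w') • g₂) (hg₂₀ : B' g₂ g₀ = (χ' - w') • g₁)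
    (hg₂₁ : B' g₂ g₁ = a₁' • g₁ + a₂' • g₂ + g₀)
    {k₀ k₁ k₂ : E3 →L[ℝ] ℝ} (hk : ∀ v, v = k₀ v • g₀ + k₁ v • g₁ + k₂ v • g₂)
    (h00 : k₀ g₀ = 1) (h01 : k₀ g₁ = 0) (h02 : k₀ g₂ = 0)
    (h10 : k₁ g₀ = 0) (h11 : k₁ g₁ = 1) (h12 : k₁ g₂ = 0)
    (h20 : k₂ g₀ = 0) (h21 : k₂ g₁ = 0) (h22 : k₂ g₂ = 1)
    {ψ : E3 → E3 →L[ℝ] E3} (hψ : ContDiffOn ℝ ∞ ψ U)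
    (hMC : ∀ x ∈ U, ∀ u v, fderiv ℝ ψ x (M x u) v - fderiv ℝ ψ x (M x v) u - ψ x (B u v)
      + B' (ψ x u) (ψ x v) = 0)
    {c s : E3 → ℝ} (hcs : ∀ x ∈ U, c x ^ 2 + s x ^ 2 = 1)
    (h₁ : ∀ x ∈ U, ψ x f₁ = c x • g₁ + s x • g₂)
    (h₂ : ∀ x ∈ U, ψ x f₂ = -s x • g₁ + c x • g₂) :
    χ = χ' ∧ w - (a₁ ^ 2 + a₂ ^ 2) = w' - (a₁' ^ 2 + a₂' ^ 2) ∧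
      (χ ≠ 0 → w = w' ∧ a₁' ^ 2 = a₁ ^ 2 ∧ a₂' ^ 2 = a₂ ^ 2) := by
  have hg₁₂ : B' g₁ g₂ = -(a₁' • g₁ + a₂' • g₂ + g₀) := by
    have := halt (g₁ + g₂)
    simp only [map_add, _root_.add_apply, halt, hg₂₁] at this
    rw [eq_neg_iff_add_eq_zero, add_comm]
    simpa using this
  have hψd : ∀ x ∈ U, HasFDerivAt ψ (fderiv ℝ ψ x) x := fun x hx =>
    ((hψ.contDiffAt (hM.isOpen.mem_nhds hx)).differentiableAt (by simp)).hasFDerivAt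
  -- the components of `ψ f` and their derivatives
  have hcomp : ∀ (k : E3 →L[ℝ] ℝ) (f : E3), ∀ x ∈ U, ∀ v,
      fderiv ℝ (fun y => k (ψ y f)) x v = k (fderiv ℝ ψ x v f) := fun k f x hx v => by
    have := (k.hasFDerivAt.comp x ((hψd x hx).clm_apply (hasFDerivAt_const f x))).fderiv
    rw [show (fun y => k (ψ y f)) = k ∘ (fun y => ψ y f) from rfl, this]
    simp
  have hceq : ∀ x ∈ U, ∀ v, fderiv ℝ c x v = k₁ (fderiv ℝ ψ x v f₁) := fun x hx v => by
    rw [← hcomp k₁ f₁ x hx]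
    refine DFunLike.congr_fun (Filter.EventuallyEq.fderiv_eq ?_) v
    filter_upwards [hM.isOpen.mem_nhds hx] with y hy
    simp [h₁ y hy, h11, h12]
  have hseq : ∀ x ∈ U, ∀ v, fderiv ℝ s x v = k₂ (fderiv ℝ ψ x v f₁) := fun x hx v => by
    rw [← hcomp k₂ f₁ x hx]
    refine DFunLike.congr_fun (Filter.EventuallyEq.fderiv_eq ?_) v
    filter_upwards [hM.isOpen.mem_nhds hx] with y hy
    simp [h₁ y hy, h21, h22]
  have hceq' : ∀ x ∈ U, ∀ v, fderiv ℝ c x v = k₂ (fderiv ℝ ψ x v f₂) := fun x hx v => by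
    rw [← hcomp k₂ f₂ x hx]
    refine DFunLike.congr_fun (Filter.EventuallyEq.fderiv_eq ?_) v
    filter_upwards [hM.isOpen.mem_nhds hx] with y hy
    simp [h₂ y hy, h21, h22]
  have hseq' : ∀ x ∈ U, ∀ v, fderiv ℝ s x v = -k₁ (fderiv ℝ ψ x v f₂) := fun x hx v => by
    rw [← hcomp k₁ f₂ x hx, ← neg_inj, neg_neg]
    have h3 : s =ᶠ[𝓝 x] fun y => -k₁ (ψ y f₂) := by
      filter_upwards [hM.isOpen.mem_nhds hx] with y hy
      simp [h₂ y hy, h11, h12]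
    rw [h3.fderiv_eq, fderiv_fun_neg]
    simp
  have hzero : ∀ f : E3, (∀ x ∈ U, k₀ (ψ x f) = k₀ (ψ x₀ f)) → ∀ x ∈ U, ∀ v,
      k₀ (fderiv ℝ ψ x v f) = 0 := fun f hf x hx v => by
    rw [← hcomp k₀ f x hx]
    have : (fun y => k₀ (ψ y f)) =ᶠ[𝓝 x] fun _ => k₀ (ψ x₀ f) := by
      filter_upwards [hM.isOpen.mem_nhds hx] with y hy using hf y hy
    rw [this.fderiv_eq]
    simp
  have hz1 := hzero f₁ (fun x hx => by simp [h₁ x hx, h₁ x₀ hx₀, h01, h02])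
  have hz2 := hzero f₂ (fun x hx => by simp [h₂ x hx, h₂ x₀ hx₀, h01, h02])
  -- the bracket of the images of `f₁` and `f₂`
  have hb21 : ∀ x ∈ U, B' (ψ x f₂) (ψ x f₁) = a₁' • g₁ + a₂' • g₂ + g₀ := fun x hx => by
    rw [h₁ x hx, h₂ x hx]
    simp only [map_add, map_smul, _root_.add_apply, _root_.smul_apply,
      halt, hg₂₁, hg₁₂]
    have : (a₁' • g₁ + a₂' • g₂ + g₀ : E3) =
      (c x ^ 2 + s x ^ 2) • (a₁' • g₁ + a₂' • g₂ + g₀) := by rw [hcs x hx, one_smul]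
    refine Eq.trans ?_ this.symm
    module
  have e21 : ∀ x ∈ U, ∀ k : E3 →L[ℝ] ℝ, k (fderiv ℝ ψ x (M x f₂) f₁) -
      k (fderiv ℝ ψ x (M x f₁) f₂) - (a₁ * k (ψ x f₁) + a₂ * k (ψ x f₂) + k (ψ x f₀)) +
      (a₁' * k g₁ + a₂' * k g₂ + k g₀) = 0 := fun x hx k => by
    have := congrArg k (hMC x hx f₂ f₁)
    rw [hb21 x hx, hf₂₁] at this
    simpa only [map_add, map_sub, map_smul, map_zero, smul_eq_mul] using this
  have e00 : ∀ x ∈ U, k₀ (ψ x f₀) = 1 := fun x hx => by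
    have := e21 x hx k₀
    rw [hz1 x hx, hz2 x hx, h₁ x hx, h₂ x hx] at this
    simp only [map_add, map_smul, smul_eq_mul, h00, h01, h02] at this
    linarith
  have hz0 := hzero f₀ (fun x hx => by rw [e00 x hx, e00 x₀ hx₀])
  have hf0 : ∀ x ∈ U, ψ x f₀ = g₀ + k₁ (ψ x f₀) • g₁ + k₂ (ψ x f₀) • g₂ := fun x hx => by
    conv_lhs => rw [hk (ψ x f₀), e00 x hx, one_smul]
  have hb10 : ∀ x ∈ U, ∀ k : E3 →L[ℝ] ℝ, k (B' (ψ x f₁) (ψ x f₀)) =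
      c x * ((χ' + w') * k g₂ - k₂ (ψ x f₀) * (a₁' * k g₁ + a₂' * k g₂ + k g₀)) +
      s x * ((χ' - w') * k g₁ + k₁ (ψ x f₀) * (a₁' * k g₁ + a₂' * k g₂ + k g₀)) :=
    fun x hx k => by
      conv_lhs => rw [hf0 x hx, h₁ x hx]
      simp only [map_add, map_smul, _root_.add_apply, _root_.smul_apply,
        halt, hg₂₁, hg₁₂, hg₁₀, hg₂₀, smul_eq_mul, map_neg, map_zero, smul_zero]
      ring
  have hb20 : ∀ x ∈ U, ∀ k : E3 →L[ℝ] ℝ, k (B' (ψ x f₂) (ψ x f₀)) =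
      -s x * ((χ' + w') * k g₂ - k₂ (ψ x f₀) * (a₁' * k g₁ + a₂' * k g₂ + k g₀)) +
      c x * ((χ' - w') * k g₁ + k₁ (ψ x f₀) * (a₁' * k g₁ + a₂' * k g₂ + k g₀)) :=
    fun x hx k => by
      conv_lhs => rw [hf0 x hx, h₂ x hx]
      simp only [map_add, map_smul, _root_.add_apply, _root_.smul_apply,
        halt, hg₂₁, hg₁₂, hg₁₀, hg₂₀, smul_eq_mul, map_neg, map_zero, smul_zero]
      ring
  have e10 : ∀ x ∈ U, ∀ k : E3 →L[ℝ] ℝ, k (fderiv ℝ ψ x (M x f₁) f₀) -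
      k (fderiv ℝ ψ x (M x f₀) f₁) - (χ + w) * k (ψ x f₂) + k (B' (ψ x f₁) (ψ x f₀)) = 0 :=
    fun x hx k => by
      have := congrArg k (hMC x hx f₁ f₀)
      rw [hf₁₀] at this
      simpa only [map_add, map_sub, map_smul, map_zero, smul_eq_mul] using this
  have e20 : ∀ x ∈ U, ∀ k : E3 →L[ℝ] ℝ, k (fderiv ℝ ψ x (M x f₂) f₀) -
      k (fderiv ℝ ψ x (M x f₀) f₂) - (χ - w) * k (ψ x f₁) + k (B' (ψ x f₂) (ψ x f₀)) = 0 :=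
    fun x hx k => by
      have := congrArg k (hMC x hx f₂ f₀)
      rw [hf₂₀] at this
      simpa only [map_add, map_sub, map_smul, map_zero, smul_eq_mul] using this
  -- the Reeb field is preserved
  have hR : ∀ x ∈ U, k₁ (ψ x f₀) = 0 ∧ k₂ (ψ x f₀) = 0 := fun x hx => by
    have q1 := e10 x hx k₀
    have q2 := e20 x hx k₀
    rw [hz0 x hx, hz1 x hx, hb10 x hx, h₂ x hx] at q1
    rw [hz0 x hx, hz2 x hx, hb20 x hx, h₁ x hx] at q2
    simp only [map_add, map_smul, smul_eq_mul, h00, h01, h02] at q1 q2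
    have := hcs x hx
    constructor
    · linear_combination (-k₁ (ψ x f₀)) * this + s x * q1 + c x * q2
    · linear_combination (-k₂ (ψ x f₀)) * this - c x * q1 + s x * q2
  have hzk : ∀ k : E3 →L[ℝ] ℝ, (∀ x ∈ U, k (ψ x f₀) = 0) → ∀ x ∈ U, ∀ v,
      k (fderiv ℝ ψ x v f₀) = 0 := fun k hf x hx v => by
    rw [← hcomp k f₀ x hx]
    have : (fun y => k (ψ y f₀)) =ᶠ[𝓝 x] fun _ => 0 := by
      filter_upwards [hM.isOpen.mem_nhds hx] with y hy using hf y hy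
    rw [this.fderiv_eq]
    simp
  have hz01 := hzk k₁ (fun x hx => (hR x hx).1)
  have hz02 := hzk k₂ (fun x hx => (hR x hx).2)
  -- the scalar structure equations
  have s1 : ∀ x ∈ U, -fderiv ℝ c x (M x f₀) + (χ + w) * s x + s x * (χ' - w') = 0 := fun x hx => by
    have q := e10 x hx k₁
    rw [hz01 x hx, hb10 x hx, h₂ x hx, ← hceq x hx, (hR x hx).1, (hR x hx).2] at q
    simp only [map_add, map_smul, smul_eq_mul, h10, h11, h12] at q
    linarith
  have s2 : ∀ x ∈ U, -fderiv ℝ s x (M x f₀) - (χ + w) * c x + c x * (χ' + w') = 0 := fun x hx => by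
    have q := e10 x hx k₂
    rw [hz02 x hx, hb10 x hx, h₂ x hx, ← hseq x hx, (hR x hx).1, (hR x hx).2] at q
    simp only [map_add, map_smul, smul_eq_mul, h20, h21, h22] at q
    linarith
  have s3 : ∀ x ∈ U, fderiv ℝ s x (M x f₀) - (χ - w) * c x + c x * (χ' - w') = 0 := fun x hx => by
    have q := e20 x hx k₁
    rw [hz01 x hx, hb20 x hx, h₁ x hx, (hR x hx).1, (hR x hx).2] at q
    rw [hseq' x hx]
    simp only [map_add, map_smul, smul_eq_mul, h10, h11, h12] at q
    linarith
  have s4 : ∀ x ∈ U, -fderiv ℝ c x (M x f₀) - (χ - w) * s x - s x * (χ' + w') = 0 := fun x hx => by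
    have q := e20 x hx k₂
    rw [hz02 x hx, hb20 x hx, h₁ x hx, (hR x hx).1, (hR x hx).2] at q
    rw [hceq' x hx]
    simp only [map_add, map_smul, smul_eq_mul, h20, h21, h22] at q
    linarith
  have s5 : ∀ x ∈ U, fderiv ℝ c x (M x f₂) + fderiv ℝ s x (M x f₁) - (a₁ * c x - a₂ * s x) + a₁' = 0 :=
    fun x hx => by
      have q := e21 x hx k₁
      rw [← hceq x hx, (hR x hx).1, h₁ x hx, h₂ x hx] at q
      rw [hseq' x hx]
      simp only [map_add, map_smul, smul_eq_mul, h10, h11, h12] at q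
      linarith
  have s6 : ∀ x ∈ U, fderiv ℝ s x (M x f₂) - fderiv ℝ c x (M x f₁) - (a₁ * s x + a₂ * c x) + a₂' = 0 :=
    fun x hx => by
      have q := e21 x hx k₂
      rw [← hseq x hx, (hR x hx).2, h₁ x hx, h₂ x hx] at q
      rw [hceq' x hx]
      simp only [map_add, map_smul, smul_eq_mul, h20, h21, h22] at q
      linarith
  have hcsm : ContDiffOn ℝ ∞ c U := by
    refine ContDiffOn.congr (f := fun x => k₁ (ψ x f₁))
      (k₁.contDiff.comp_contDiffOn (hψ.clm_apply contDiffOn_const)) fun x hx => ?_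
    simp [h₁ x hx, h11, h12]
  have hssm : ContDiffOn ℝ ∞ s U := by
    refine ContDiffOn.congr (f := fun x => k₂ (ψ x f₁))
      (k₂.contDiff.comp_contDiffOn (hψ.clm_apply contDiffOn_const)) fun x hx => ?_
    simp [h₁ x hx, h21, h22]
  have hcd : ∀ x ∈ U, HasFDerivAt c (fderiv ℝ c x) x := fun x hx =>
    ((hcsm.contDiffAt (hM.isOpen.mem_nhds hx)).differentiableAt (by simp)).hasFDerivAt
  have hsd : ∀ x ∈ U, HasFDerivAt s (fderiv ℝ s x) x := fun x hx =>
    ((hssm.contDiffAt (hM.isOpen.mem_nhds hx)).differentiableAt (by simp)).hasFDerivAt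
  have hdcs : ∀ x ∈ U, ∀ v, c x * fderiv ℝ c x v + s x * fderiv ℝ s x v = 0 := fun x hx v => by
    have h3 := ((hcd x hx).pow 2).add ((hsd x hx).pow 2)
    have h4 : (fun y => c y ^ 2 + s y ^ 2) =ᶠ[𝓝 x] fun _ => 1 := by
      filter_upwards [hM.isOpen.mem_nhds hx] with y hy using hcs y hy
    have h5 := DFunLike.congr_fun
      (h3.unique ((hasFDerivAt_const (1 : ℝ) x).congr_of_eventuallyEq h4)) v
    simp at h5
    linarith
  have hc0 : ∀ x ∈ U, c x * (χ' - χ) = 0 := fun x hx => by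
    linear_combination (1 / 2) * s2 x hx + (1 / 2) * s3 x hx
  have hs0 : ∀ x ∈ U, s x * (χ' + χ) = 0 := fun x hx => by
    linear_combination (1 / 2) * s1 x hx - (1 / 2) * s4 x hx
  have hχχ : χ = χ' := by
    by_contra hne
    have hc : c x₀ = 0 := (mul_eq_zero.1 (hc0 x₀ hx₀)).resolve_right
      (fun h => hne (by linarith))
    have hs : s x₀ ≠ 0 := fun h => by have := hcs x₀ hx₀; simp [hc, h] at this
    have := (mul_eq_zero.1 (hs0 x₀ hx₀)).resolve_left hs
    exact hne (by linarith)
  subst hχχ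
  refine ⟨rfl, ?_, fun hχ0 => ?_⟩
  · -- the derivatives of the angle along the frame
    set p₁ : E3 → ℝ := fun x => a₁ - c x * a₁' - s x * a₂' with hp₁
    set p₂ : E3 → ℝ := fun x => a₂ + s x * a₁' - c x * a₂' with hp₂
    have d0c : ∀ x ∈ U, fderiv ℝ c x (M x f₀) = -s x * (w' - w) := fun x hx => by
      linear_combination (-1) * s1 x hx + hs0 x hx
    have d0s : ∀ x ∈ U, fderiv ℝ s x (M x f₀) = c x * (w' - w) := fun x hx => by
      linear_combination (-1) * s2 x hx
    have hdc : ∀ x ∈ U, ∀ v, fderiv ℝ c x v = -s x * (c x * fderiv ℝ s x v - s x * fderiv ℝ c x v) :=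
      fun x hx v => by
        linear_combination c x * hdcs x hx v - fderiv ℝ c x v * hcs x hx
    have hds : ∀ x ∈ U, ∀ v, fderiv ℝ s x v = c x * (c x * fderiv ℝ s x v - s x * fderiv ℝ c x v) :=
      fun x hx v => by
        linear_combination s x * hdcs x hx v - fderiv ℝ s x v * hcs x hx
    have hp1 : ∀ x ∈ U, c x * fderiv ℝ s x (M x f₁) - s x * fderiv ℝ c x (M x f₁) = p₁ x :=
      fun x hx => by
        simp only [hp₁]
        linear_combination c x * s5 x hx + s x * s6 x hx - hdcs x hx (M x f₂) + a₁ * hcs x hx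
    have hp2 : ∀ x ∈ U, c x * fderiv ℝ s x (M x f₂) - s x * fderiv ℝ c x (M x f₂) = p₂ x :=
      fun x hx => by
        simp only [hp₂]
        linear_combination c x * s6 x hx - s x * s5 x hx + hdcs x hx (M x f₁) + a₂ * hcs x hx
    have d1c : ∀ x ∈ U, fderiv ℝ c x (M x f₁) = -s x * p₁ x := fun x hx => by
      rw [hdc x hx, hp1 x hx]
    have d1s : ∀ x ∈ U, fderiv ℝ s x (M x f₁) = c x * p₁ x := fun x hx => by
      rw [hds x hx, hp1 x hx]
    have d2c : ∀ x ∈ U, fderiv ℝ c x (M x f₂) = -s x * p₂ x := fun x hx => by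
      rw [hdc x hx, hp2 x hx]
    have d2s : ∀ x ∈ U, fderiv ℝ s x (M x f₂) = c x * p₂ x := fun x hx => by
      rw [hds x hx, hp2 x hx]
    -- the derivations `f₁`, `f₂` commute up to the bracket on the functions `c` and `s`
    have hUx := hM.isOpen.mem_nhds hx₀
    have cs := hM.commutator hx₀ (hssm.contDiffAt hUx) f₂ f₁
    have cc := hM.commutator hx₀ (hcsm.contDiffAt hUx) f₂ f₁
    have hp1d : HasFDerivAt p₁ (-(a₁' • fderiv ℝ c x₀) - a₂' • fderiv ℝ s x₀) x₀ := by
      have := (((hcd x₀ hx₀).mul_const a₁').const_sub a₁).sub ((hsd x₀ hx₀).mul_const a₂')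
      exact this
    have hp2d : HasFDerivAt p₂ (a₁' • fderiv ℝ s x₀ - a₂' • fderiv ℝ c x₀) x₀ := by
      have := (((hsd x₀ hx₀).mul_const a₁').const_add a₂).sub ((hcd x₀ hx₀).mul_const a₂')
      exact this
    have r1 : (fun y => fderiv ℝ s y (M y f₁)) =ᶠ[𝓝 x₀] fun y => c y * p₁ y := by
      filter_upwards [hUx] with y hy using d1s y hy
    have r2 : (fun y => fderiv ℝ s y (M y f₂)) =ᶠ[𝓝 x₀] fun y => c y * p₂ y := by
      filter_upwards [hUx] with y hy using d2s y hy
    have r3 : (fun y => fderiv ℝ c y (M y f₁)) =ᶠ[𝓝 x₀] fun y => -s y * p₁ y := by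
      filter_upwards [hUx] with y hy using d1c y hy
    have r4 : (fun y => fderiv ℝ c y (M y f₂)) =ᶠ[𝓝 x₀] fun y => -s y * p₂ y := by
      filter_upwards [hUx] with y hy using d2c y hy
    rw [r1.fderiv_eq, r2.fderiv_eq, ((hcd x₀ hx₀).fun_mul hp1d).fderiv,
      ((hcd x₀ hx₀).fun_mul hp2d).fderiv, hf₂₁] at cs
    rw [r3.fderiv_eq, r4.fderiv_eq, ((hsd x₀ hx₀).fun_neg.fun_mul hp1d).fderiv,
      ((hsd x₀ hx₀).fun_neg.fun_mul hp2d).fderiv, hf₂₁] at cc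
    simp only [map_add, map_smul, _root_.add_apply, _root_.smul_apply, _root_.sub_apply,
      _root_.neg_apply, smul_eq_mul, d1c x₀ hx₀, d2c x₀ hx₀, d1s x₀ hx₀, d2s x₀ hx₀, d0c x₀ hx₀,
      d0s x₀ hx₀] at cs cc
    have hx := hcs x₀ hx₀
    simp only [hp₁, hp₂] at cs cc
    have hc1 : c x₀ * (w - (a₁ ^ 2 + a₂ ^ 2) - (w' - (a₁' ^ 2 + a₂' ^ 2))) = 0 := by
      linear_combination cs - c x₀ * (a₁' ^ 2 + a₂' ^ 2) * hx
    have hs1 : s x₀ * (w - (a₁ ^ 2 + a₂ ^ 2) - (w' - (a₁' ^ 2 + a₂' ^ 2))) = 0 := by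
      linear_combination -cc - s x₀ * (a₁' ^ 2 + a₂' ^ 2) * hx
    linear_combination c x₀ * hc1 + s x₀ * hs1 -
      (w - (a₁ ^ 2 + a₂ ^ 2) - (w' - (a₁' ^ 2 + a₂' ^ 2))) * hx
  · have hs : ∀ x ∈ U, s x = 0 := fun x hx =>
      (mul_eq_zero.1 (hs0 x hx)).resolve_right (by simpa using hχ0)
    have hc : ∀ x ∈ U, c x ^ 2 = 1 := fun x hx => by simpa [hs x hx] using hcs x hx
    have hcne : c x₀ ≠ 0 := fun h => by have := hc x₀ hx₀; simp [h] at this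
    have hds : ∀ v, fderiv ℝ s x₀ v = 0 := fun v => by
      have : s =ᶠ[𝓝 x₀] fun _ => 0 := by
        filter_upwards [hM.isOpen.mem_nhds hx₀] with y hy using hs y hy
      rw [this.fderiv_eq]; simp
    have hdc : ∀ v, fderiv ℝ c x₀ v = 0 := fun v => by
      have := hdcs x₀ hx₀ v
      rw [hs x₀ hx₀, zero_mul, add_zero] at this
      exact (mul_eq_zero.1 this).resolve_left hcne
    have q2 := s2 x₀ hx₀
    have q5 := s5 x₀ hx₀
    have q6 := s6 x₀ hx₀
    rw [hds] at q2
    rw [hds, hdc, hs x₀ hx₀] at q5 q6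
    have hw : w = w' := by
      have : c x₀ * (w' - w) = 0 := by linarith
      linarith [(mul_eq_zero.1 this).resolve_left hcne]
    have ha₁ : a₁' = a₁ * c x₀ := by linarith
    have ha₂ : a₂' = a₂ * c x₀ := by linarith
    refine ⟨hw, ?_, ?_⟩
    · rw [ha₁, mul_pow, hc x₀ hx₀, mul_one]
    · rw [ha₂, mul_pow, hc x₀ hx₀, mul_one]

end

/-! ### Canonical frames of a sub-Riemannian structure -/

noncomputable section

open Set Filter Topology VectorField

namespace LeftInvariantSR

open LieGroup3

variable {G : LieGroup3.{u}} {H : LieGroup3.{v}} {S : LeftInvariantSR G} {T : LeftInvariantSR H}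

/-- A local isometry, read in a chart of the source and in the left trivialization of the target:
the function `ψ` with values in linear maps from the first to the second Lie algebra. -/
theorem LocallyIsometric.exists_coframe (h : S.LocallyIsometric T) :
    ∃ (U : Set E3) (M ψ : E3 → E3 →L[ℝ] E3) (x₀ : E3), IsLieFrame G.br U M ∧ x₀ ∈ U ∧
      ContDiffOn ℝ ∞ ψ U ∧
      (∀ x ∈ U, ∀ u v, fderiv ℝ ψ x (M x u) v - fderiv ℝ ψ x (M x v) u - ψ x (G.br u v)
        + H.br (ψ x u) (ψ x v) = 0) ∧
      ∀ x ∈ U, ∃ A : S.dist ≃ₗ[ℝ] T.dist, (∀ v, ((A v : H.Lie) : E3) = ψ x (v : G.Lie)) ∧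
        ∀ v w, T.metric (A v) (A w) = S.metric v w := by
  obtain ⟨φ, hp, hφ, -, hiso⟩ := h 1
  set c := chartAt E3 (1 : G.carrier) with hc
  have h1 : (1 : G.carrier) ∈ c.source := mem_chart_source _ _
  set U := c.target ∩ c.symm ⁻¹' φ.source with hU
  have hUo : IsOpen U := c.symm.isOpen_inter_preimage φ.open_source
  set Φ : E3 → H.carrier := φ ∘ c.symm with hΦ
  have hcs : ∀ x ∈ U, ContMDiffAt (𝓡 3) (𝓡 3) ∞ c.symm x := fun x hx =>
    (contMDiffOn_chart_symm (n := ∞)).contMDiffAt (c.open_target.mem_nhds hx.1)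
  have hφs : ∀ x ∈ U, ContMDiffAt (𝓡 3) (𝓡 3) ∞ φ (c.symm x) := fun x hx =>
    hφ.contMDiffAt (φ.open_source.mem_nhds hx.2)
  have hΦs : ∀ x ∈ U, ContMDiffAt (𝓡 3) (𝓡 3) ∞ Φ x := fun x hx => (hφs x hx).comp x (hcs x hx)
  have hlog : ∀ x ∈ U, H.HasLogDerivAt Φ (H.logDeriv Φ x) x := fun x hx =>
    hasLogDerivAt_logDeriv ((hΦs x hx).mdifferentiableAt (by simp))
  have hM := G.isLieFrame_chartFrame 1
  have hMs : ∀ x ∈ U, ContDiffAt ℝ ∞ (G.chartFrame 1) x := fun x hx =>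
    hM.contDiffOn.contDiffAt (hM.isOpen.mem_nhds hx.1)
  have hΘs : ∀ x ∈ U, ContDiffAt ℝ ∞ (H.logDeriv Φ) x := fun x hx => contDiffAt_logDeriv (hΦs x hx)
  refine ⟨U, G.chartFrame 1, fun x => H.logDeriv Φ x ∘L G.chartFrame 1 x, c 1,
    ⟨hUo, hM.contDiffOn.mono inter_subset_left, fun x hx => hM.bijective x hx.1,
      fun x hx => hM.bracket x hx.1⟩, ⟨c.map_source h1, by simpa [c.left_inv h1] using hp⟩, ?_, ?_, ?_⟩
  · exact fun x hx => ((hΘs x hx).clm_comp (hMs x hx)).contDiffWithinAt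
  · intro x hx u v
    have hd := ((hΘs x hx).differentiableAt (by simp)).hasFDerivAt
    have hdM := ((hMs x hx).differentiableAt (by simp)).hasFDerivAt
    have mc := maurerCartan (by filter_upwards [hUo.mem_nhds hx] with y hy using hlog y hy) hd
      (G.chartFrame 1 x u) (G.chartFrame 1 x v)
    rw [(hd.clm_comp hdM).fderiv]
    have hb := congrArg (H.logDeriv Φ x) (hM.bracket x hx.1 u v)
    simp only [map_sub] at hb
    simp only [_root_.add_apply, ContinuousLinearMap.comp_apply, ContinuousLinearMap.compL_apply,
      ContinuousLinearMap.flip_apply]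
    rw [← hb]
    refine Eq.trans ?_ mc
    abel
  · intro x hx
    obtain ⟨A, hA, hm⟩ := hiso (c.symm x) hx.2
    refine ⟨A, fun v => ?_, hm⟩
    apply (H.dL_bijective (Φ x)).1
    have e1 := ((hφs x hx).mdifferentiableAt (by simp)).hasMFDerivAt.comp x
      ((hcs x hx).mdifferentiableAt (by simp)).hasMFDerivAt
    have e2 := DFunLike.congr_fun (hasMFDerivAt_unique e1 (hlog x hx)) (G.chartFrame 1 x (v : G.Lie))
    refine Eq.trans ?_ e2
    refine (hA v).symm.trans ?_
    have e3 := (mdifferentiable_chart (I := 𝓡 3) (1 : G.carrier)).symm_comp_deriv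
      (c.map_target hx.1)
    rw [c.right_inv hx.1] at e3
    have e4 := DFunLike.congr_fun e3 (G.dL (c.symm x) (v : G.Lie))
    exact congrArg (mfderiv (𝓡 3) (𝓡 3) φ (c.symm x)) e4.symm

/-- `b` consists of the Reeb field `b 0` and an orthonormal basis `b 1, b 2` of the distribution for
which the symmetric part of `ad (b 0)` on the distribution is off-diagonal, with entry `χ`; its
skew-symmetric part is `w`. -/
structure IsCanonicalFrame (S : LeftInvariantSR G) (b : Module.Basis (Fin 3) ℝ G.Lie)
    (χ w a₁ a₂ : ℝ) : Prop where
  mem₁ : b 1 ∈ S.dist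
  mem₂ : b 2 ∈ S.dist
  metric₁₁ : S.metric ⟨b 1, mem₁⟩ ⟨b 1, mem₁⟩ = 1
  metric₂₂ : S.metric ⟨b 2, mem₂⟩ ⟨b 2, mem₂⟩ = 1
  metric₁₂ : S.metric ⟨b 1, mem₁⟩ ⟨b 2, mem₂⟩ = 0
  lie₁₀ : ⁅b 1, b 0⁆ = (χ + w) • b 2
  lie₂₀ : ⁅b 2, b 0⁆ = (χ - w) • b 1
  lie₂₁ : ⁅b 2, b 1⁆ = a₁ • b 1 + a₂ • b 2 + b 0

namespace IsCanonicalFrame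

variable {b : Module.Basis (Fin 3) ℝ G.Lie} {b' : Module.Basis (Fin 3) ℝ H.Lie}
  {χ w a₁ a₂ χ' w' a₁' a₂' : ℝ}

theorem metric₂₁ (h : S.IsCanonicalFrame b χ w a₁ a₂) :
    S.metric ⟨b 2, h.mem₂⟩ ⟨b 1, h.mem₁⟩ = 0 := by rw [S.metric_symm, h.metric₁₂]

theorem metric_combination (h : S.IsCanonicalFrame b χ w a₁ a₂) (x y x' y' : ℝ) :
    S.metric (x • ⟨b 1, h.mem₁⟩ + y • ⟨b 2, h.mem₂⟩) (x' • ⟨b 1, h.mem₁⟩ + y' • ⟨b 2, h.mem₂⟩) =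
      x * x' + y * y' := by
  simp only [map_add, map_smul, LinearMap.add_apply, LinearMap.smul_apply, smul_eq_mul,
    h.metric₁₁, h.metric₂₂, h.metric₁₂, h.metric₂₁]
  ring

theorem dist_eq (h : S.IsCanonicalFrame b χ w a₁ a₂) : S.dist = Submodule.span ℝ {b 1, b 2} := by
  symm
  have hli : LinearIndependent ℝ ![b 1, b 2] := by
    have := b.linearIndependent.comp ![(1 : Fin 3), 2] (by decide)
    convert this using 1
    ext i
    fin_cases i <;> rfl
  have : FiniteDimensional ℝ G.Lie := inferInstanceAs (FiniteDimensional ℝ E3)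
  apply Submodule.eq_of_le_of_finrank_eq
  · rw [Submodule.span_le]
    rintro v (rfl | rfl)
    exacts [h.mem₁, h.mem₂]
  · have e : ({b 1, b 2} : Set G.Lie) = Set.range ![b 1, b 2] := by
      rw [Matrix.range_cons, Matrix.range_cons, Matrix.range_empty, union_empty]; rfl
    rw [S.rank_two, e]
    exact finrank_span_eq_card hli

theorem exists_combination (h : S.IsCanonicalFrame b χ w a₁ a₂) (v : S.dist) :
    ∃ x y : ℝ, v = x • ⟨b 1, h.mem₁⟩ + y • ⟨b 2, h.mem₂⟩ := by
  have hv : (v : G.Lie) ∈ Submodule.span ℝ {b 1, b 2} := by rw [← h.dist_eq]; exact v.2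
  rw [Submodule.mem_span_pair] at hv
  obtain ⟨x, y, hxy⟩ := hv
  exact ⟨x, y, Subtype.ext hxy.symm⟩

theorem metric_eq (h : S.IsCanonicalFrame b χ w a₁ a₂) {v v' : S.dist} {x y x' y' : ℝ}
    (hv : (v : G.Lie) = x • b 1 + y • b 2) (hv' : (v' : G.Lie) = x' • b 1 + y' • b 2) :
    S.metric v v' = x * x' + y * y' := by
  rw [← h.metric_combination x y x' y']
  congr 1
  · congr 1; exact Subtype.ext hv
  · exact Subtype.ext hv'

/-- Reversing the orientation of the distribution. -/
theorem reflect (h : S.IsCanonicalFrame b χ w a₁ a₂) :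
    S.IsCanonicalFrame (b.unitsSMul ![-1, 1, -1]) χ w (-a₁) a₂ := by
  have e0 : b.unitsSMul ![-1, 1, -1] 0 = -b 0 := by simp [Module.Basis.unitsSMul_apply]
  have e1 : b.unitsSMul ![-1, 1, -1] 1 = b 1 := by simp [Module.Basis.unitsSMul_apply]
  have e2 : b.unitsSMul ![-1, 1, -1] 2 = -b 2 := by simp [Module.Basis.unitsSMul_apply]
  have m1 : b.unitsSMul ![-1, 1, -1] 1 ∈ S.dist := by rw [e1]; exact h.mem₁
  have m2 : b.unitsSMul ![-1, 1, -1] 2 ∈ S.dist := by rw [e2]; exact neg_mem h.mem₂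
  have k1 : b.unitsSMul ![-1, 1, -1] 1 = (1 : ℝ) • b 1 + (0 : ℝ) • b 2 := by rw [e1]; simp
  have k2 : b.unitsSMul ![-1, 1, -1] 2 = (0 : ℝ) • b 1 + (-1 : ℝ) • b 2 := by rw [e2]; simp
  refine ⟨m1, m2, ?_, ?_, ?_, ?_, ?_, ?_⟩
  · rw [h.metric_eq k1 k1]; norm_num
  · rw [h.metric_eq k2 k2]; norm_num
  · rw [h.metric_eq k1 k2]; norm_num
  · rw [e0, e1, e2, lie_neg, h.lie₁₀, smul_neg]
  · rw [e0, e1, e2, lie_neg, neg_lie, h.lie₂₀, neg_neg]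
  · rw [e0, e1, e2, neg_lie, h.lie₂₁, neg_smul, smul_neg, neg_add, neg_add]

/-- Rotating the frame by a half turn. -/
theorem halfTurn (h : S.IsCanonicalFrame b χ w a₁ a₂) :
    S.IsCanonicalFrame (b.unitsSMul ![1, -1, -1]) χ w (-a₁) (-a₂) := by
  have e0 : b.unitsSMul ![1, -1, -1] 0 = b 0 := by simp [Module.Basis.unitsSMul_apply]
  have e1 : b.unitsSMul ![1, -1, -1] 1 = -b 1 := by simp [Module.Basis.unitsSMul_apply]
  have e2 : b.unitsSMul ![1, -1, -1] 2 = -b 2 := by simp [Module.Basis.unitsSMul_apply]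
  have m1 : b.unitsSMul ![1, -1, -1] 1 ∈ S.dist := by rw [e1]; exact neg_mem h.mem₁
  have m2 : b.unitsSMul ![1, -1, -1] 2 ∈ S.dist := by rw [e2]; exact neg_mem h.mem₂
  have k1 : b.unitsSMul ![1, -1, -1] 1 = (-1 : ℝ) • b 1 + (0 : ℝ) • b 2 := by rw [e1]; simp
  have k2 : b.unitsSMul ![1, -1, -1] 2 = (0 : ℝ) • b 1 + (-1 : ℝ) • b 2 := by rw [e2]; simp
  refine ⟨m1, m2, ?_, ?_, ?_, ?_, ?_, ?_⟩
  · rw [h.metric_eq k1 k1]; norm_num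
  · rw [h.metric_eq k2 k2]; norm_num
  · rw [h.metric_eq k1 k2]; norm_num
  · rw [e0, e1, e2, neg_lie, h.lie₁₀, smul_neg]
  · rw [e0, e1, e2, neg_lie, h.lie₂₀, smul_neg]
  · rw [e0, e1, e2, neg_lie, lie_neg, neg_neg, h.lie₂₁, smul_neg, smul_neg, neg_smul, neg_smul,
      neg_neg, neg_neg]

/-- The coefficients `a₁, a₂` matter only up to sign. -/
theorem exists_of_sq_eq (h : S.IsCanonicalFrame b χ w a₁ a₂) (h₁ : a₁' ^ 2 = a₁ ^ 2)
    (h₂ : a₂' ^ 2 = a₂ ^ 2) : ∃ b, S.IsCanonicalFrame b χ w a₁' a₂' := by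
  rcases sq_eq_sq_iff_eq_or_eq_neg.1 h₁ with rfl | rfl <;>
    rcases sq_eq_sq_iff_eq_or_eq_neg.1 h₂ with rfl | rfl
  · exact ⟨_, h⟩
  · have := h.reflect.halfTurn
    rw [neg_neg] at this
    exact ⟨_, this⟩
  · exact ⟨_, h.reflect⟩
  · exact ⟨_, h.halfTurn⟩

/-- The coordinates of a canonical frame, as continuous linear functionals. -/
def coord (b : Module.Basis (Fin 3) ℝ G.Lie) (i : Fin 3) : E3 →L[ℝ] ℝ :=
  LinearMap.toContinuousLinearMap (b.coord i : E3 →ₗ[ℝ] ℝ)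

theorem coord_basis (b : Module.Basis (Fin 3) ℝ G.Lie) (i j : Fin 3) :
    coord b i (b j) = if j = i then 1 else 0 := by
  refine (b.repr_self_apply j i).trans ?_
  rfl

theorem sum_coord (b : Module.Basis (Fin 3) ℝ G.Lie) (v : E3) :
    v = coord b 0 v • (b 0 : E3) + coord b 1 v • (b 1 : E3) + coord b 2 v • (b 2 : E3) := by
  have := b.sum_repr v
  rw [Fin.sum_univ_three] at this
  exact this.symm

theorem coord_combination (b : Module.Basis (Fin 3) ℝ G.Lie) (i : Fin 3) {v : E3} {x y : ℝ}
    (hv : v = x • (b 1 : E3) + y • (b 2 : E3)) :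
    coord b i v = x * (if 1 = i then 1 else 0) + y * (if 2 = i then 1 else 0) := by
  rw [hv]
  refine (map_add (coord b i) (x • (b 1 : E3)) (y • (b 2 : E3))).trans ?_
  congr 1
  · exact (map_smul (coord b i) x (b 1 : E3)).trans (congrArg (x * ·) (coord_basis b i 1))
  · exact (map_smul (coord b i) y (b 2 : E3)).trans (congrArg (y * ·) (coord_basis b i 2))

theorem coord_unitsSMul (b : Module.Basis (Fin 3) ℝ G.Lie) (ε : Fin 3 → ℝˣ) (i : Fin 3) (v : E3) :
    coord (b.unitsSMul ε) i v = ((ε i)⁻¹ : ℝˣ) * coord b i v :=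
  b.repr_unitsSMul ε v i

/-- The invariance of `χ` and `κ = w - a₁² - a₂²` under local isometries. -/
theorem invariant (hS : S.IsCanonicalFrame b χ w a₁ a₂) (hT : T.IsCanonicalFrame b' χ' w' a₁' a₂')
    (hχ : 0 ≤ χ) (hχ' : 0 ≤ χ') (h : S.LocallyIsometric T) :
    χ = χ' ∧ w - (a₁ ^ 2 + a₂ ^ 2) = w' - (a₁' ^ 2 + a₂' ^ 2) ∧
      (χ ≠ 0 → w = w' ∧ a₁' ^ 2 = a₁ ^ 2 ∧ a₂' ^ 2 = a₂ ^ 2) := by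
  obtain ⟨U, M, ψ, x₀, hM, hx₀, hψ, hMC, hiso⟩ := h.exists_coframe
  -- the horizontal components of `ψ` are orthogonal matrices
  have comb : ∀ {b' : Module.Basis (Fin 3) ℝ H.Lie} {w' a₁' a₂' : ℝ},
      T.IsCanonicalFrame b' χ' w' a₁' a₂' → ∀ x ∈ U,
      (ψ x (b 1) = coord b' 1 (ψ x (b 1)) • (b' 1 : E3) + coord b' 2 (ψ x (b 1)) • (b' 2 : E3)) ∧
      (ψ x (b 2) = coord b' 1 (ψ x (b 2)) • (b' 1 : E3) + coord b' 2 (ψ x (b 2)) • (b' 2 : E3)) ∧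
      coord b' 1 (ψ x (b 1)) ^ 2 + coord b' 2 (ψ x (b 1)) ^ 2 = 1 ∧
      coord b' 1 (ψ x (b 2)) ^ 2 + coord b' 2 (ψ x (b 2)) ^ 2 = 1 ∧
      coord b' 1 (ψ x (b 1)) * coord b' 1 (ψ x (b 2)) +
        coord b' 2 (ψ x (b 1)) * coord b' 2 (ψ x (b 2)) = 0 := by
    intro b' w' a₁' a₂' hT x hx
    obtain ⟨A, hA, hm⟩ := hiso x hx
    obtain ⟨p, q, hpq⟩ := hT.exists_combination (A ⟨b 1, hS.mem₁⟩)
    obtain ⟨r, s, hrs⟩ := hT.exists_combination (A ⟨b 2, hS.mem₂⟩)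
    have e1 : ψ x (b 1) = p • (b' 1 : E3) + q • (b' 2 : E3) :=
      (hA ⟨b 1, hS.mem₁⟩).symm.trans (congrArg Subtype.val hpq)
    have e2 : ψ x (b 2) = r • (b' 1 : E3) + s • (b' 2 : E3) :=
      (hA ⟨b 2, hS.mem₂⟩).symm.trans (congrArg Subtype.val hrs)
    have m11 := hm ⟨b 1, hS.mem₁⟩ ⟨b 1, hS.mem₁⟩
    have m22 := hm ⟨b 2, hS.mem₂⟩ ⟨b 2, hS.mem₂⟩
    have m12 := hm ⟨b 1, hS.mem₁⟩ ⟨b 2, hS.mem₂⟩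
    rw [hpq, hT.metric_combination, hS.metric₁₁] at m11
    rw [hrs, hT.metric_combination, hS.metric₂₂] at m22
    rw [hpq, hrs, hT.metric_combination, hS.metric₁₂] at m12
    have c1 : coord b' 1 (ψ x (b 1)) = p := by simp [coord_combination b' 1 e1]
    have c2 : coord b' 2 (ψ x (b 1)) = q := by simp [coord_combination b' 2 e1]
    have c3 : coord b' 1 (ψ x (b 2)) = r := by simp [coord_combination b' 1 e2]
    have c4 : coord b' 2 (ψ x (b 2)) = s := by simp [coord_combination b' 2 e2]
    rw [c1, c2, c3, c4]
    exact ⟨e1, e2, by linarith, by linarith, m12⟩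
  -- the result, when the orientation is preserved at `x₀`
  have main : ∀ {b' : Module.Basis (Fin 3) ℝ H.Lie} {w' a₁' a₂' : ℝ},
      T.IsCanonicalFrame b' χ' w' a₁' a₂' →
      0 < coord b' 1 (ψ x₀ (b 1)) * coord b' 2 (ψ x₀ (b 2)) -
        coord b' 2 (ψ x₀ (b 1)) * coord b' 1 (ψ x₀ (b 2)) →
      χ = χ' ∧ w - (a₁ ^ 2 + a₂ ^ 2) = w' - (a₁' ^ 2 + a₂' ^ 2) ∧
        (χ ≠ 0 → w = w' ∧ a₁' ^ 2 = a₁ ^ 2 ∧ a₂' ^ 2 = a₂ ^ 2) := by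
    intro b' w' a₁' a₂' hT hpos
    set ε : E3 → ℝ := fun x => coord b' 1 (ψ x (b 1)) * coord b' 2 (ψ x (b 2)) -
        coord b' 2 (ψ x (b 1)) * coord b' 1 (ψ x (b 2)) with hε
    have hcomp : ∀ (i : Fin 3) (f : E3), ContinuousOn (fun x => coord b' i (ψ x f)) U := fun i f =>
      (coord b' i).continuous.comp_continuousOn (hψ.continuousOn.clm_apply continuousOn_const)
    have hεc : ContinuousOn ε U :=
      ((hcomp 1 (b 1)).mul (hcomp 2 (b 2))).sub ((hcomp 2 (b 1)).mul (hcomp 1 (b 2)))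
    have hVo : IsOpen (U ∩ ε ⁻¹' Ioi 0) := hεc.isOpen_inter_preimage hM.isOpen isOpen_Ioi
    have hrot : ∀ x ∈ U ∩ ε ⁻¹' Ioi 0, coord b' 1 (ψ x (b 2)) = -coord b' 2 (ψ x (b 1)) ∧
        coord b' 2 (ψ x (b 2)) = coord b' 1 (ψ x (b 1)) := by
      intro x hx
      obtain ⟨-, -, q1, q2, q3⟩ := comb hT x hx.1
      have h4 : 0 < coord b' 1 (ψ x (b 1)) * coord b' 2 (ψ x (b 2)) -
        coord b' 2 (ψ x (b 1)) * coord b' 1 (ψ x (b 2)) := hx.2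
      set p := coord b' 1 (ψ x (b 1))
      set q := coord b' 2 (ψ x (b 1))
      set r := coord b' 1 (ψ x (b 2))
      set s := coord b' 2 (ψ x (b 2))
      have h5 : (p * s - q * r) ^ 2 = 1 := by
        linear_combination (r ^ 2 + s ^ 2) * q1 + q2 - (p * r + q * s) * q3
      have h6 : p * s - q * r = 1 := by nlinarith
      constructor <;> nlinarith [sq_nonneg (p - s), sq_nonneg (q + r)]
    have hM' : IsLieFrame G.br (U ∩ ε ⁻¹' Ioi 0) M :=
      ⟨hVo, hM.contDiffOn.mono inter_subset_left, fun x hx => hM.bijective x hx.1,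
        fun x hx => hM.bracket x hx.1⟩
    refine hM'.rigidity (B' := H.br) (x₀ := x₀) (f₀ := b 0) (f₁ := b 1) (f₂ := b 2) (g₀ := b' 0)
      (g₁ := b' 1) (g₂ := b' 2) (k₀ := coord b' 0) (k₁ := coord b' 1) (k₂ := coord b' 2)
      (ψ := ψ) (c := fun x => coord b' 1 (ψ x (b 1))) (s := fun x => coord b' 2 (ψ x (b 1)))
      ⟨hx₀, hpos⟩ hχ hχ' hS.lie₁₀ hS.lie₂₀ hS.lie₂₁ (fun v => lie_self (show H.Lie from v))
      hT.lie₁₀ hT.lie₂₀ hT.lie₂₁ (sum_coord b') (by simp [coord_basis]) (by simp [coord_basis])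
      (by simp [coord_basis]) (by simp [coord_basis]) (by simp [coord_basis])
      (by simp [coord_basis]) (by simp [coord_basis]) (by simp [coord_basis])
      (by simp [coord_basis]) (hψ.mono inter_subset_left) (fun x hx => hMC x hx.1)
      (fun x hx => (comb hT x hx.1).2.2.1) (fun x hx => (comb hT x hx.1).1) (fun x hx => ?_)
    have := (comb hT x hx.1).2.1
    rw [(hrot x hx).1, (hrot x hx).2] at this
    exact this
  rcases lt_or_ge 0 (coord b' 1 (ψ x₀ (b 1)) * coord b' 2 (ψ x₀ (b 2)) -
        coord b' 2 (ψ x₀ (b 1)) * coord b' 1 (ψ x₀ (b 2))) with hpos | hneg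
  · exact main hT hpos
  -- otherwise the orientation of the target frame is reversed
  · have hT' := hT.reflect
    obtain ⟨e1, e2, q1, q2, q3⟩ := comb hT x₀ hx₀
    set p := coord b' 1 (ψ x₀ (b 1))
    set q := coord b' 2 (ψ x₀ (b 1))
    set r := coord b' 1 (ψ x₀ (b 2))
    set s := coord b' 2 (ψ x₀ (b 2))
    have h5 : (p * s - q * r) ^ 2 = 1 := by
      linear_combination (r ^ 2 + s ^ 2) * q1 + q2 - (p * r + q * s) * q3
    have k1 : ∀ v, coord (b'.unitsSMul ![-1, 1, -1]) 1 v = coord b' 1 v := fun v => by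
      simp [coord_unitsSMul]
    have k2 : ∀ v, coord (b'.unitsSMul ![-1, 1, -1]) 2 v = -coord b' 2 v := fun v => by
      simp [coord_unitsSMul]
    have := main hT' (by rw [k1, k1, k2, k2]; nlinarith)
    simpa using this

end IsCanonicalFrame

end LeftInvariantSR

end

/-! ### Existence of canonical frames, and the invariants -/

noncomputable section

open Set Filter Topology

/-- A unit vector of the plane is the square of a unit vector, as complex numbers. -/
theorem exists_sq_sub_sq_and_two_mul {u v : ℝ} (h : u ^ 2 + v ^ 2 = 1) :
    ∃ c s : ℝ, c ^ 2 + s ^ 2 = 1 ∧ c ^ 2 - s ^ 2 = u ∧ 2 * c * s = v := by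
  obtain ⟨z, hz⟩ := IsAlgClosed.exists_pow_nat_eq (⟨u, v⟩ : ℂ) (n := 2) two_pos
  have h1 : z.re ^ 2 - z.im ^ 2 = u := by
    have := congrArg Complex.re hz; simp [pow_two] at this; linarith
  have h2 : 2 * z.re * z.im = v := by
    have := congrArg Complex.im hz; simp [pow_two] at this; linarith
  refine ⟨z.re, z.im, ?_, h1, h2⟩
  have : (z.re ^ 2 + z.im ^ 2) ^ 2 = 1 := by rw [← h, ← h1, ← h2]; ring
  nlinarith [sq_nonneg z.re, sq_nonneg z.im]

namespace LeftInvariantSR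

open LieGroup3

variable {G : LieGroup3.{u}} {H : LieGroup3.{v}} {S : LeftInvariantSR G} {T : LeftInvariantSR H}

instance : FiniteDimensional ℝ G.Lie := inferInstanceAs (FiniteDimensional ℝ E3)

theorem finrank_lie (G : LieGroup3.{u}) : Module.finrank ℝ G.Lie = 3 :=
  (finrank_euclideanSpace_fin : Module.finrank ℝ E3 = 3)

theorem exists_orthonormal (S : LeftInvariantSR G) :
    ∃ f₁ f₂ : S.dist, S.metric f₁ f₁ = 1 ∧ S.metric f₂ f₂ = 1 ∧ S.metric f₁ f₂ = 0 := by
  have : Module.Finite ℝ S.dist := Module.finite_of_finrank_pos (by rw [S.rank_two]; norm_num)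
  set e := Module.finBasisOfFinrankEq ℝ S.dist S.rank_two
  have unit : ∀ v : S.dist, v ≠ 0 → ∃ r : ℝ, r ≠ 0 ∧ S.metric (r • v) (r • v) = 1 := by
    intro v hv
    have := S.metric_pos v hv
    refine ⟨(√(S.metric v v))⁻¹, by positivity, ?_⟩
    simp only [map_smul, LinearMap.smul_apply, smul_eq_mul]
    rw [← mul_assoc, ← mul_inv, Real.mul_self_sqrt this.le, inv_mul_cancel₀ this.ne']
  obtain ⟨r, hr, h₁⟩ := unit (e 0) (e.ne_zero 0)
  set f := r • e 0 with hf
  have hg : e 1 - S.metric (e 1) f • f ≠ 0 := by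
    intro h
    have := congrArg (fun v => e.repr v 1) h
    simp [hf] at this
  obtain ⟨q, -, h₂⟩ := unit _ hg
  refine ⟨f, _, h₁, h₂, ?_⟩
  simp only [map_smul, map_sub, smul_eq_mul, h₁, S.metric_symm f (e 1)]
  ring

section

variable {f₁ f₂ : S.dist} (h₁ : S.metric f₁ f₁ = 1) (h₂ : S.metric f₂ f₂ = 1)
  (h₁₂ : S.metric f₁ f₂ = 0)

include h₁ h₂ h₁₂

theorem linearIndependent_of_orthonormal : LinearIndependent ℝ ![f₁, f₂] := by
  rw [LinearIndependent.pair_iff]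
  intro s t hst
  have e1 := congrArg (S.metric f₁) hst
  have e2 := congrArg (S.metric f₂) hst
  simp only [map_add, map_smul, h₁, h₁₂, h₂, S.metric_symm f₂ f₁, map_zero, smul_eq_mul] at e1 e2
  constructor <;> linarith

theorem exists_combination_of_orthonormal {v : G.Lie} (hv : v ∈ S.dist) :
    ∃ x y : ℝ, v = x • (f₁ : G.Lie) + y • (f₂ : G.Lie) := by
  have hs := (linearIndependent_of_orthonormal h₁ h₂ h₁₂).span_eq_top_of_card_eq_finrank'
    (by simp [S.rank_two])
  rw [Matrix.range_cons, Matrix.range_cons, Matrix.range_empty, union_empty] at hs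
  have : (⟨v, hv⟩ : S.dist) ∈ Submodule.span ℝ ({f₁} ∪ {f₂} : Set S.dist) := by
    rw [hs]; trivial
  obtain ⟨x, y, hxy⟩ := Submodule.mem_span_pair.1 this
  exact ⟨x, y, (congrArg Subtype.val hxy).symm⟩

/-- The distribution is not closed under the bracket, as it generates the Lie algebra. -/
theorem lie_notMem_of_orthonormal : ⁅(f₂ : G.Lie), (f₁ : G.Lie)⁆ ∉ S.dist := by
  intro hmem
  let K : LieSubalgebra ℝ G.Lie :=
    { S.dist with
      lie_mem' := by
        intro v v' hv hv'
        obtain ⟨x, y, rfl⟩ := exists_combination_of_orthonormal h₁ h₂ h₁₂ hv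
        obtain ⟨x', y', rfl⟩ := exists_combination_of_orthonormal h₁ h₂ h₁₂ hv'
        have : ⁅x • (f₁ : G.Lie) + y • (f₂ : G.Lie), x' • (f₁ : G.Lie) + y' • (f₂ : G.Lie)⁆ =
            (y * x' - x * y') • ⁅(f₂ : G.Lie), (f₁ : G.Lie)⁆ := by
          rw [lie_add, add_lie, add_lie, lie_smul, lie_smul, lie_smul, lie_smul, smul_lie, smul_lie,
            smul_lie, smul_lie, lie_self, lie_self, ← lie_skew (f₂ : G.Lie) (f₁ : G.Lie)]
          module
        exact this ▸ S.dist.smul_mem _ hmem }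
  have hK : K = ⊤ := by
    rw [eq_top_iff, ← S.bracket_generating, LieSubalgebra.lieSpan_le]
    exact fun v hv => hv
  have : S.dist = ⊤ := by
    rw [eq_top_iff]
    intro v _
    have : v ∈ K := by rw [hK]; trivial
    exact this
  have h2 := S.rank_two
  rw [this, finrank_top, finrank_lie] at h2
  norm_num at h2

theorem exists_basis_of_orthonormal {f₀ : G.Lie} (hf₀ : f₀ ∉ S.dist) :
    ∃ b : Module.Basis (Fin 3) ℝ G.Lie, b 0 = f₀ ∧ b 1 = f₁ ∧ b 2 = f₂ := by
  have hli : LinearIndependent ℝ ![(f₁ : G.Lie), (f₂ : G.Lie)] := by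
    have := (linearIndependent_of_orthonormal h₁ h₂ h₁₂).map' S.dist.subtype
      (Submodule.ker_subtype _)
    have e : ![(f₁ : G.Lie), (f₂ : G.Lie)] = S.dist.subtype ∘ ![f₁, f₂] := by
      ext i; fin_cases i <;> rfl
    rw [e]
    exact this
  have hli' : LinearIndependent ℝ ![f₀, (f₁ : G.Lie), (f₂ : G.Lie)] := by
    refine linearIndependent_finCons.2 ⟨hli, fun h => hf₀ ?_⟩
    refine Submodule.span_le.2 ?_ h
    rintro _ ⟨i, rfl⟩
    fin_cases i
    exacts [f₁.2, f₂.2]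
  refine ⟨basisOfLinearIndependentOfCardEqFinrank hli' (by simp [finrank_lie]), ?_, ?_, ?_⟩ <;> simp

end

/-- Every orthonormal frame can be completed by a Reeb field. -/
theorem exists_hasInvariants (S : LeftInvariantSR G) : ∃ κ χ, S.HasInvariants κ χ := by
  obtain ⟨f₁, f₂, h₁, h₂, h₁₂⟩ := S.exists_orthonormal
  obtain ⟨b, hb0, hb1, hb2⟩ := exists_basis_of_orthonormal h₁ h₂ h₁₂
    (lie_notMem_of_orthonormal h₁ h₂ h₁₂)
  have dec : ∀ v, ∃ x y z : ℝ, v = x • (f₁ : G.Lie) + y • (f₂ : G.Lie) +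
      z • ⁅(f₂ : G.Lie), (f₁ : G.Lie)⁆ := fun v => by
    refine ⟨b.repr v 1, b.repr v 2, b.repr v 0, ?_⟩
    have := b.sum_repr v
    rw [Fin.sum_univ_three, hb0, hb1, hb2] at this
    refine this.symm.trans ?_
    abel
  obtain ⟨x, y, z, hF₁⟩ := dec ⁅(f₁ : G.Lie), ⁅(f₂ : G.Lie), (f₁ : G.Lie)⁆⁆
  obtain ⟨x', y', z', hF₂⟩ := dec ⁅(f₂ : G.Lie), ⁅(f₂ : G.Lie), (f₁ : G.Lie)⁆⁆
  -- the horizontal part of `⁅f₂, f₁⁆` that makes the brackets with the Reeb field horizontal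
  refine ⟨_, _, ⁅(f₂ : G.Lie), (f₁ : G.Lie)⁆ - z' • (f₁ : G.Lie) + z • (f₂ : G.Lie), f₁, f₂,
    x, y, x', y', z', -z, h₁, h₂, h₁₂, ?_, ?_, ?_, rfl, rfl⟩
  · rw [lie_add, lie_sub, lie_smul, lie_smul, lie_self, hF₁, ← lie_skew (f₁ : G.Lie) (f₂ : G.Lie)]
    module
  · rw [lie_add, lie_sub, lie_smul, lie_smul, lie_self, hF₂]
    module
  · module

/-- Rotating the frame in the definition of the invariants gives a canonical frame. -/
theorem HasInvariants.exists_isCanonicalFrame {κ χ : ℝ} (h : S.HasInvariants κ χ) :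
    ∃ b w a₁ a₂, S.IsCanonicalFrame b χ w a₁ a₂ ∧ 0 ≤ χ ∧ κ = w - (a₁ ^ 2 + a₂ ^ 2) ∧
      (χ = 0 → a₁ = 0) := by
  obtain ⟨f₀, f₁, f₂, p, q, r, t, m, n, h₁, h₂, h₁₂, e1, e2, e3, hχ, hκ⟩ := h
  have hf₀ : f₀ ∉ S.dist := fun hf₀ => lie_notMem_of_orthonormal h₁ h₂ h₁₂ (by
    rw [e3]
    exact S.dist.add_mem (S.dist.add_mem (S.dist.smul_mem _ f₁.2) (S.dist.smul_mem _ f₂.2)) hf₀)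
  -- the Jacobi identity forces `ad f₀` to be traceless
  have htr : t = -p := by
    obtain ⟨b, hb0, hb1, hb2⟩ := exists_basis_of_orthonormal h₁ h₂ h₁₂ hf₀
    have hJ := lie_jacobi (f₁ : G.Lie) (f₂ : G.Lie) f₀
    rw [e2, ← lie_skew f₀ (f₁ : G.Lie), e1, ← lie_skew (f₁ : G.Lie) (f₂ : G.Lie), e3] at hJ
    simp only [lie_add, lie_smul, lie_neg, lie_self, ← lie_skew (f₁ : G.Lie) (f₂ : G.Lie), e3,
      ← lie_skew f₀ (f₁ : G.Lie), ← lie_skew f₀ (f₂ : G.Lie), e1, e2] at hJ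
    have := congrArg (fun v => b.repr v 0) hJ
    rw [← hb0, ← hb1, ← hb2] at this
    simp at this
    linarith
  subst htr
  set y := (q + r) / 2 with hy
  have hχ' : χ ^ 2 = p ^ 2 + y ^ 2 := by
    rw [hχ, Real.sq_sqrt] <;> nlinarith [sq_nonneg p, sq_nonneg y]
  have hχ0 : 0 ≤ χ := hχ ▸ Real.sqrt_nonneg _
  -- rotation by the angle with cosine `c` and sine `s`; the conditions say that it makes the
  -- symmetric part of `ad f₀` antidiagonal, with entries `χ`
  have rot : ∀ c s : ℝ, c ^ 2 + s ^ 2 = 1 → (c ^ 2 - s ^ 2) * p + 2 * c * s * y = 0 →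
      (c ^ 2 - s ^ 2) * y - 2 * c * s * p = χ →
      ∃ b, S.IsCanonicalFrame b χ ((q - r) / 2) (c * m + s * n) (-s * m + c * n) := by
    intro c s hcs hd ho
    set w := (q - r) / 2 with hw
    have hq : q = y + w := by rw [hy, hw]; ring
    have hr : r = y - w := by rw [hy, hw]; ring
    have hp : p = -(2 * c * s) * χ := by
      linear_combination (c ^ 2 - s ^ 2) * hd - 2 * c * s * ho - p * (c ^ 2 + s ^ 2 + 1) * hcs
    have hyC : y = (c ^ 2 - s ^ 2) * χ := by
      linear_combination 2 * c * s * hd + (c ^ 2 - s ^ 2) * ho - y * (c ^ 2 + s ^ 2 + 1) * hcs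
    set g₁ : S.dist := c • f₁ + s • f₂ with hg₁
    set g₂ : S.dist := -s • f₁ + c • f₂ with hg₂
    have h₂₁ : S.metric f₂ f₁ = 0 := by rw [S.metric_symm, h₁₂]
    have k₁ : S.metric g₁ g₁ = 1 := by
      simp only [hg₁, map_add, map_smul, LinearMap.add_apply, LinearMap.smul_apply, smul_eq_mul,
        h₁, h₂, h₁₂, h₂₁]
      linarith
    have k₂ : S.metric g₂ g₂ = 1 := by
      simp only [hg₂, map_add, map_smul, LinearMap.add_apply, LinearMap.smul_apply, smul_eq_mul,
        h₁, h₂, h₁₂, h₂₁]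
      linarith
    have k₁₂ : S.metric g₁ g₂ = 0 := by
      simp only [hg₁, hg₂, map_add, map_smul, LinearMap.add_apply, LinearMap.smul_apply,
        smul_eq_mul, h₁, h₂, h₁₂, h₂₁]
      ring
    obtain ⟨b, hb0, hb1, hb2⟩ := exists_basis_of_orthonormal k₁ k₂ k₁₂ hf₀
    have v₁ : (g₁ : G.Lie) = c • (f₁ : G.Lie) + s • (f₂ : G.Lie) := rfl
    have v₂ : (g₂ : G.Lie) = -s • (f₁ : G.Lie) + c • (f₂ : G.Lie) := rfl
    have m1 : b 1 ∈ S.dist := hb1 ▸ g₁.2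
    have m2 : b 2 ∈ S.dist := hb2 ▸ g₂.2
    have s1 : (⟨b 1, m1⟩ : S.dist) = g₁ := Subtype.ext hb1
    have s2 : (⟨b 2, m2⟩ : S.dist) = g₂ := Subtype.ext hb2
    refine ⟨b, m1, m2, by rw [s1, k₁], by rw [s2, k₂], by rw [s1, s2, k₁₂], ?_, ?_, ?_⟩
    · rw [hb0, hb1, hb2, v₁, v₂, add_lie, smul_lie, smul_lie, e1, e2]
      have i1 : c * p + s * r = (χ + w) * -s := by
        linear_combination c * hp + s * hyC + s * hr - s * χ * hcs
      have i2 : c * q + s * -p = (χ + w) * c := by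
        linear_combination -s * hp + c * hyC + c * hq + c * χ * hcs
      simp only [smul_add, smul_smul]
      linear_combination (norm := module) i1 • (f₁ : G.Lie) + i2 • (f₂ : G.Lie)
    · rw [hb0, hb1, hb2, v₁, v₂, add_lie, smul_lie, smul_lie, e1, e2]
      have i1 : -s * p + c * r = (χ - w) * c := by
        linear_combination -s * hp + c * hyC + c * hr + c * χ * hcs
      have i2 : -s * q + c * -p = (χ - w) * s := by
        linear_combination -c * hp - s * hyC - s * hq + s * χ * hcs
      simp only [smul_add, smul_smul]
      linear_combination (norm := module) i1 • (f₁ : G.Lie) + i2 • (f₂ : G.Lie)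
    · rw [hb0, hb1, hb2, v₁, v₂]
      simp only [lie_add, add_lie, smul_lie, lie_smul, lie_self,
        ← lie_skew (f₁ : G.Lie) (f₂ : G.Lie), e3]
      linear_combination (norm := module) hcs • f₀
  -- the angle is half of the angle of `(y, -p)`, unless this vector vanishes
  have key : ∃ c s : ℝ, c ^ 2 + s ^ 2 = 1 ∧ (c ^ 2 - s ^ 2) * p + 2 * c * s * y = 0 ∧
      (c ^ 2 - s ^ 2) * y - 2 * c * s * p = χ ∧ (χ = 0 → c * m + s * n = 0) := by
    rcases eq_or_ne χ 0 with h0 | h0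
    · -- every frame is canonical, and the first one can be taken orthogonal to `(m, n)`
      have hp : p = 0 := by nlinarith [sq_nonneg p, sq_nonneg y]
      have hy0 : y = 0 := by nlinarith [sq_nonneg p, sq_nonneg y]
      rcases eq_or_ne (m ^ 2 + n ^ 2) 0 with hmn | hmn
      · have hm : m = 0 := by nlinarith [sq_nonneg m, sq_nonneg n]
        have hn : n = 0 := by nlinarith [sq_nonneg m, sq_nonneg n]
        exact ⟨1, 0, by simp, by simp [hp], by simp [hy0, h0], by simp [hm]⟩
      · have hpos : 0 < m ^ 2 + n ^ 2 := lt_of_le_of_ne (by positivity) hmn.symm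
        refine ⟨n / √(m ^ 2 + n ^ 2), -m / √(m ^ 2 + n ^ 2), ?_, by simp [hp, hy0],
          by simp [hp, hy0, h0], fun _ => by ring⟩
        rw [div_pow, div_pow, Real.sq_sqrt hpos.le]
        field_simp
        ring
    · obtain ⟨c, s, h1, h2, h3⟩ := exists_sq_sub_sq_and_two_mul (u := y / χ) (v := -p / χ) (by
        field_simp
        linarith)
      refine ⟨c, s, h1, ?_, ?_, fun h => absurd h h0⟩
      · rw [h2, h3]; ring
      · rw [h2, h3]
        field_simp
        linarith
  obtain ⟨c, s, hcs, hd, ho, h0⟩ := key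
  obtain ⟨b, hb⟩ := rot c s hcs hd ho
  refine ⟨b, _, _, _, hb, hχ0, ?_, h0⟩
  rw [hκ]
  linear_combination (m ^ 2 + n ^ 2) * hcs

namespace IsCanonicalFrame

variable {b : Module.Basis (Fin 3) ℝ G.Lie} {b' : Module.Basis (Fin 3) ℝ H.Lie}
  {χ w a₁ a₂ χ' w' a₁' a₂' : ℝ}

/-- The only constraints imposed by the Jacobi identity. -/
theorem jacobi (h : S.IsCanonicalFrame b χ w a₁ a₂) : a₁ * (χ + w) = 0 ∧ a₂ * (χ - w) = 0 := by
  have hJ := lie_jacobi (b 0) (b 1) (b 2)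
  rw [← lie_skew (b 1) (b 2), h.lie₂₁, h.lie₂₀, ← lie_skew (b 0) (b 1), h.lie₁₀] at hJ
  simp only [lie_add, lie_smul, lie_neg, lie_self, ← lie_skew (b 0) (b 1), ← lie_skew (b 0) (b 2),
    h.lie₁₀, h.lie₂₀] at hJ
  constructor
  · have := congrArg (fun v => b.repr v 2) hJ
    simp only [map_add, map_neg, map_smul, map_zero] at this
    simp at this
    linear_combination this
  · have := congrArg (fun v => b.repr v 1) hJ
    simpa using this

theorem hasInvariants (h : S.IsCanonicalFrame b χ w a₁ a₂) (hχ : 0 ≤ χ) :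
    S.HasInvariants (w - (a₁ ^ 2 + a₂ ^ 2)) χ := by
  refine ⟨b 0, ⟨b 1, h.mem₁⟩, ⟨b 2, h.mem₂⟩, 0, χ + w, χ - w, 0, a₁, a₂, h.metric₁₁, h.metric₂₂,
    h.metric₁₂, by simp [h.lie₁₀], by simp [h.lie₂₀], h.lie₂₁, ?_, by ring⟩
  have : -(0 * 0 - ((χ + w + (χ - w)) / 2) ^ 2) = χ ^ 2 := by ring
  rw [this, Real.sqrt_sq hχ]

end IsCanonicalFrame

theorem LocallyIsometric.refl (S : LeftInvariantSR G) : S.LocallyIsometric S := by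
  refine fun p => ⟨OpenPartialHomeomorph.refl _, trivial, ?_, ?_, fun q _ => ?_⟩
  · exact contMDiffOn_id
  · exact contMDiffOn_id
  · refine ⟨LinearEquiv.refl ℝ _, fun v => ?_, fun v w => rfl⟩
    have : mfderiv (𝓡 3) (𝓡 3) (OpenPartialHomeomorph.refl G.carrier) q =
      ContinuousLinearMap.id ℝ (TangentSpace (𝓡 3) q) := mfderiv_id
    exact DFunLike.congr_fun this _

/-- Locally isometric structures have the same invariants. -/
theorem HasInvariants.eq_of_locallyIsometric {κ χ κ' χ' : ℝ} (hS : S.HasInvariants κ χ)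
    (hT : T.HasInvariants κ' χ') (h : S.LocallyIsometric T) : κ = κ' ∧ χ = χ' := by
  obtain ⟨b, w, a₁, a₂, hb, h0, rfl, -⟩ := hS.exists_isCanonicalFrame
  obtain ⟨b', w', a₁', a₂', hb', h0', rfl, -⟩ := hT.exists_isCanonicalFrame
  exact ⟨(hb.invariant hb' h0 h0' h).2.1, (hb.invariant hb' h0 h0' h).1⟩

theorem existsUnique_hasInvariants (S : LeftInvariantSR G) :
    ∃! p : ℝ × ℝ, S.HasInvariants p.1 p.2 := by
  obtain ⟨κ, χ, h⟩ := S.exists_hasInvariants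
  refine ⟨(κ, χ), h, fun p hp => ?_⟩
  obtain ⟨h1, h2⟩ := hp.eq_of_locallyIsometric h (.refl S)
  exact Prod.ext h1 h2

theorem HasInvariants.dilate {κ χ : ℝ} (h : S.HasInvariants κ χ) {c : ℝ} (hc : 0 < c) :
    (S.dilate c hc).HasInvariants (c ^ 2 * κ) (c ^ 2 * χ) := by
  obtain ⟨f₀, f₁, f₂, p, q, r, t, m, n, h₁, h₂, h₁₂, e1, e2, e3, rfl, rfl⟩ := h
  have hm : ∀ v v' : S.dist, (S.dilate c hc).metric (c • v : S.dist) (c • v' : S.dist) =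
      S.metric v v' := by
    intro v v'
    change (c ^ 2)⁻¹ • S.metric (c • v) (c • v') = _
    simp only [map_smul, LinearMap.smul_apply, smul_eq_mul]
    field_simp
  refine ⟨c ^ 2 • f₀, (c • f₁ : S.dist), (c • f₂ : S.dist), c ^ 2 * p, c ^ 2 * q, c ^ 2 * r,
    c ^ 2 * t, c * m, c * n, by rw [hm, h₁], by rw [hm, h₂], by rw [hm, h₁₂], ?_, ?_, ?_, ?_,
    by ring⟩
  · change ⁅c • (f₁ : G.Lie), c ^ 2 • f₀⁆ = (c ^ 2 * p) • c • (f₁ : G.Lie) +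
      (c ^ 2 * q) • c • (f₂ : G.Lie)
    rw [lie_smul, smul_lie, e1]
    module
  · change ⁅c • (f₂ : G.Lie), c ^ 2 • f₀⁆ = (c ^ 2 * r) • c • (f₁ : G.Lie) +
      (c ^ 2 * t) • c • (f₂ : G.Lie)
    rw [lie_smul, smul_lie, e2]
    module
  · change ⁅c • (f₂ : G.Lie), c • (f₁ : G.Lie)⁆ = (c * m) • c • (f₁ : G.Lie) +
      (c * n) • c • (f₂ : G.Lie) + c ^ 2 • f₀
    rw [lie_smul, smul_lie, e3]
    module
  · rw [← Real.sqrt_sq (by positivity : 0 ≤ c ^ 2), ← Real.sqrt_mul (by positivity),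
      Real.sqrt_sq (by positivity : 0 ≤ c ^ 2)]
    congr 1
    ring

theorem exists_dilate_isNormalized (S : LeftInvariantSR G) :
    ∃ (c : ℝ) (hc : 0 < c), (S.dilate c hc).IsNormalized := by
  obtain ⟨κ, χ, h⟩ := S.exists_hasInvariants
  rcases eq_or_ne (χ ^ 2 + κ ^ 2) 0 with h0 | h0
  · have hχ : χ = 0 := by nlinarith [sq_nonneg χ, sq_nonneg κ]
    have hκ : κ = 0 := by nlinarith [sq_nonneg χ, sq_nonneg κ]
    exact ⟨1, one_pos, _, _, h.dilate one_pos, .inl (by simp [hχ, hκ])⟩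
  · have hr : 0 < √(χ ^ 2 + κ ^ 2) := Real.sqrt_pos.2 (lt_of_le_of_ne (by positivity) h0.symm)
    have hc : 0 < √(√(χ ^ 2 + κ ^ 2))⁻¹ := Real.sqrt_pos.2 (inv_pos.2 hr)
    refine ⟨_, hc, _, _, h.dilate hc, .inr ?_⟩
    rw [Real.sq_sqrt (inv_pos.2 hr).le, mul_pow, mul_pow, ← mul_add, inv_pow,
      Real.sq_sqrt (by positivity), inv_mul_cancel₀ h0]

/-- Dilations act freely on the invariants of a normalized structure, unless they vanish. -/
theorem IsNormalized.hasInvariants_dilate {κ χ : ℝ} (hS : S.IsNormalized) (hT : T.IsNormalized)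
    {c : ℝ} (hc : 0 < c) (h : (S.dilate c hc).LocallyIsometric T) (hκ : S.HasInvariants κ χ) :
    T.HasInvariants κ χ := by
  obtain ⟨κ₀, χ₀, h₀, hn⟩ := hS
  obtain ⟨rfl, rfl⟩ := h₀.eq_of_locallyIsometric hκ (.refl S)
  obtain ⟨κ', χ', h', hn'⟩ := hT
  obtain ⟨rfl, rfl⟩ := (hκ.dilate hc).eq_of_locallyIsometric h' h
  rcases hn with ⟨rfl, rfl⟩ | hn
  · simpa using h'
  · have e : (c ^ 2) ^ 2 = 1 := by
      rcases hn' with ⟨h1, h2⟩ | hn'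
      · have : (c ^ 2 * χ₀) ^ 2 + (c ^ 2 * κ₀) ^ 2 = (c ^ 2) ^ 2 := by
          linear_combination (c ^ 2) ^ 2 * hn
        rw [h1, h2] at this
        nlinarith [pow_pos hc 2, pow_pos hc 4]
      · linear_combination hn' - (c ^ 2) ^ 2 * hn
    have e' : c ^ 2 = 1 := by nlinarith [pow_pos hc 2]
    simpa [e'] using h'

end LeftInvariantSR

end

/-! ### Local isometries between structures with the same constants -/

noncomputable section

open Set Filter Topology Metric

section

variable {L L' : Type*} [LieRing L] [LieAlgebra ℝ L] [LieRing L'] [LieAlgebra ℝ L']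

/-- Bases of three-dimensional Lie algebras with the same structure constants define an
isomorphism. -/
theorem Module.Basis.exists_lieEquiv (b : Module.Basis (Fin 3) ℝ L) (b' : Module.Basis (Fin 3) ℝ L')
    (h₁₀ : b.equiv b' (Equiv.refl _) ⁅b 1, b 0⁆ = ⁅b' 1, b' 0⁆)
    (h₂₀ : b.equiv b' (Equiv.refl _) ⁅b 2, b 0⁆ = ⁅b' 2, b' 0⁆)
    (h₂₁ : b.equiv b' (Equiv.refl _) ⁅b 2, b 1⁆ = ⁅b' 2, b' 1⁆) :
    ∃ e : L ≃ₗ⁅ℝ⁆ L', ∀ i, e (b i) = b' i := by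
  set B := b.equiv b' (Equiv.refl _) with hB
  have hb : ∀ i, B (b i) = b' i := fun i => by simp [hB]
  have key : (LieModule.toEnd ℝ L L : L →ₗ[ℝ] L →ₗ[ℝ] L).compr₂ B.toLinearMap =
      (LieModule.toEnd ℝ L' L' : L' →ₗ[ℝ] L' →ₗ[ℝ] L').compl₁₂ B.toLinearMap B.toLinearMap := by
    refine b.ext fun i => b.ext fun j => ?_
    change B ⁅b i, b j⁆ = ⁅B (b i), B (b j)⁆
    rw [hb, hb]
    fin_cases i <;> fin_cases j
    · simp
    · change B ⁅b 0, b 1⁆ = ⁅b' 0, b' 1⁆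
      rw [← lie_skew, map_neg, h₁₀, lie_skew]
    · change B ⁅b 0, b 2⁆ = ⁅b' 0, b' 2⁆
      rw [← lie_skew, map_neg, h₂₀, lie_skew]
    · exact h₁₀
    · simp
    · change B ⁅b 1, b 2⁆ = ⁅b' 1, b' 2⁆
      rw [← lie_skew, map_neg, h₂₁, lie_skew]
    · exact h₂₀
    · exact h₂₁
    · simp
  exact ⟨{ B with map_lie' := fun {v w} => LinearMap.congr_fun₂ key v w }, hb⟩

end

namespace LieGroup3

variable {G : LieGroup3.{u}}

theorem IsSecondKind.mono {a₁ a₂ a₃ : E3} {ε ε' : ℝ} {Ψ : ℝ × ℝ × ℝ → G.carrier}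
    (h : IsSecondKind G a₁ a₂ a₃ ε Ψ) (hε : ε' ≤ ε) : IsSecondKind G a₁ a₂ a₃ ε' Ψ where
  smooth x hx := h.smooth x (ball_subset_ball hε hx)
  third x hx := h.third x (ball_subset_ball hε hx)
  second x y hx := h.second x y (ball_subset_ball hε hx)
  first x hx := h.first x (ball_subset_ball hε hx)
  ode_third v hv x y z hx := h.ode_third v hv x y z (ball_subset_ball hε hx)
  ode_second x y hx := h.ode_second x y (ball_subset_ball hε hx)

theorem IsSecondKind.logDeriv_bijective {a₁ a₂ a₃ : E3} {ε : ℝ} {Ψ : ℝ × ℝ × ℝ → G.carrier}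
    (h : IsSecondKind G a₁ a₂ a₃ ε Ψ) (hε : 0 < ε) (ha : LinearIndependent ℝ ![a₁, a₂, a₃]) :
    Function.Bijective (G.logDeriv Ψ 0) := by
  have h0 : (0 : ℝ × ℝ × ℝ) ∈ ball (0 : ℝ × ℝ × ℝ) ε := mem_ball_self hε
  have e1 : G.logDeriv Ψ 0 (1, 0, 0) = a₁ := h.first 0 h0
  have e2 : G.logDeriv Ψ 0 (0, 1, 0) = a₂ := h.second 0 0 h0
  have e3 : G.logDeriv Ψ 0 (0, 0, 1) = a₃ := h.third 0 h0
  have hinj : Function.Injective (G.logDeriv Ψ 0 : ℝ × ℝ × ℝ →ₗ[ℝ] E3) := by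
    rw [← LinearMap.ker_eq_bot, LinearMap.ker_eq_bot']
    rintro ⟨x, y, z⟩ hv
    have hd : ((x, y, z) : ℝ × ℝ × ℝ) = x • (1, 0, 0) + y • (0, 1, 0) + z • (0, 0, 1) := by simp
    rw [ContinuousLinearMap.coe_coe, hd, map_add, map_add, map_smul, map_smul, map_smul, e1, e2,
      e3] at hv
    have := Fintype.linearIndependent_iff.1 ha ![x, y, z] (by simpa [Fin.sum_univ_three] using hv)
    have hx := this 0
    have hy := this 1
    have hz := this 2
    simp at hx hy hz
    simp [hx, hy, hz]
  exact ⟨hinj, (LinearMap.injective_iff_surjective_of_finrank_eq_finrank (by simp)).1 hinj⟩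

end LieGroup3

namespace LeftInvariantSR

open LieGroup3

variable {G : LieGroup3.{u}} {H : LieGroup3.{v}} {S : LeftInvariantSR G} {T : LeftInvariantSR H}

theorem hasDerivAt_exp_smul_apply (A : E3 →L[ℝ] E3) (v : E3) (t : ℝ) :
    HasDerivAt (fun t : ℝ => NormedSpace.exp (t • A) v) (A (NormedSpace.exp (t • A) v)) t := by
  have := (hasDerivAt_exp_smul_const' A t).clm_apply (hasDerivAt_const t v)
  rw [map_zero, add_zero] at this
  exact this

theorem exp_zero_smul_apply (A : E3 →L[ℝ] E3) (v : E3) :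
    NormedSpace.exp ((0 : ℝ) • A) v = v := by
  exact DFunLike.congr_fun ((congrArg NormedSpace.exp (zero_smul ℝ A)).trans NormedSpace.exp_zero) v

/-- A local isometry is obtained from coordinates of the second kind whose Maurer–Cartan forms
correspond under a family of linear maps depending on the last coordinate only. -/
theorem locallyIsometric_of_ode {a₁ a₂ a₃ b₁ b₂ b₃ : E3}
    (ha : LinearIndependent ℝ ![a₁, a₂, a₃]) (hb : LinearIndependent ℝ ![b₁, b₂, b₃])
    (Q : ℝ → E3 →L[ℝ] E3) (h₁ : Q 0 a₁ = b₁) (h₂ : Q 0 a₂ = b₂) (h₃ : ∀ t, Q t a₃ = b₃)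
    (hQ : ∀ t, HasDerivAt Q (Q t ∘L G.br a₃ - H.br b₃ ∘L Q t) t)
    (z : ℝ → E3) (hz : z 0 = a₁) (hz₁ : ∀ t, HasDerivAt z (-G.br a₂ (z t)) t)
    (hz₂ : ∀ t, HasDerivAt (fun t => Q 0 (z t)) (-H.br b₂ (Q 0 (z t))) t)
    (hA : ∀ t, ∃ A : S.dist ≃ₗ[ℝ] T.dist, (∀ v, ((A v : H.Lie) : E3) = Q t (v : G.Lie)) ∧
        ∀ v w, T.metric (A v) (A w) = S.metric v w) :
    S.LocallyIsometric T := by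
  obtain ⟨ε₁, hε₁, Φ, hΦ⟩ := G.exists_isSecondKind a₁ a₂ a₃
  obtain ⟨ε₂, hε₂, Ψ, hΨ⟩ := H.exists_isSecondKind b₁ b₂ b₃
  have hε : 0 < min ε₁ ε₂ := lt_min hε₁ hε₂
  replace hΦ := hΦ.mono (min_le_left ε₁ ε₂)
  replace hΨ := hΨ.mono (min_le_right ε₁ ε₂)
  exact locallyIsometric_of_logDeriv isOpen_ball (mem_ball_self hε) hΦ.smooth hΨ.smooth
    (hΦ.logDeriv_bijective hε ha) (hΨ.logDeriv_bijective hε hb) fun y hy =>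
      ⟨Q y.2.2, hΨ.logDeriv_eq hΦ Q h₁ h₂ h₃ hQ z hz hz₁ hz₂ hy, hA _⟩

namespace IsCanonicalFrame

variable {b : Module.Basis (Fin 3) ℝ G.Lie} {b' : Module.Basis (Fin 3) ℝ H.Lie}
  {χ w a₁ a₂ χ' w' a₁' a₂' : ℝ}

/-- A linear map that rotates one horizontal frame into another restricts to an isometry. -/
theorem exists_isometry (hS : S.IsCanonicalFrame b χ w a₁ a₂)
    (hT : T.IsCanonicalFrame b' χ' w' a₁' a₂') (Q : E3 →L[ℝ] E3) {c s : ℝ} (hcs : c ^ 2 + s ^ 2 = 1)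
    (h₁ : Q (b 1) = c • (b' 1 : E3) + s • (b' 2 : E3))
    (h₂ : Q (b 2) = -s • (b' 1 : E3) + c • (b' 2 : E3)) :
    ∃ A : S.dist ≃ₗ[ℝ] T.dist, (∀ v, ((A v : H.Lie) : E3) = Q (v : G.Lie)) ∧
        ∀ v w, T.metric (A v) (A w) = S.metric v w := by
  let Q' : G.Lie →ₗ[ℝ] H.Lie := (Q : E3 →ₗ[ℝ] E3)
  have hQ' : ∀ x y : ℝ, Q' (x • b 1 + y • b 2) = (x * c - y * s) • b' 1 + (x * s + y * c) • b' 2 := by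
    intro x y
    have e1 : Q' (b 1) = c • b' 1 + s • b' 2 := h₁
    have e2 : Q' (b 2) = -s • b' 1 + c • b' 2 := h₂
    rw [map_add, map_smul, map_smul, e1, e2]
    module
  have hcomb : ∀ v : S.dist, ∃ x y : ℝ, (v : G.Lie) = x • b 1 + y • b 2 := fun v => by
    obtain ⟨x, y, hxy⟩ := hS.exists_combination v
    exact ⟨x, y, congrArg Subtype.val hxy⟩
  have hmem : ∀ v : S.dist, Q' v ∈ T.dist := fun v => by
    obtain ⟨x, y, hxy⟩ := hcomb v
    rw [hxy, hQ']
    exact T.dist.add_mem (T.dist.smul_mem _ hT.mem₁) (T.dist.smul_mem _ hT.mem₂)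
  let A₀ : S.dist →ₗ[ℝ] T.dist := (Q' ∘ₗ S.dist.subtype).codRestrict T.dist hmem
  have hA₀ : ∀ v, (A₀ v : H.Lie) = Q' v := fun v => rfl
  have hm : ∀ v w, T.metric (A₀ v) (A₀ w) = S.metric v w := by
    intro v v'
    obtain ⟨x, y, hxy⟩ := hcomb v
    obtain ⟨x', y', hxy'⟩ := hcomb v'
    rw [hS.metric_eq hxy hxy', hT.metric_eq (by rw [hA₀, hxy, hQ']) (by rw [hA₀, hxy', hQ'])]
    linear_combination (x * x' + y * y') * hcs
  have hinj : Function.Injective A₀ := by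
    rw [← LinearMap.ker_eq_bot, LinearMap.ker_eq_bot']
    intro v hv
    by_contra hne
    have := S.metric_pos v hne
    rw [← hm, hv] at this
    simp at this
  have : FiniteDimensional ℝ S.dist := inferInstance
  have : FiniteDimensional ℝ T.dist := inferInstance
  exact ⟨A₀.linearEquivOfInjective hinj (by rw [S.rank_two, T.rank_two]), fun v => rfl, hm⟩

theorem linearIndependent_frame (b : Module.Basis (Fin 3) ℝ G.Lie) {i j k : Fin 3}
    (h : Function.Injective ![i, j, k]) : LinearIndependent ℝ (![b i, b j, b k] : Fin 3 → E3) := by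
  have e : (![b i, b j, b k] : Fin 3 → E3) = b ∘ ![i, j, k] := by
    ext1 l
    fin_cases l <;> rfl
  rw [e]
  exact b.linearIndependent.comp _ h

theorem linearIndependent_of_ne_zero (b : Module.Basis (Fin 3) ℝ G.Lie) {a : ℝ} (ha : a ≠ 0) :
    LinearIndependent ℝ (![(a • b 2 + b 0 : G.Lie), b 1, b 0] : Fin 3 → E3) := by
  have : LinearIndependent ℝ ![a • b 2 + b 0, b 1, b 0] := by
    rw [Fintype.linearIndependent_iff]
    intro g hg
    rw [Fin.sum_univ_three] at hg
    have e0 := congrArg (fun v => b.repr v 0) hg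
    have e1 := congrArg (fun v => b.repr v 1) hg
    have e2 := congrArg (fun v => b.repr v 2) hg
    simp at e0 e1 e2
    have h0 : g 0 = 0 := e2.resolve_right ha
    intro i
    fin_cases i
    · exact h0
    · exact e1
    · change g 2 = 0
      rw [h0] at e0
      simpa using e0
  exact this

theorem exists_lieEquiv (hS : S.IsCanonicalFrame b χ w a₁ a₂) (hT : T.IsCanonicalFrame b' χ w a₁ a₂) :
    ∃ e : G.Lie ≃ₗ⁅ℝ⁆ H.Lie, ∀ i, e (b i) = b' i := by
  apply b.exists_lieEquiv b'
  · rw [hS.lie₁₀, hT.lie₁₀]; simp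
  · rw [hS.lie₂₀, hT.lie₂₀]; simp
  · rw [hS.lie₂₁, hT.lie₂₁]; simp

/-- Structures with the same canonical structure constants are locally isometric, as there is an
isomorphism of their Lie algebras that preserves the frame. -/
theorem locallyIsometric (hS : S.IsCanonicalFrame b χ w a₁ a₂)
    (hT : T.IsCanonicalFrame b' χ w a₁ a₂) : S.LocallyIsometric T := by
  obtain ⟨e, he⟩ := hS.exists_lieEquiv hT
  let B : E3 →L[ℝ] E3 := LinearMap.toContinuousLinearMap (e : G.Lie →ₗ[ℝ] H.Lie)
  have hB : ∀ v w : E3, B (G.br v w) = H.br (B v) (B w) := fun v w => e.map_lie v w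
  have hd := hasDerivAt_exp_smul_apply (-G.br (b 1)) (b 2)
  refine locallyIsometric_of_ode (a₁ := b 2) (a₂ := b 1) (a₃ := b 0) (b₁ := b' 2) (b₂ := b' 1)
    (b₃ := b' 0) (linearIndependent_frame b (by decide)) (linearIndependent_frame b' (by decide))
    (fun _ => B) (he 2) (he 1) (fun _ => he 0) (fun t => ?_)
    (fun t => NormedSpace.exp (t • -G.br (b 1)) (b 2 : E3)) ?_ hd (fun t => ?_) (fun t => ?_)
  · refine (hasDerivAt_const t B).congr_deriv ?_
    symm
    rw [sub_eq_zero]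
    ext1 v
    exact (hB (b 0) v).trans (congrArg (fun u => H.br u (B v)) (he 0))
  · exact exp_zero_smul_apply _ _
  · refine (B.hasFDerivAt.comp_hasDerivAt t (hd t)).congr_deriv ?_
    refine (map_neg B _).trans (congrArg Neg.neg ?_)
    exact (hB (b 1) _).trans (congrArg (fun u => H.br u _) (he 1))
  · exact hS.exists_isometry hT B (c := 1) (s := 0) (by norm_num)
      ((he 1).trans (by simp)) ((he 2).trans (by simp))

/-- The exceptional local isometries between structures whose Lie algebras are not isomorphic:
for `χ = 0` and `κ = -a² < 0`, the flow of the Reeb field of the structure on `SL(2)` acts by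
isometries, and is used to compensate for the bracket with the Reeb field; on a complement of the
Reeb field both Lie algebras contain the same two-dimensional subalgebra. -/
theorem locallyIsometric_of_reeb_central {a : ℝ} (ha : a ≠ 0) (hS : S.IsCanonicalFrame b 0 0 0 a)
    (hT : T.IsCanonicalFrame b' 0 (-a ^ 2) 0 0) : S.LocallyIsometric T := by
  set w := -a ^ 2 with hw
  let L : (Fin 3 → H.Lie) → E3 →L[ℝ] E3 := fun f =>
    LinearMap.toContinuousLinearMap (b.constr ℝ f : G.Lie →ₗ[ℝ] H.Lie)
  have hL : ∀ f i, L f (b i) = f i := fun f i => b.constr_basis ℝ f i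
  set Q : ℝ → E3 →L[ℝ] E3 := fun t => L ![b' 0, 0, 0] + (Real.cos (w * t) • L ![0, b' 1, b' 2] +
    Real.sin (w * t) • L ![0, b' 2, -b' 1]) with hQ
  have q0 : ∀ t, Q t (b 0) = b' 0 := fun t => by
    have e : Q t (b 0) = L ![b' 0, 0, 0] (b 0) + (Real.cos (w * t) • L ![0, b' 1, b' 2] (b 0) +
      Real.sin (w * t) • L ![0, b' 2, -b' 1] (b 0)) := rfl
    rw [e, hL, hL, hL]
    change b' 0 + (Real.cos (w * t) • (0 : H.Lie) + Real.sin (w * t) • (0 : H.Lie)) = _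
    simp
  have q1 : ∀ t, Q t (b 1) = (Real.cos (w * t) • b' 1 + Real.sin (w * t) • b' 2 : H.Lie) := fun t => by
    have e : Q t (b 1) = L ![b' 0, 0, 0] (b 1) + (Real.cos (w * t) • L ![0, b' 1, b' 2] (b 1) +
      Real.sin (w * t) • L ![0, b' 2, -b' 1] (b 1)) := rfl
    rw [e, hL, hL, hL]
    exact zero_add _
  have q2 : ∀ t, Q t (b 2) = (-Real.sin (w * t) • b' 1 + Real.cos (w * t) • b' 2 : H.Lie) := fun t => by
    have e : Q t (b 2) = L ![b' 0, 0, 0] (b 2) + (Real.cos (w * t) • L ![0, b' 1, b' 2] (b 2) +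
      Real.sin (w * t) • L ![0, b' 2, -b' 1] (b 2)) := rfl
    rw [e, hL, hL, hL]
    change (0 : H.Lie) + (Real.cos (w * t) • b' 2 + Real.sin (w * t) • -b' 1) = _
    module
  have ext3 : ∀ A B : E3 →L[ℝ] E3, (∀ i, A (b i) = B (b i)) → A = B := fun A B h =>
    ContinuousLinearMap.coe_injective (b.ext (f₁ := (A : E3 →ₗ[ℝ] E3)) (f₂ := (B : E3 →ₗ[ℝ] E3)) h)
  -- `b 1` and `y` span the subalgebra that both Lie algebras contain
  set y : G.Lie := a • b 2 + b 0 with hy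
  set y' : H.Lie := a • b' 2 + b' 0 with hy'
  have hQy : Q 0 y = y' := by
    have e : Q 0 y = a • Q 0 (b 2) + Q 0 (b 0) := by
      exact ((Q 0).map_add _ _).trans (congrArg (· + Q 0 (b 0)) ((Q 0).map_smul _ _))
    rw [e, q2, q0]
    change a • (-Real.sin (w * 0) • b' 1 + Real.cos (w * 0) • b' 2) + b' 0 = _
    simp [hy']
  have hbr : G.br (b 1) y = (-a • y : G.Lie) := by
    change ⁅b 1, y⁆ = -a • y
    rw [hy, lie_add, lie_smul, ← lie_skew (b 1) (b 2), hS.lie₂₁, hS.lie₁₀]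
    module
  have hbr' : H.br (b' 1) y' = (-a • y' : H.Lie) := by
    change ⁅b' 1, y'⁆ = -a • y'
    rw [hy', lie_add, lie_smul, ← lie_skew (b' 1) (b' 2), hT.lie₂₁, hT.lie₁₀]
    module
  have hexp : ∀ t, HasDerivAt (fun t => Real.exp (a * t)) (a * Real.exp (a * t)) t := fun t => by
    have := ((hasDerivAt_id t).const_mul a).exp
    simpa [mul_comm] using this
  obtain ⟨Y, hY⟩ : ∃ Y : E3, Y = y := ⟨_, rfl⟩
  obtain ⟨Y', hY'⟩ : ∃ Y : E3, Y = y' := ⟨_, rfl⟩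
  rw [← hY, ← hY'] at hQy
  replace hbr : G.br (b 1) Y = -a • Y := by rw [hY]; exact hbr
  replace hbr' : H.br (b' 1) Y' = -a • Y' := by rw [hY']; exact hbr'
  refine locallyIsometric_of_ode (a₁ := Y) (a₂ := b 1) (a₃ := b 0) (b₁ := Y') (b₂ := b' 1)
    (b₃ := b' 0) ?_ ?_ Q hQy ?_ q0 (fun t => ?_) (fun t => Real.exp (a * t) • Y) (by simp)
    (fun t => ?_) (fun t => ?_) (fun t => ?_)
  · rw [hY]; exact linearIndependent_of_ne_zero b ha
  · rw [hY']; exact linearIndependent_of_ne_zero b' ha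
  · refine (q1 0).trans ?_
    rw [mul_zero, Real.cos_zero, Real.sin_zero, one_smul, zero_smul, add_zero]
  · have h1 := (((hasDerivAt_id t).const_mul w).cos.smul_const (L ![0, b' 1, b' 2])).add
      (((hasDerivAt_id t).const_mul w).sin.smul_const (L ![0, b' 2, -b' 1]))
    refine (h1.const_add (L ![b' 0, 0, 0])).congr_deriv (ext3 _ _ fun i => ?_)
    have e1 : ((-Real.sin (w * t) * (w * 1)) • L ![0, b' 1, b' 2] +
        (Real.cos (w * t) * (w * 1)) • L ![0, b' 2, -b' 1]) (b i) =
        ((-Real.sin (w * t) * (w * 1)) • (![0, b' 1, b' 2] : Fin 3 → H.Lie) i +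
        (Real.cos (w * t) * (w * 1)) • (![0, b' 2, -b' 1] : Fin 3 → H.Lie) i : H.Lie) := by
      rw [← hL ![0, b' 1, b' 2] i, ← hL ![0, b' 2, -b' 1] i]; rfl
    let R : G.Lie →ₗ[ℝ] H.Lie := (Q t : E3 →ₗ[ℝ] E3)
    have e2 : (Q t ∘L G.br (b 0) - H.br (b' 0) ∘L Q t) (b i) =
        R ⁅b 0, b i⁆ - ⁅b' 0, R (b i)⁆ := rfl
    refine e1.trans (Eq.trans ?_ e2.symm)
    have z0 : ∀ v : G.Lie, v = 0 → R v = 0 := fun v hv => by rw [hv, map_zero]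
    fin_cases i
    · change (-Real.sin (w * t) * (w * 1)) • (0 : H.Lie) + (Real.cos (w * t) * (w * 1)) • (0 : H.Lie) =
        R ⁅b 0, b 0⁆ - ⁅b' 0, R (b 0)⁆
      rw [z0 _ (lie_self _), show R (b 0) = b' 0 from q0 t, lie_self]
      simp
    · change (-Real.sin (w * t) * (w * 1)) • b' 1 + (Real.cos (w * t) * (w * 1)) • b' 2 =
        R ⁅b 0, b 1⁆ - ⁅b' 0, R (b 1)⁆
      rw [z0 _ (by rw [← lie_skew, hS.lie₁₀]; simp), show R (b 1) = _ from q1 t,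
        lie_add, lie_smul, lie_smul, ← lie_skew, hT.lie₁₀, ← lie_skew, hT.lie₂₀]
      module
    · change (-Real.sin (w * t) * (w * 1)) • b' 2 + (Real.cos (w * t) * (w * 1)) • -b' 1 =
        R ⁅b 0, b 2⁆ - ⁅b' 0, R (b 2)⁆
      rw [z0 _ (by rw [← lie_skew, hS.lie₂₀]; simp), show R (b 2) = _ from q2 t,
        lie_add, lie_smul, lie_smul, ← lie_skew, hT.lie₁₀, ← lie_skew, hT.lie₂₀]
      module
  · refine ((hexp t).smul_const Y).congr_deriv ?_
    rw [map_smul, hbr]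
    module
  · have h1 := (hexp t).smul_const Y'
    have h2 : (fun t => Q 0 (Real.exp (a * t) • Y)) = fun t => Real.exp (a * t) • Y' := by
      ext1 t; rw [map_smul, hQy]
    rw [h2]
    refine h1.congr_deriv ?_
    rw [map_smul, hQy, map_smul, hbr']
    module
  · exact hS.exists_isometry hT (Q t) (Real.cos_sq_add_sin_sq _) (q1 t) (q2 t)

end IsCanonicalFrame

end LeftInvariantSR

end

/-! ### Three-dimensional Lie algebras -/

noncomputable section

open Set Filter Topology

section LieAlgebra

variable {L : Type*} [LieRing L] [LieAlgebra ℝ L] {L' : Type*} [LieRing L'] [LieAlgebra ℝ L']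

theorem trace_eq_sum_repr (b : Module.Basis (Fin 3) ℝ L) (f : L →ₗ[ℝ] L) :
    LinearMap.trace ℝ L f = b.repr (f (b 0)) 0 + b.repr (f (b 1)) 1 + b.repr (f (b 2)) 2 := by
  rw [LinearMap.trace_eq_matrix_trace ℝ b, Matrix.trace, Fin.sum_univ_three]
  simp [LinearMap.toMatrix_apply]

theorem killingForm_eq_sum_repr (b : Module.Basis (Fin 3) ℝ L) (x y : L) :
    killingForm ℝ L x y = b.repr ⁅x, ⁅y, b 0⁆⁆ 0 + b.repr ⁅x, ⁅y, b 1⁆⁆ 1 +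
      b.repr ⁅x, ⁅y, b 2⁆⁆ 2 := by
  rw [killingForm_apply_apply, trace_eq_sum_repr b]
  rfl

variable (L) in
/-- The trace of the adjoint representation, which vanishes for unimodular groups. -/
def adTrace : L →ₗ[ℝ] ℝ := LinearMap.trace ℝ L ∘ₗ (LieAlgebra.ad ℝ L : L →ₗ[ℝ] Module.End ℝ L)

theorem adTrace_eq_sum_repr (b : Module.Basis (Fin 3) ℝ L) (x : L) :
    adTrace L x = b.repr ⁅x, b 0⁆ 0 + b.repr ⁅x, b 1⁆ 1 + b.repr ⁅x, b 2⁆ 2 := by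
  rw [← LieAlgebra.ad_apply ℝ, ← LieAlgebra.ad_apply ℝ, ← LieAlgebra.ad_apply ℝ,
    ← trace_eq_sum_repr b]
  rfl

variable (L) in
/-- The simple algebras, and those of the Euclidean and hyperbolic motions, in the form in which
they come from a canonical frame with `a₁ = a₂ = 0`, where `α = χ + w` and `β = χ - w`. -/
def IsDiagAlg (α β : ℝ) : Prop :=
  ∃ b : Module.Basis (Fin 3) ℝ L, ⁅b 1, b 0⁆ = α • b 2 ∧ ⁅b 2, b 0⁆ = β • b 1 ∧ ⁅b 2, b 1⁆ = b 0

/-- An algebra in diagonal form has traceless adjoint representation, and a diagonal Killing form. -/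
theorem IsDiagAlg.forms {α β : ℝ} {b : Module.Basis (Fin 3) ℝ L} (h₁₀ : ⁅b 1, b 0⁆ = α • b 2)
    (h₂₀ : ⁅b 2, b 0⁆ = β • b 1) (h₂₁ : ⁅b 2, b 1⁆ = b 0) :
    adTrace L = 0 ∧ ∀ x y, killingForm ℝ L x y = 2 * α * β * (b.repr x 0 * b.repr y 0) -
      2 * α * (b.repr x 1 * b.repr y 1) + 2 * β * (b.repr x 2 * b.repr y 2) := by
  have h₀₁ : ⁅b 0, b 1⁆ = -(α • b 2) := by rw [← lie_skew, h₁₀]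
  have h₀₂ : ⁅b 0, b 2⁆ = -(β • b 1) := by rw [← lie_skew, h₂₀]
  have h₁₂ : ⁅b 1, b 2⁆ = -b 0 := by rw [← lie_skew, h₂₁]
  constructor
  · refine b.ext fun i => ?_
    rw [adTrace_eq_sum_repr b]
    fin_cases i <;> simp [h₁₀, h₂₀, h₂₁, h₀₁, h₀₂, h₁₂]
  · have : killingForm ℝ L = (2 * α * β) • (b.coord 0).smulRight (b.coord 0) -
        (2 * α) • (b.coord 1).smulRight (b.coord 1) +
        (2 * β) • (b.coord 2).smulRight (b.coord 2) := by
      refine b.ext fun i => b.ext fun j => ?_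
      rw [killingForm_eq_sum_repr b]
      fin_cases i <;> fin_cases j <;> simp [h₁₀, h₂₀, h₂₁, h₀₁, h₀₂, h₁₂] <;> ring
    intro x y
    rw [this]
    simp

/-- The trace of the adjoint representation and the Killing form factor through the quotient by the
abelian ideal, with coefficients `tr A` and `tr A ^ 2 - 2 det A = tr (A ^ 2)`. -/
theorem IsSolvAlg.forms {t d : ℝ} (h : IsSolvAlg L t d) : ∃ l : L →ₗ[ℝ] ℝ, (∃ x, l x = 1) ∧
    (∃ x, x ≠ 0 ∧ l x = 0) ∧ (∀ x, adTrace L x = t * l x) ∧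
    ∀ x y, killingForm ℝ L x y = (t ^ 2 - 2 * d) * (l x * l y) := by
  obtain ⟨b, h₀₁, h₀₂, h₁₂⟩ := h
  have h₁₀ : ⁅b 1, b 0⁆ = -b 2 := by rw [← lie_skew, h₀₁]
  have h₂₀ : ⁅b 2, b 0⁆ = -(-d • b 1 + t • b 2) := by rw [← lie_skew, h₀₂]
  have h₂₁ : ⁅b 2, b 1⁆ = 0 := by rw [← lie_skew, h₁₂, neg_zero]
  refine ⟨b.coord 0, ⟨b 0, by simp⟩, ⟨b 1, b.ne_zero 1, by simp⟩, ?_, ?_⟩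
  · have : adTrace L = t • b.coord 0 := by
      refine b.ext fun i => ?_
      rw [adTrace_eq_sum_repr b]
      fin_cases i <;> simp [h₁₀, h₂₀, h₂₁, h₀₁, h₀₂, h₁₂]
    intro x
    rw [this]
    simp
  · have : killingForm ℝ L = (t ^ 2 - 2 * d) • (b.coord 0).smulRight (b.coord 0) := by
      refine b.ext fun i => b.ext fun j => ?_
      rw [killingForm_eq_sum_repr b]
      fin_cases i <;> fin_cases j <;> simp [h₁₀, h₂₀, h₂₁, h₀₁, h₀₂, h₁₂]
      ring
    intro x y
    rw [this]
    simp

/-- The Killing form is degenerate in the solvable case, and nondegenerate for `α, β ≠ 0`. -/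
theorem IsSolvAlg.not_isDiagAlg {t d α β : ℝ} (h : IsSolvAlg L t d) (hα : α ≠ 0) (hβ : β ≠ 0) :
    ¬IsDiagAlg L α β := by
  rintro ⟨b, h₁₀, h₂₀, h₂₁⟩
  obtain ⟨l, -, ⟨x, hx, hlx⟩, -, hK⟩ := h.forms
  have hK' := (IsDiagAlg.forms h₁₀ h₂₀ h₂₁).2 x
  simp only [hK, hlx, zero_mul, mul_zero] at hK'
  apply hx
  have e0 : b.repr x 0 = 0 := by simpa [hα, hβ] using hK' (b 0)
  have e1 : b.repr x 1 = 0 := by simpa [hα, hβ] using hK' (b 1)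
  have e2 : b.repr x 2 = 0 := by simpa [hα, hβ] using hK' (b 2)
  rw [← b.sum_repr x, Fin.sum_univ_three, e0, e1, e2]
  simp

/-- The trace and the determinant of the operator are determined up to scaling the generator. -/
theorem IsSolvAlg.unique {t d t' d' : ℝ} (h : IsSolvAlg L t d) (h' : IsSolvAlg L t' d') :
    ∃ r : ℝ, r ≠ 0 ∧ t' = r * t ∧ d' = r ^ 2 * d := by
  obtain ⟨l, ⟨x, hx⟩, -, hτ, hK⟩ := h.forms
  obtain ⟨l', ⟨x', hx'⟩, -, hτ', hK'⟩ := h'.forms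
  have e1 := (hτ x').symm.trans (hτ' x')
  have e2 := (hτ x).symm.trans (hτ' x)
  have e3 := (hK x' x').symm.trans (hK' x' x')
  have e4 := (hK x x).symm.trans (hK' x x)
  rw [hx'] at e1 e3
  rw [hx] at e2 e4
  rcases eq_or_ne (l x') 0 with h0 | h0
  · rw [h0] at e1 e3
    have ht' : t' = 0 := by linarith
    have ht : t = 0 := by rw [ht'] at e2; linarith
    have hd' : d' = 0 := by rw [ht'] at e3; linarith
    have hd : d = 0 := by rw [ht, ht', hd'] at e4; linarith
    exact ⟨1, one_ne_zero, by rw [ht, ht', mul_zero], by rw [hd, hd', mul_zero]⟩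
  · refine ⟨l x', h0, by linarith, ?_⟩
    have : t' = l x' * t := by linarith
    rw [this] at e3
    linarith

theorem IsSolvAlg.scale {t d : ℝ} (h : IsSolvAlg L t d) {r : ℝ} (hr : r ≠ 0) :
    IsSolvAlg L (r * t) (r ^ 2 * d) := by
  obtain ⟨b, h₀₁, h₀₂, h₁₂⟩ := h
  refine ⟨b.unitsSMul ![Units.mk0 r hr, 1, Units.mk0 r hr], ?_, ?_, ?_⟩
  · simp [Module.Basis.unitsSMul_apply, h₀₁, Units.smul_def]
  · simp [Module.Basis.unitsSMul_apply, h₀₂, Units.smul_def]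
    module
  · simp [Module.Basis.unitsSMul_apply, h₁₂, Units.smul_def]

theorem IsDiagAlg.scale {α β : ℝ} (h : IsDiagAlg L α β) {r s : ℝ} (hr : r ≠ 0) (hs : s ≠ 0) :
    IsDiagAlg L (r ^ 2 * α) (s ^ 2 * β) := by
  obtain ⟨b, h₁₀, h₂₀, h₂₁⟩ := h
  refine ⟨b.unitsSMul ![Units.mk0 r hr * Units.mk0 s hs, Units.mk0 r hr, Units.mk0 s hs], ?_, ?_, ?_⟩
  · simp [Module.Basis.unitsSMul_apply, h₁₀, Units.smul_def]
    module
  · simp [Module.Basis.unitsSMul_apply, h₂₀, Units.smul_def]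
    module
  · simp [Module.Basis.unitsSMul_apply, h₂₁, Units.smul_def]
    module

theorem exists_basis_of_linearIndependent (b : Module.Basis (Fin 3) ℝ L) {v : Fin 3 → L}
    (h : LinearIndependent ℝ v) : ∃ b' : Module.Basis (Fin 3) ℝ L, ∀ i, b' i = v i :=
  ⟨basisOfLinearIndependentOfCardEqFinrank h (Module.finrank_eq_card_basis b).symm, by simp⟩

/-- A cyclic permutation of the basis, up to signs, exchanges the two diagonal forms of `sl(2)`. -/
theorem IsDiagAlg.cyclic (h : IsDiagAlg L (-1) 1) : IsDiagAlg L 1 1 := by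
  obtain ⟨b, h₁₀, h₂₀, h₂₁⟩ := h
  have hli : LinearIndependent ℝ ![-b 2, b 0, b 1] := by
    rw [Fintype.linearIndependent_iff]
    intro g hg
    rw [Fin.sum_univ_three] at hg
    have e0 := congrArg (fun v => b.repr v 0) hg
    have e1 := congrArg (fun v => b.repr v 1) hg
    have e2 := congrArg (fun v => b.repr v 2) hg
    simp at e0 e1 e2
    intro i
    fin_cases i
    exacts [e2, e0, e1]
  obtain ⟨b', hb'⟩ := exists_basis_of_linearIndependent b hli
  refine ⟨b', ?_, ?_, ?_⟩
  · simp [hb', ← lie_skew (b 0) (b 2), h₂₀]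
  · simp [hb', ← lie_skew (b 1) (b 2), h₂₁]
  · simp [hb', h₁₀]

theorem isSE2Alg_iff : IsSE2Alg L ↔ IsSolvAlg L 0 1 := by simp [IsSE2Alg, IsSolvAlg]

theorem isSH2Alg_iff : IsSH2Alg L ↔ IsSolvAlg L 0 (-1) := by simp [IsSH2Alg, IsSolvAlg]

theorem isHeisenbergAlg_iff : IsHeisenbergAlg L ↔ IsSolvAlg L 0 0 := by
  simp [IsHeisenbergAlg, IsSolvAlg]

theorem IsAffAlg.isSolvAlg (h : IsAffAlg L) : IsSolvAlg L (-1) 0 := by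
  obtain ⟨b, h₀₁, h₀₂, h₁₂⟩ := h
  have h₁₀ : ⁅b 1, b 0⁆ = -b 0 := by rw [← lie_skew, h₀₁]
  have hli : LinearIndependent ℝ ![b 1, b 0 + b 2, -b 0] := by
    rw [Fintype.linearIndependent_iff]
    intro g hg
    rw [Fin.sum_univ_three] at hg
    have e0 := congrArg (fun v => b.repr v 0) hg
    have e1 := congrArg (fun v => b.repr v 1) hg
    have e2 := congrArg (fun v => b.repr v 2) hg
    simp at e0 e1 e2
    intro i
    fin_cases i <;> simp <;> linarith
  obtain ⟨b', hb'⟩ := exists_basis_of_linearIndependent b hli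
  refine ⟨b', ?_, ?_, ?_⟩ <;> simp [hb', h₁₀, h₁₂, h₀₂, ← lie_skew (b 2) (b 0)]

theorem IsSolvAlg.isAffAlg {t : ℝ} (h : IsSolvAlg L t 0) (ht : t ≠ 0) : IsAffAlg L := by
  obtain ⟨b, h₀₁, h₀₂, h₁₂⟩ := h
  have h₁₀ : ⁅b 1, b 0⁆ = -b 2 := by rw [← lie_skew, h₀₁]
  have h₂₀ : ⁅b 2, b 0⁆ = -(t • b 2) := by rw [← lie_skew, h₀₂]; simp
  have hli : LinearIndependent ℝ ![b 2, -t⁻¹ • b 0, b 2 - t • b 1] := by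
    rw [Fintype.linearIndependent_iff]
    intro g hg
    rw [Fin.sum_univ_three] at hg
    have e0 := congrArg (fun v => b.repr v 0) hg
    have e1 := congrArg (fun v => b.repr v 1) hg
    have e2 := congrArg (fun v => b.repr v 2) hg
    simp [ht] at e0 e1 e2
    intro i
    fin_cases i <;> simp [e0, e1]
    simpa [e1] using e2
  obtain ⟨b', hb'⟩ := exists_basis_of_linearIndependent b hli
  refine ⟨b', ?_, ?_, ?_⟩
  · simp [hb', h₂₀, smul_smul, ht]
  · simp [hb', ← lie_skew (b 2) (b 1), h₁₂]
  · simp [hb', h₀₁, h₀₂, smul_smul, ht]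

theorem isAffAlg_iff : IsAffAlg L ↔ ∃ t : ℝ, t ≠ 0 ∧ IsSolvAlg L t 0 :=
  ⟨fun h => ⟨-1, by norm_num, h.isSolvAlg⟩, fun ⟨_, ht, h⟩ => h.isAffAlg ht⟩

theorem IsSolvAlg.map {t d : ℝ} (h : IsSolvAlg L t d) (e : L ≃ₗ⁅ℝ⁆ L') : IsSolvAlg L' t d := by
  obtain ⟨b, h₀₁, h₀₂, h₁₂⟩ := h
  refine ⟨b.map e.toLinearEquiv, ?_, ?_, ?_⟩
  · exact (e.map_lie _ _).symm.trans (congrArg e h₀₁)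
  · exact (e.map_lie _ _).symm.trans ((congrArg e h₀₂).trans (by simp))
  · exact (e.map_lie _ _).symm.trans ((congrArg e h₁₂).trans (by simp))

theorem IsDiagAlg.map {α β : ℝ} (h : IsDiagAlg L α β) (e : L ≃ₗ⁅ℝ⁆ L') : IsDiagAlg L' α β := by
  obtain ⟨b, h₀₁, h₀₂, h₁₂⟩ := h
  refine ⟨b.map e.toLinearEquiv, ?_, ?_, ?_⟩
  · exact (e.map_lie _ _).symm.trans ((congrArg e h₀₁).trans (by simp))
  · exact (e.map_lie _ _).symm.trans ((congrArg e h₀₂).trans (by simp))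
  · exact (e.map_lie _ _).symm.trans (congrArg e h₁₂)

theorem IsDiagAlg.nonempty_lieEquiv {α β : ℝ} (h : IsDiagAlg L α β) (h' : IsDiagAlg L' α β) :
    Nonempty (L ≃ₗ⁅ℝ⁆ L') := by
  obtain ⟨b, h₁₀, h₂₀, h₂₁⟩ := h
  obtain ⟨b', h₁₀', h₂₀', h₂₁'⟩ := h'
  obtain ⟨e, -⟩ := b.exists_lieEquiv b' (by rw [h₁₀, h₁₀']; simp) (by rw [h₂₀, h₂₀']; simp)
    (by rw [h₂₁, h₂₁']; simp)
  exact ⟨e⟩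

open Matrix

attribute [local instance 100] LieRing.ofAssociativeRing

theorem isDiagAlg_sl : IsDiagAlg (LieAlgebra.SpecialLinear.sl (Fin 2) ℝ) 1 1 := by
  have hmem : ∀ x y z : ℝ, (!![x, y; z, -x] : Matrix (Fin 2) (Fin 2) ℝ) ∈
      LieAlgebra.SpecialLinear.sl (Fin 2) ℝ := fun x y z => by
    rw [LieAlgebra.SpecialLinear.sl, LieSubalgebra.mem_mk_iff']
    simp [Matrix.trace_fin_two]
  have htr : ∀ A : LieAlgebra.SpecialLinear.sl (Fin 2) ℝ, A.1 1 1 = -A.1 0 0 := fun A => by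
    have h : Matrix.trace A.1 = 0 := A.2
    rw [Matrix.trace_fin_two] at h
    linarith
  let e : LieAlgebra.SpecialLinear.sl (Fin 2) ℝ ≃ₗ[ℝ] (Fin 3 → ℝ) :=
    { toFun := fun A => ![A.1 0 1 + A.1 1 0, A.1 0 1 - A.1 1 0, 2 * A.1 0 0]
      invFun := fun x => ⟨_, hmem (x 2 / 2) ((x 0 + x 1) / 2) ((x 0 - x 1) / 2)⟩
      map_add' := fun A B => by ext i; fin_cases i <;> simp <;> ring
      map_smul' := fun c A => by ext i; fin_cases i <;> simp <;> ring
      left_inv := fun A => by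
        ext i j; fin_cases i <;> fin_cases j <;> simp [htr]
      right_inv := fun x => by ext i; fin_cases i <;> simp <;> ring }
  have hb : ∀ i, (Module.Basis.ofEquivFun e i : Matrix (Fin 2) (Fin 2) ℝ) =
      !![(Pi.single i 1 : Fin 3 → ℝ) 2 / 2, ((Pi.single i 1 : Fin 3 → ℝ) 0 + (Pi.single i 1 : Fin 3 → ℝ) 1) / 2;
        ((Pi.single i 1 : Fin 3 → ℝ) 0 - (Pi.single i 1 : Fin 3 → ℝ) 1) / 2, -((Pi.single i 1 : Fin 3 → ℝ) 2 / 2)] :=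
    fun i => by rw [Module.Basis.coe_ofEquivFun]; rfl
  have hsm : ∀ (c : ℝ) (A : LieAlgebra.SpecialLinear.sl (Fin 2) ℝ),
      ((c • A : LieAlgebra.SpecialLinear.sl (Fin 2) ℝ) : Matrix (Fin 2) (Fin 2) ℝ) = c • A.1 :=
    fun _ _ => rfl
  refine ⟨Module.Basis.ofEquivFun e, ?_, ?_, ?_⟩ <;>
  · apply Subtype.ext
    simp only [LieSubalgebra.coe_bracket, hsm, hb, Ring.lie_def]
    ext i j
    fin_cases i <;> fin_cases j <;> simp <;> norm_num

theorem isDiagAlg_su2 : IsDiagAlg su2 1 (-1) := by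
  have hmem : ∀ x y z : ℝ, (!![⟨0, x⟩, ⟨y, z⟩; ⟨-y, z⟩, ⟨0, -x⟩] : Matrix (Fin 2) (Fin 2) ℂ) ∈
      su2 := fun x y z => by
    refine ⟨?_, ?_⟩
    · ext i j
      fin_cases i <;> fin_cases j <;> simp [Complex.ext_iff]
    · simp [Matrix.trace_fin_two, Complex.ext_iff]
  have hs : ∀ (A : su2) (i j : Fin 2), (A.1 j i).re = -(A.1 i j).re ∧ (A.1 j i).im = (A.1 i j).im :=
    fun A i j => by
      have h := congrFun (congrFun A.2.1 i) j
      simpa [Complex.ext_iff] using h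
  have h11 : ∀ A : su2, A.1 1 1 = -A.1 0 0 := fun A => by
    have h := A.2.2
    rw [Matrix.trace_fin_two] at h
    linear_combination h
  have h00 : ∀ A : su2, (A.1 0 0).re = 0 := fun A => by linarith [(hs A 0 0).1]
  let e : su2 ≃ₗ[ℝ] (Fin 3 → ℝ) :=
    { toFun := fun A => ![2 * (A.1 0 1).im, 2 * (A.1 0 1).re, 2 * (A.1 0 0).im]
      invFun := fun x => ⟨_, hmem (x 2 / 2) (x 1 / 2) (x 0 / 2)⟩
      map_add' := fun A B => by ext i; fin_cases i <;> simp <;> ring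
      map_smul' := fun c A => by ext i; fin_cases i <;> simp <;> ring
      left_inv := fun A => by
        ext i j
        fin_cases i <;> fin_cases j <;>
          simp [Complex.ext_iff, h11, h00, (hs A 0 1).1, (hs A 0 1).2]
      right_inv := fun x => by ext i; fin_cases i <;> simp <;> ring }
  have hb : ∀ i, (Module.Basis.ofEquivFun e i : Matrix (Fin 2) (Fin 2) ℂ) =
      !![⟨0, (Pi.single i 1 : Fin 3 → ℝ) 2 / 2⟩, ⟨(Pi.single i 1 : Fin 3 → ℝ) 1 / 2, (Pi.single i 1 : Fin 3 → ℝ) 0 / 2⟩;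
        ⟨-((Pi.single i 1 : Fin 3 → ℝ) 1 / 2), (Pi.single i 1 : Fin 3 → ℝ) 0 / 2⟩,
        ⟨0, -((Pi.single i 1 : Fin 3 → ℝ) 2 / 2)⟩] :=
    fun i => by rw [Module.Basis.coe_ofEquivFun]; rfl
  have hsm : ∀ (c : ℝ) (A : su2), ((c • A : su2) : Matrix (Fin 2) (Fin 2) ℂ) = c • A.1 :=
    fun _ _ => rfl
  refine ⟨Module.Basis.ofEquivFun e, ?_, ?_, ?_⟩ <;>
  · apply Subtype.ext
    simp only [LieSubalgebra.coe_bracket, hsm, hb, Ring.lie_def]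
    ext i j
    fin_cases i <;> fin_cases j <;>
      simp [Complex.ext_iff] <;> norm_num

theorem isSL2Alg_iff : IsSL2Alg L ↔ IsDiagAlg L 1 1 :=
  ⟨fun ⟨e⟩ => isDiagAlg_sl.map e.symm, fun h => h.nonempty_lieEquiv isDiagAlg_sl⟩

theorem nonempty_lieEquiv_su2_iff : Nonempty (L ≃ₗ⁅ℝ⁆ su2) ↔ IsDiagAlg L 1 (-1) :=
  ⟨fun ⟨e⟩ => isDiagAlg_su2.map e.symm, fun h => h.nonempty_lieEquiv isDiagAlg_su2⟩

/-- The Killing form of `su(2)` is negative definite, that of `sl(2)` is not. -/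
theorem IsDiagAlg.not_isDiagAlg_neg (h : IsDiagAlg L 1 1) : ¬IsDiagAlg L 1 (-1) := by
  rintro ⟨b', h₁₀', h₂₀', h₂₁'⟩
  obtain ⟨b, h₁₀, h₂₀, h₂₁⟩ := h
  have h1 := (IsDiagAlg.forms h₁₀ h₂₀ h₂₁).2 (b 2) (b 2)
  rw [(IsDiagAlg.forms h₁₀' h₂₀' h₂₁').2] at h1
  simp at h1
  nlinarith [mul_self_nonneg (b'.repr (b 2) 0), mul_self_nonneg (b'.repr (b 2) 1),
    mul_self_nonneg (b'.repr (b 2) 2)]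

end LieAlgebra

end

/-! ### Labels and arcs -/

noncomputable section

open Set Filter Topology

/-- The label of the semidirect product of `ℝ` with `ℝ²` by a nonscalar operator of trace `t` and
determinant `d`. -/
def solvLabel (t d : ℝ) : Label :=
  if t = 0 then if d = 0 then .H3 else if 0 < d then .SE2 else .SH2
  else if d = 0 then .AffR else if 0 < d then .SolvPlus else .SolvMinus

theorem solvLabel_scale (t d : ℝ) {r : ℝ} (hr : r ≠ 0) :
    solvLabel (r * t) (r ^ 2 * d) = solvLabel t d := by
  have : 0 < r ^ 2 := by positivity
  simp [solvLabel, hr, mul_pos_iff_of_pos_left this]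

theorem solvLabel_of_pos {t d : ℝ} (ht : t ≠ 0) (hd : 0 < d) : (solvLabel t d) = .SolvPlus := by
  simp [solvLabel, ht, hd, hd.ne']

theorem solvLabel_of_neg {t d : ℝ} (ht : t ≠ 0) (hd : d < 0) : (solvLabel t d) = .SolvMinus := by
  simp [solvLabel, ht, hd.not_gt, hd.ne]

namespace LeftInvariantSR

open LieGroup3

variable {G : LieGroup3.{u}} {H : LieGroup3.{v}} {S : LeftInvariantSR G} {T : LeftInvariantSR H}

theorem hasLabel_solvLabel {t d : ℝ} (h : IsSolvAlg G.Lie t d) : S.HasLabel (solvLabel t d) := by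
  -- the determinant is normalized to `1` or `-1` by scaling the generator
  have norm : d ≠ 0 → IsSolvAlg G.Lie ((√|d|)⁻¹ * t) (|d|⁻¹ * d) := fun hd => by
    have hd' : 0 < |d| := abs_pos.2 hd
    have := h.scale (r := (√|d|)⁻¹) (by positivity)
    rwa [inv_pow, Real.sq_sqrt hd'.le] at this
  have hr : d ≠ 0 → (√|d|)⁻¹ ≠ 0 := fun hd => by
    have : 0 < |d| := abs_pos.2 hd
    positivity
  unfold solvLabel
  split_ifs with ht hd hp hd hp
  · subst ht hd
    exact isHeisenbergAlg_iff.2 h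
  · have := norm hd
    rw [abs_of_pos hp, inv_mul_cancel₀ hd, ht, mul_zero] at this
    exact isSE2Alg_iff.2 this
  · have := norm hd
    have hn : d < 0 := lt_of_le_of_ne (not_lt.1 hp) hd
    rw [abs_of_neg hn, inv_neg, neg_mul, inv_mul_cancel₀ hd, ht, mul_zero] at this
    exact isSH2Alg_iff.2 this
  · subst hd
    exact h.isAffAlg ht
  · have := norm hd
    have h2 := mul_ne_zero (hr hd) ht
    rw [abs_of_pos hp] at this h2
    rw [inv_mul_cancel₀ hd] at this
    exact ⟨_, h2, this⟩
  · have := norm hd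
    have h2 := mul_ne_zero (hr hd) ht
    have hn : d < 0 := lt_of_le_of_ne (not_lt.1 hp) hd
    rw [abs_of_neg hn] at this h2
    rw [inv_neg, neg_mul, inv_mul_cancel₀ hd] at this
    exact ⟨_, h2, this⟩

/-- The Lie algebra behind a label is solvable, `sl(2)` or `su(2)`. -/
theorem HasLabel.cases {l : Label} (h : S.HasLabel l) :
    (∃ t d, IsSolvAlg G.Lie t d ∧ l = solvLabel t d) ∨
    (IsDiagAlg G.Lie 1 1 ∧ (l = .SLe2 ∧ S.IsElliptic ∨ l = .SLh2 ∧ S.IsHyperbolic)) ∨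
    (IsDiagAlg G.Lie 1 (-1) ∧ l = .SU2) := by
  cases l with
  | H3 => exact .inl ⟨0, 0, isHeisenbergAlg_iff.1 h, by simp [solvLabel]⟩
  | AffR => exact .inl ⟨-1, 0, IsAffAlg.isSolvAlg h, by simp [solvLabel]⟩
  | SolvPlus =>
    obtain ⟨t, ht, h⟩ := h
    exact .inl ⟨t, 1, h, by simp [solvLabel, ht]⟩
  | SolvMinus =>
    obtain ⟨t, ht, h⟩ := h
    exact .inl ⟨t, -1, h, by simp [solvLabel, ht]⟩
  | SE2 => exact .inl ⟨0, 1, isSE2Alg_iff.1 h, by simp [solvLabel]⟩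
  | SH2 => exact .inl ⟨0, -1, isSH2Alg_iff.1 h, by simp [solvLabel]⟩
  | SLe2 => exact .inr (.inl ⟨isSL2Alg_iff.1 h.1, .inl ⟨rfl, h.2⟩⟩)
  | SLh2 => exact .inr (.inl ⟨isSL2Alg_iff.1 h.1, .inr ⟨rfl, h.2⟩⟩)
  | SU2 => exact .inr (.inr ⟨nonempty_lieEquiv_su2_iff.1 h, rfl⟩)

theorem IsElliptic.not_isHyperbolic (h : S.IsElliptic) : ¬S.IsHyperbolic := by
  rintro ⟨⟨v, hv, hKv⟩, w, hw, hKw⟩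
  have hv0 : v ≠ 0 := by rintro rfl; simp at hKv
  have hw0 : w ≠ 0 := by rintro rfl; simp at hKw
  rcases h with h | h
  · exact (h w hw hw0).not_gt hKw
  · exact (h v hv hv0).not_gt hKv

theorem _root_.IsSolvAlg.solvLabel_eq {L : Type*} [LieRing L] [LieAlgebra ℝ L] {t d t' d' : ℝ}
    (h : IsSolvAlg L t d) (h' : IsSolvAlg L t' d') : solvLabel t d = solvLabel t' d' := by
  obtain ⟨r, hr, rfl, rfl⟩ := h.unique h'
  exact (solvLabel_scale t d hr).symm

theorem HasLabel.unique {l l' : Label} (h : S.HasLabel l) (h' : S.HasLabel l') : l = l' := by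
  rcases h.cases with ⟨t, d, hs, rfl⟩ | ⟨hd, hl⟩ | ⟨hd, rfl⟩ <;>
    rcases h'.cases with ⟨t', d', hs', rfl⟩ | ⟨hd', hl'⟩ | ⟨hd', rfl⟩
  · exact IsSolvAlg.solvLabel_eq hs hs'
  · exact absurd hd' (hs.not_isDiagAlg one_ne_zero one_ne_zero)
  · exact absurd hd' (hs.not_isDiagAlg one_ne_zero (by norm_num))
  · exact absurd hd (hs'.not_isDiagAlg one_ne_zero one_ne_zero)
  · rcases hl with ⟨rfl, he⟩ | ⟨rfl, he⟩ <;> rcases hl' with ⟨rfl, he'⟩ | ⟨rfl, he'⟩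
    · rfl
    · exact absurd he' he.not_isHyperbolic
    · exact absurd he he'.not_isHyperbolic
    · rfl
  · exact absurd hd' hd.not_isDiagAlg_neg
  · exact absurd hd (hs'.not_isDiagAlg one_ne_zero (by norm_num))
  · exact absurd hd hd'.not_isDiagAlg_neg
  · rfl

/-- The arc depends only on the Lie algebra. -/
theorem HasLabel.arc_eq_of_lieEquiv {l l' : Label} (h : S.HasLabel l) (h' : T.HasLabel l')
    (e : G.Lie ≃ₗ⁅ℝ⁆ H.Lie) : l.arc = l'.arc := by
  rcases h.cases with ⟨t, d, hs, rfl⟩ | ⟨hd, hl⟩ | ⟨hd, rfl⟩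
  · rw [(hasLabel_solvLabel (S := T) (hs.map e)).unique h']
  · have hm : l.arc = .middle := by rcases hl with ⟨rfl, -⟩ | ⟨rfl, -⟩ <;> rfl
    rcases h'.cases with ⟨t', d', hs', rfl⟩ | ⟨hd', ⟨rfl, -⟩ | ⟨rfl, -⟩⟩ | ⟨hd', rfl⟩
    · exact absurd (hd.map e) (hs'.not_isDiagAlg one_ne_zero one_ne_zero)
    all_goals exact hm
  · rcases h'.cases with ⟨t', d', hs', rfl⟩ | ⟨hd', ⟨rfl, -⟩ | ⟨rfl, -⟩⟩ | ⟨hd', rfl⟩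
    · exact absurd (hd.map e) (hs'.not_isDiagAlg one_ne_zero (by norm_num))
    all_goals rfl

namespace IsCanonicalFrame

variable {b : Module.Basis (Fin 3) ℝ G.Lie} {χ w a₁ a₂ : ℝ}

/-- The plane of `b 2` and `⁅b 1, b 2⁆` is an abelian ideal, on which `ad (b 1)` is in companion form
for the cyclic vector `b 2`. -/
theorem isSolvAlg_plus {a : ℝ} (h : S.IsCanonicalFrame b χ χ 0 a) :
    IsSolvAlg G.Lie (-a) (2 * χ) := by
  have hli : LinearIndependent ℝ ![b 1, b 2, -(a • b 2 + b 0)] := by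
    rw [Fintype.linearIndependent_iff]
    intro g hg
    rw [Fin.sum_univ_three] at hg
    have e0 := congrArg (fun v => b.repr v 0) hg
    have e1 := congrArg (fun v => b.repr v 1) hg
    have e2 := congrArg (fun v => b.repr v 2) hg
    simp at e0 e1 e2
    rw [e0] at e2
    intro i
    fin_cases i
    exacts [e1, by simpa using e2, e0]
  obtain ⟨b', hb'⟩ := exists_basis_of_linearIndependent b hli
  have h₂₁ := h.lie₂₁
  have h₁₂ : ⁅b 1, b 2⁆ = -(a • b 2 + b 0) := by rw [← lie_skew, h₂₁]; simp
  have h₁₀ := h.lie₁₀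
  have h₂₀ := h.lie₂₀
  refine ⟨b', ?_, ?_, ?_⟩
  · simp [hb', h₁₂]
  · simp [hb', h₁₂, h₁₀]
    module
  · simp [hb', h₂₀]

/-- The plane of `b 1` and `⁅b 2, b 1⁆` is an abelian ideal, on which `ad (b 2)` is in companion form
for the cyclic vector `b 1`. -/
theorem isSolvAlg_minus {a : ℝ} (h : S.IsCanonicalFrame b χ (-χ) a 0) :
    IsSolvAlg G.Lie a (-(2 * χ)) := by
  have hli : LinearIndependent ℝ ![b 2, b 1, a • b 1 + b 0] := by
    rw [Fintype.linearIndependent_iff]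
    intro g hg
    rw [Fin.sum_univ_three] at hg
    have e0 := congrArg (fun v => b.repr v 0) hg
    have e1 := congrArg (fun v => b.repr v 1) hg
    have e2 := congrArg (fun v => b.repr v 2) hg
    simp at e0 e1 e2
    rw [e0] at e1
    intro i
    fin_cases i
    exacts [e2, by simpa using e1, e0]
  obtain ⟨b', hb'⟩ := exists_basis_of_linearIndependent b hli
  have h₂₁ := h.lie₂₁
  have h₁₀ := h.lie₁₀
  have h₂₀ := h.lie₂₀
  refine ⟨b', ?_, ?_, ?_⟩
  · simp [hb', h₂₁]
  · simp [hb', h₂₁, h₂₀]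
    module
  · simp [hb', h₁₀]

theorem isDiagAlg (h : S.IsCanonicalFrame b χ w 0 0) : IsDiagAlg G.Lie (χ + w) (χ - w) :=
  ⟨b, h.lie₁₀, h.lie₂₀, by simp [h.lie₂₁]⟩

theorem killingForm_eq (h : S.IsCanonicalFrame b χ w 0 0) (x y : ℝ) :
    killingForm ℝ G.Lie (x • b 1 + y • b 2) (x • b 1 + y • b 2) =
      2 * (χ - w) * y ^ 2 - 2 * (χ + w) * x ^ 2 := by
  rw [(IsDiagAlg.forms h.lie₁₀ h.lie₂₀ (by simp [h.lie₂₁])).2]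
  simp
  ring

/-- The label of a unimodular structure is read off from the signs of `χ + w` and `χ - w`. -/
theorem exists_hasLabel (h : S.IsCanonicalFrame b χ w 0 0) (hχ : 0 ≤ χ) :
    ∃ l : Label, S.HasLabel l ∧ l.OccursAt w χ ∧ l.arc = .middle := by
  have hsq : ∀ x : ℝ, 0 < x → ((√x)⁻¹) ^ 2 * x = 1 := fun x hx => by
    rw [inv_pow, Real.sq_sqrt hx.le, inv_mul_cancel₀ hx.ne']
  have hne : ∀ x : ℝ, 0 < x → (√x)⁻¹ ≠ 0 := fun x hx => by positivity
  have hd := h.isDiagAlg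
  rcases lt_trichotomy w χ with h1 | h1 | h1
  · rcases lt_trichotomy w (-χ) with h2 | h2 | h2
    · have hα : 0 < -(χ + w) := by linarith
      have hβ : 0 < χ - w := by linarith
      have := hd.scale (hne _ hα) (hne _ hβ)
      have e : ((√(-(χ + w)))⁻¹) ^ 2 * (χ + w) = -1 := by linarith [hsq _ hα]
      rw [e, hsq _ hβ] at this
      refine ⟨.SLe2, ⟨isSL2Alg_iff.2 this.cyclic, .inl fun v hv hv0 => ?_⟩, ⟨hχ, h2⟩, rfl⟩
      obtain ⟨x, y, hxy⟩ := h.exists_combination ⟨v, hv⟩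
      have hv' : v = x • b 1 + y • b 2 := congrArg Subtype.val hxy
      rw [hv', h.killingForm_eq]
      have hxy0 : x ≠ 0 ∨ y ≠ 0 := by
        by_contra! hc
        exact hv0 (by rw [hv', hc.1, hc.2]; simp)
      rcases hxy0 with hx | hy
      · have : 0 < x ^ 2 := by positivity
        nlinarith [sq_nonneg y]
      · have : 0 < y ^ 2 := by positivity
        nlinarith [sq_nonneg x]
    · subst h2
      have hχ' : 0 < χ := by linarith
      have := hasLabel_solvLabel (S := S) h.isSolvAlg_minus
      have e : solvLabel 0 (-(2 * χ)) = .SH2 := by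
        simp [solvLabel, hχ'.ne', hχ]
      rw [e] at this
      exact ⟨_, this, ⟨hχ', rfl⟩, rfl⟩
    · have hα : 0 < χ + w := by linarith
      have hβ : 0 < χ - w := by linarith
      have := hd.scale (hne _ hα) (hne _ hβ)
      rw [hsq _ hα, hsq _ hβ] at this
      refine ⟨.SLh2, ⟨isSL2Alg_iff.2 this, ⟨b 2, h.mem₂, ?_⟩, b 1, h.mem₁, ?_⟩,
        ⟨by linarith, h2, h1⟩, rfl⟩
      · have := h.killingForm_eq 0 1
        simp only [zero_smul, one_smul, zero_add] at this
        rw [this]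
        linarith
      · have := h.killingForm_eq 1 0
        simp only [zero_smul, one_smul, add_zero] at this
        rw [this]
        linarith
  · subst h1
    have := hasLabel_solvLabel (S := S) h.isSolvAlg_plus
    rw [neg_zero] at this
    rcases hχ.eq_or_lt with h0 | h0
    · have e : solvLabel 0 (2 * w) = .H3 := by simp [solvLabel, ← h0]
      rw [e] at this
      exact ⟨_, this, ⟨h0.symm, h0.symm⟩, rfl⟩
    · have e : solvLabel 0 (2 * w) = .SE2 := by simp [solvLabel, h0.ne', h0]
      rw [e] at this
      exact ⟨_, this, ⟨h0, rfl⟩, rfl⟩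
  · have hα : 0 < χ + w := by linarith
    have hβ : 0 < -(χ - w) := by linarith
    have := hd.scale (hne _ hα) (hne _ hβ)
    have e : ((√(-(χ - w)))⁻¹) ^ 2 * (χ - w) = -1 := by linarith [hsq _ hβ]
    rw [e, hsq _ hα] at this
    exact ⟨.SU2, nonempty_lieEquiv_su2_iff.2 this, ⟨hχ, h1⟩, rfl⟩

end IsCanonicalFrame

/-- The normal forms of canonical frames, arranged by the arc on which the structure lies. The
middle arc consists of the unimodular structures and of those on `A⁺(ℝ) ⊕ ℝ`. -/
def IsOnArc (S : LeftInvariantSR G) (κ χ : ℝ) : Arc → Prop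
  | .middle => (∃ b, S.IsCanonicalFrame b χ κ 0 0) ∨
      χ = 0 ∧ ∃ b a, a ≠ 0 ∧ κ = -a ^ 2 ∧ S.IsCanonicalFrame b 0 0 0 a
  | .plus => 0 < χ ∧ ∃ b a, a ≠ 0 ∧ κ = χ - a ^ 2 ∧ S.IsCanonicalFrame b χ χ 0 a
  | .minus => 0 < χ ∧ ∃ b a, a ≠ 0 ∧ κ = -χ - a ^ 2 ∧ S.IsCanonicalFrame b χ (-χ) a 0

variable {κ χ : ℝ}

theorem HasInvariants.nonneg (h : S.HasInvariants κ χ) : 0 ≤ χ := by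
  obtain ⟨b, w, a₁, a₂, hb, h0, -⟩ := h.exists_isCanonicalFrame
  exact h0

/-- By the Jacobi identity, `w = χ` if `a₂ ≠ 0`, and `w = -χ` if `a₁ ≠ 0`. -/
theorem HasInvariants.exists_isOnArc (h : S.HasInvariants κ χ) : ∃ arc, S.IsOnArc κ χ arc := by
  obtain ⟨b, w, a₁, a₂, hb, h0, hκ, hχ⟩ := h.exists_isCanonicalFrame
  obtain ⟨j1, j2⟩ := hb.jacobi
  rcases eq_or_ne a₁ 0 with rfl | h1
  · rcases eq_or_ne a₂ 0 with rfl | h2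
    · obtain rfl : κ = w := by rw [hκ]; ring
      exact ⟨.middle, .inl ⟨b, hb⟩⟩
    · obtain rfl : w = χ := by linarith [(mul_eq_zero.1 j2).resolve_left h2]
      rcases h0.eq_or_lt with rfl | h0
      · exact ⟨.middle, .inr ⟨rfl, b, a₂, h2, by rw [hκ]; ring, hb⟩⟩
      · exact ⟨.plus, h0, b, a₂, h2, by rw [hκ]; ring, hb⟩
  · have hχ0 : 0 < χ := lt_of_le_of_ne h0 fun h => h1 (hχ h.symm)
    obtain rfl : w = -χ := by linarith [(mul_eq_zero.1 j1).resolve_left h1]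
    obtain rfl : a₂ = 0 := (mul_eq_zero.1 j2).resolve_right (by linarith)
    exact ⟨.minus, hχ0, b, a₁, h1, by rw [hκ]; ring, hb⟩

theorem IsOnArc.exists_hasLabel {arc : Arc} (h : S.IsOnArc κ χ arc) (hχ : 0 ≤ χ) :
    ∃ l : Label, S.HasLabel l ∧ l.OccursAt κ χ ∧ l.arc = arc := by
  cases arc with
  | middle =>
    rcases h with ⟨b, hb⟩ | ⟨rfl, b, a, ha, rfl, hb⟩
    · exact hb.exists_hasLabel hχ
    · have := hasLabel_solvLabel (S := S) hb.isSolvAlg_plus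
      have e : solvLabel (-a) (2 * 0) = .AffR := by simp [solvLabel, ha]
      rw [e] at this
      exact ⟨_, this, ⟨neg_neg_of_pos (by positivity), rfl⟩, rfl⟩
  | plus =>
    obtain ⟨h0, b, a, ha, rfl, hb⟩ := h
    have := hasLabel_solvLabel (S := S) hb.isSolvAlg_plus
    rw [solvLabel_of_pos (neg_ne_zero.2 ha) (by positivity)] at this
    exact ⟨_, this, ⟨h0, by linarith [pow_pos (abs_pos.2 ha) 2, sq_abs a]⟩, rfl⟩
  | minus =>
    obtain ⟨h0, b, a, ha, rfl, hb⟩ := h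
    have := hasLabel_solvLabel (S := S) hb.isSolvAlg_minus
    rw [solvLabel_of_neg ha (by linarith)] at this
    exact ⟨_, this, ⟨h0, by linarith [pow_pos (abs_pos.2 ha) 2, sq_abs a]⟩, rfl⟩

theorem HasLabel.isOnArc {l : Label} (hl : S.HasLabel l) (h : S.HasInvariants κ χ) :
    S.IsOnArc κ χ l.arc := by
  obtain ⟨arc, harc⟩ := h.exists_isOnArc
  obtain ⟨l', hl', -, rfl⟩ := harc.exists_hasLabel h.nonneg
  rwa [hl.unique hl']

theorem IsOnArc.locallyIsometric {arc : Arc} (h : S.IsOnArc κ χ arc) (h' : T.IsOnArc κ χ arc) :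
    S.LocallyIsometric T := by
  cases arc with
  | middle =>
    rcases h with ⟨b, hb⟩ | ⟨rfl, b, a, ha, rfl, hb⟩ <;>
      rcases h' with ⟨b', hb'⟩ | ⟨h0, b', a', ha', hκ, hb'⟩
    · exact hb.locallyIsometric hb'
    · subst h0 hκ
      exact (hb'.locallyIsometric_of_reeb_central ha' hb).symm
    · exact hb.locallyIsometric_of_reeb_central ha hb'
    · obtain ⟨b'', hb''⟩ := hb'.exists_of_sq_eq (a₂' := a) rfl (by linarith)
      exact hb.locallyIsometric hb''
  | plus =>
    obtain ⟨h0, b, a, ha, rfl, hb⟩ := h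
    obtain ⟨-, b', a', ha', hκ, hb'⟩ := h'
    obtain ⟨b'', hb''⟩ := hb'.exists_of_sq_eq (a₂' := a) rfl (by linarith)
    exact hb.locallyIsometric hb''
  | minus =>
    obtain ⟨h0, b, a, ha, rfl, hb⟩ := h
    obtain ⟨-, b', a', ha', hκ, hb'⟩ := h'
    obtain ⟨b'', hb''⟩ := hb'.exists_of_sq_eq (a₁' := a) (by linarith) rfl
    exact hb.locallyIsometric hb''

theorem IsOnArc.nonempty_lieEquiv {arc : Arc} (h : S.IsOnArc κ χ arc) (h' : T.IsOnArc κ χ arc)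
    (h0 : χ ≠ 0 ∨ χ = 0 ∧ 0 ≤ κ) : Nonempty (G.Lie ≃ₗ⁅ℝ⁆ H.Lie) := by
  have hd : χ = 0 → ∀ a : ℝ, a ≠ 0 → κ ≠ -a ^ 2 := fun hχ a ha hκ => by
    have := h0.resolve_left (not_not.2 hχ)
    have : 0 < a ^ 2 := by positivity
    linarith
  cases arc with
  | middle =>
    rcases h with ⟨b, hb⟩ | ⟨h0, b, a, ha, hκ, hb⟩
    · rcases h' with ⟨b', hb'⟩ | ⟨h0, b', a', ha', hκ, hb'⟩
      · obtain ⟨e, -⟩ := hb.exists_lieEquiv hb'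
        exact ⟨e⟩
      · exact absurd hκ (hd h0 a' ha')
    · exact absurd hκ (hd h0 a ha)
  | plus =>
    obtain ⟨h0, b, a, ha, rfl, hb⟩ := h
    obtain ⟨-, b', a', ha', hκ, hb'⟩ := h'
    obtain ⟨b'', hb''⟩ := hb'.exists_of_sq_eq (a₂' := a) rfl (by linarith)
    obtain ⟨e, -⟩ := hb.exists_lieEquiv hb''
    exact ⟨e⟩
  | minus =>
    obtain ⟨h0, b, a, ha, rfl, hb⟩ := h
    obtain ⟨-, b', a', ha', hκ, hb'⟩ := h'
    obtain ⟨b'', hb''⟩ := hb'.exists_of_sq_eq (a₁' := a) (by linarith) rfl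
    obtain ⟨e, -⟩ := hb.exists_lieEquiv hb''
    exact ⟨e⟩

/-- For `χ > 0` the arc is determined by which of `a₁` and `a₂` vanish. -/
theorem IsOnArc.exists_frame {arc : Arc} (h : S.IsOnArc κ χ arc) (hχ : 0 < χ) :
    ∃ b w a₁ a₂, S.IsCanonicalFrame b χ w a₁ a₂ ∧ (a₁ ≠ 0 ↔ arc = .minus) ∧
      (a₂ ≠ 0 ↔ arc = .plus) := by
  cases arc with
  | middle =>
    rcases h with ⟨b, hb⟩ | ⟨h0, -⟩
    · exact ⟨b, _, _, _, hb, by simp, by simp⟩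
    · exact absurd h0 hχ.ne'
  | plus =>
    obtain ⟨h0, b, a, ha, rfl, hb⟩ := h
    exact ⟨b, _, _, _, hb, by simp, by simp [ha]⟩
  | minus =>
    obtain ⟨h0, b, a, ha, rfl, hb⟩ := h
    exact ⟨b, _, _, _, hb, by simp [ha], by simp⟩

theorem IsOnArc.eq_middle {arc : Arc} (h : S.IsOnArc κ χ arc) (hχ : χ = 0) : arc = .middle := by
  cases arc with
  | middle => rfl
  | plus => exact absurd hχ h.1.ne'
  | minus => exact absurd hχ h.1.ne'

theorem IsOnArc.arc_eq_of_locallyIsometric {arc arc' : Arc} (h : S.IsOnArc κ χ arc)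
    (h' : T.IsOnArc κ χ arc') (hχ : 0 ≤ χ) (hi : S.LocallyIsometric T) : arc = arc' := by
  rcases hχ.eq_or_lt with h0 | h0
  · rw [h.eq_middle h0.symm, h'.eq_middle h0.symm]
  · obtain ⟨b, w, a₁, a₂, hb, h1, h2⟩ := h.exists_frame h0
    obtain ⟨b', w', a₁', a₂', hb', h1', h2'⟩ := h'.exists_frame h0
    obtain ⟨-, e1, e2⟩ := (hb.invariant hb' hχ hχ hi).2.2 h0.ne'
    have i1 : a₁ ≠ 0 ↔ a₁' ≠ 0 := by
      rw [← sq_pos_iff (a := a₁), ← sq_pos_iff (a := a₁'), e1]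
    have i2 : a₂ ≠ 0 ↔ a₂' ≠ 0 := by
      rw [← sq_pos_iff (a := a₂), ← sq_pos_iff (a := a₂'), e2]
    rw [h1, h1'] at i1
    rw [h2, h2'] at i2
    cases arc <;> cases arc' <;> simp_all

theorem HasLabel.locallyIsometric_iff {κ' χ' : ℝ} {l l' : Label} (hS : S.HasInvariants κ χ)
    (hT : T.HasInvariants κ' χ') (hl : S.HasLabel l) (hl' : T.HasLabel l') :
    S.LocallyIsometric T ↔ κ = κ' ∧ χ = χ' ∧ l.arc = l'.arc := by
  constructor
  · intro h
    obtain ⟨rfl, rfl⟩ := hS.eq_of_locallyIsometric hT h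
    exact ⟨rfl, rfl, (hl.isOnArc hS).arc_eq_of_locallyIsometric (hl'.isOnArc hT) hS.nonneg h⟩
  · rintro ⟨rfl, rfl, h⟩
    have := hl'.isOnArc hT
    rw [← h] at this
    exact (hl.isOnArc hS).locallyIsometric this

theorem HasInvariants.existsUnique_hasLabel (h : S.HasInvariants κ χ) :
    ∃ l : Label, S.HasLabel l ∧ l.OccursAt κ χ ∧ ∀ l' : Label, S.HasLabel l' → l' = l := by
  obtain ⟨arc, harc⟩ := h.exists_isOnArc
  obtain ⟨l, hl, ho, -⟩ := harc.exists_hasLabel h.nonneg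
  exact ⟨l, hl, ho, fun l' hl' => hl'.unique hl⟩

theorem HasInvariants.locallyIsometric_iff_nonempty_lieEquiv (hS : S.HasInvariants κ χ)
    (hT : T.HasInvariants κ χ) (h0 : χ ≠ 0 ∨ χ = 0 ∧ 0 ≤ κ) :
    S.LocallyIsometric T ↔ Nonempty (G.Lie ≃ₗ⁅ℝ⁆ H.Lie) := by
  obtain ⟨l, hl, -, -⟩ := hS.existsUnique_hasLabel
  obtain ⟨l', hl', -, -⟩ := hT.existsUnique_hasLabel
  rw [HasLabel.locallyIsometric_iff hS hT hl hl']
  constructor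
  · rintro ⟨-, -, h⟩
    have := hl'.isOnArc hT
    rw [← h] at this
    exact (hl.isOnArc hS).nonempty_lieEquiv this h0
  · rintro ⟨e⟩
    exact ⟨rfl, rfl, hl.arc_eq_of_lieEquiv hl' e⟩

/-- Two of four structures with the same invariants lie on the same of the three arcs. -/
theorem exists_ne_locallyIsometric {G : Fin 4 → LieGroup3.{u}} {S : ∀ i, LeftInvariantSR (G i)}
    (h : ∀ i, (S i).HasInvariants κ χ) : ∃ i j, i ≠ j ∧ (S i).LocallyIsometric (S j) := by
  choose arc harc using fun i => (h i).exists_isOnArc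
  let f : Arc → Fin 3 := fun a => match a with | .middle => 0 | .plus => 1 | .minus => 2
  have hf : Function.Injective f := by rintro (_ | _ | _) (_ | _ | _) <;> simp [f]
  obtain ⟨i, j, hij, he⟩ := Fintype.exists_ne_map_eq_of_card_lt (f ∘ arc) (by simp)
  have hj := harc j
  rw [← hf he] at hj
  exact ⟨i, j, hij, (harc i).locallyIsometric hj⟩

end LeftInvariantSR

end

/-! ### Unimodularity and the adjoint trace -/

noncomputable section

open Set Filter Topology

/-- Jacobi's formula for the solutions of a linear differential equation. -/
theorem hasDerivAt_det {A : ℝ → E3 →L[ℝ] E3} {B : E3 →L[ℝ] E3} {t : ℝ}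
    (h : ∀ v, HasDerivAt (fun s => A s v) (B (A t v)) t) :
    HasDerivAt (fun s => (A s).det) (LinearMap.trace ℝ E3 (B : E3 →ₗ[ℝ] E3) * (A t).det) t := by
  let b := (EuclideanSpace.basisFun (Fin 3) ℝ).toBasis
  have hdet : ∀ C : E3 →L[ℝ] E3, C.det = Matrix.det (Matrix.of fun i j => C (b j) i) := fun C => by
    rw [ContinuousLinearMap.det, ← LinearMap.det_toMatrix b]
    congr 1
    ext i j
    simp [LinearMap.toMatrix_apply, b]
  have hB : ∀ v i, B v i = v 0 * B (b 0) i + v 1 * B (b 1) i + v 2 * B (b 2) i := fun v i => by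
    have e := b.sum_repr v
    rw [Fin.sum_univ_three] at e
    have e' : v = v 0 • b 0 + v 1 • b 1 + v 2 • b 2 := e.symm
    conv_lhs => rw [e', map_add, map_add, map_smul, map_smul, map_smul]
    simp
  have htr : LinearMap.trace ℝ E3 (B : E3 →ₗ[ℝ] E3) = B (b 0) 0 + B (b 1) 1 + B (b 2) 2 := by
    rw [LinearMap.trace_eq_matrix_trace ℝ b, Matrix.trace, Fin.sum_univ_three]
    simp [LinearMap.toMatrix_apply, b]
  have hc : ∀ i j, HasDerivAt (fun s => A s (b j) i) (B (A t (b j)) i) t := fun i j =>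
    ((EuclideanSpace.proj i : E3 →L[ℝ] ℝ).hasFDerivAt.comp_hasDerivAt t (h (b j)))
  simp only [hdet, Matrix.det_fin_three, Matrix.of_apply]
  refine ((((((hc 0 0).mul (hc 1 1)).mul (hc 2 2)).sub (((hc 0 0).mul (hc 1 2)).mul (hc 2 1))).sub
    (((hc 0 1).mul (hc 1 0)).mul (hc 2 2))).add (((hc 0 1).mul (hc 1 2)).mul (hc 2 0))
    |>.add (((hc 0 2).mul (hc 1 0)).mul (hc 2 1))
    |>.sub (((hc 0 2).mul (hc 1 1)).mul (hc 2 0))).congr_deriv ?_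
  rw [htr]
  simp only [hB (A t _)]
  simp only [Pi.mul_apply]
  ring

namespace LieGroup3

variable (G : LieGroup3.{u}) {F : Type*} [NormedAddCommGroup F] [NormedSpace ℝ F]

theorem contMDiff_conj (g : G.carrier) :
    ContMDiff (𝓡 3) (𝓡 3) ∞ fun x : G.carrier => g * x * g⁻¹ :=
  (contMDiff_mul_right (a := g⁻¹)).comp (contMDiff_mul_left (a := g))

theorem hasMFDerivAt_conj (g : G.carrier) {x : G.carrier} (hx : x = 1) :
    HasMFDerivAt (𝓡 3) (𝓡 3) (fun x : G.carrier => g * x * g⁻¹) x (G.Ad g : E3 →L[ℝ] E3) := by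
  subst hx
  exact ((G.contMDiff_conj g).mdifferentiable (by simp) 1).hasMFDerivAt

theorem Ad_one : G.Ad 1 = ContinuousLinearMap.id ℝ E3 := by
  have h := G.hasMFDerivAt_conj 1 rfl
  have e : (fun x : G.carrier => 1 * x * 1⁻¹) = id := by ext; simp
  rw [e] at h
  exact hasMFDerivAt_unique h (hasMFDerivAt_id 1)

theorem Ad_mul (g h : G.carrier) : G.Ad (g * h) = G.Ad g ∘L G.Ad h := by
  have e := (G.hasMFDerivAt_conj g (x := h * 1 * h⁻¹) (by simp)).comp (1 : G.carrier)
    (G.hasMFDerivAt_conj h rfl)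
  have e' : (fun x : G.carrier => g * x * g⁻¹) ∘ (fun x : G.carrier => h * x * h⁻¹) =
      fun x => g * h * x * (g * h)⁻¹ := by ext x; simp [mul_assoc]
  rw [e'] at e
  exact hasMFDerivAt_unique (G.hasMFDerivAt_conj (g * h) rfl) e

variable {G}

theorem HasLogDerivAt.mul_right {Ψ : F → G.carrier} {θ : F →L[ℝ] E3} {x : F}
    (h : G.HasLogDerivAt Ψ θ x) (g : G.carrier) :
    G.HasLogDerivAt (fun y => Ψ y * g) (G.Ad g⁻¹ ∘L θ) x := by
  have h1 := h.mul_left (Ψ x)⁻¹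
  have h2 := (G.hasMFDerivAt_conj g⁻¹ (x := (Ψ x)⁻¹ * Ψ x) (by simp)).comp x h1
  have h3 : G.HasLogDerivAt ((fun x : G.carrier => g⁻¹ * x * g⁻¹⁻¹) ∘ fun y => (Ψ x)⁻¹ * Ψ y)
      (G.Ad g⁻¹ ∘L θ) x := by
    refine HasLogDerivAt.of_hasMFDerivAt h2 ?_
    have e1 : (Ψ x)⁻¹ * Ψ x = 1 := by simp
    have e2 : ((fun x : G.carrier => g⁻¹ * x * g⁻¹⁻¹) ∘ fun y => (Ψ x)⁻¹ * Ψ y) x = 1 := by simp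
    have e3 : G.dL ((fun y => (Ψ x)⁻¹ * Ψ y) x) = ContinuousLinearMap.id ℝ E3 :=
      (congrArg G.dL e1).trans G.dL_one
    rw [e2, G.dL_one, e3]
    rfl
  have h4 := h3.mul_left (Ψ x * g)
  convert h4 using 2 with y
  simp [mul_assoc]

/-- The derivative of `y ↦ Ad (Φ y)⁻¹` along lines, which is read off from the Maurer–Cartan
equation for `(x, y) ↦ Φ x * Φ y`. -/
theorem hasDerivAt_Ad_inv {Φ : E3 → G.carrier} {U : Set E3} (hU : IsOpen U)
    (hΦ : ∀ x ∈ U, ContMDiffAt 𝓘(ℝ, E3) (𝓡 3) ∞ Φ x) {x : E3} (hx : x ∈ U)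
    (hb : Function.Surjective (G.logDeriv Φ x)) (y w : E3) {t : ℝ} (hy : y + t • w ∈ U) (v : E3) :
    HasDerivAt (fun s => G.Ad (Φ (y + s • w))⁻¹ v)
      (-G.br (G.logDeriv Φ (y + t • w) w) (G.Ad (Φ (y + t • w))⁻¹ v)) t := by
  obtain ⟨u, rfl⟩ := hb v
  set Ψ : E3 × E3 → G.carrier := fun p => Φ p.1 * Φ p.2 with hΨ
  have hlogΦ : ∀ x ∈ U, G.HasLogDerivAt Φ (G.logDeriv Φ x) x := fun x hx =>
    hasLogDerivAt_logDeriv ((hΦ x hx).mdifferentiableAt (by simp))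
  have hsm : ∀ p ∈ U ×ˢ U, ContMDiffAt 𝓘(ℝ, E3 × E3) (𝓡 3) ∞ Ψ p := fun p hp =>
    ContMDiffAt.mul
      (ContMDiffAt.comp (g := Φ) p (hΦ p.1 hp.1) contDiff_fst.contMDiff.contMDiffAt)
      (ContMDiffAt.comp (g := Φ) p (hΦ p.2 hp.2) contDiff_snd.contMDiff.contMDiffAt)
  have hlog : ∀ p ∈ U ×ˢ U, G.HasLogDerivAt Ψ (G.logDeriv Ψ p) p := fun p hp =>
    hasLogDerivAt_logDeriv ((hsm p hp).mdifferentiableAt (by simp))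
  -- the first variable acts through `Ad (Φ q)⁻¹`, which is the quantity to be differentiated
  have hfst : ∀ p ∈ U ×ˢ U, ∀ u, G.logDeriv Ψ p (u, 0) = G.Ad (Φ p.2)⁻¹ (G.logDeriv Φ p.1 u) := by
    rintro ⟨p, q⟩ hp u
    have e1 := (hlogΦ p hp.1).mul_right (Φ q)
    have e2 := (hlog _ hp).comp (f := fun t => (t, q))
      ((hasFDerivAt_id p).prodMk (hasFDerivAt_const q p))
    have := DFunLike.congr_fun (e2.unique e1) u
    simpa using this
  have hsnd : ∀ p ∈ U ×ˢ U, ∀ w, G.logDeriv Ψ p (0, w) = G.logDeriv Φ p.2 w := by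
    rintro ⟨p, q⟩ hp w
    have e1 := (hlogΦ q hp.2).mul_left (Φ p)
    have e2 := (hlog _ hp).comp (f := fun t => (p, t))
      ((hasFDerivAt_const p q).prodMk (hasFDerivAt_id q))
    have := DFunLike.congr_fun (e2.unique e1) w
    simpa using this
  have hUU : IsOpen (U ×ˢ U) := hU.prod hU
  set z := y + t • w with hz
  have hp : (x, z) ∈ U ×ˢ U := ⟨hx, hy⟩
  have hd : HasFDerivAt (G.logDeriv Ψ) (fderiv ℝ (G.logDeriv Ψ) (x, z)) (x, z) :=
    ((contDiffAt_logDeriv (hsm _ hp)).differentiableAt (by simp)).hasFDerivAt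
  have mc := maurerCartan (by
    filter_upwards [hUU.mem_nhds hp] with q hq using hlog q hq) hd (0, w) (u, 0)
  have hline : HasDerivAt (fun s : ℝ => y + s • w) w t := by
    simpa using ((hasDerivAt_id t).smul_const w).const_add y
  have e1 := hasDerivAt_clm_comp (c := fun s : ℝ => (x, y + s • w)) hd
    ((hasDerivAt_const t x).prodMk hline) (u, 0)
  have e2 : fderiv ℝ (G.logDeriv Ψ) (x, z) (u, 0) (0, w) = 0 := by
    have hline' : HasDerivAt (fun s : ℝ => x + s • u) u 0 := by
      simpa using ((hasDerivAt_id (0 : ℝ)).smul_const u).const_add x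
    have c1 := hasDerivAt_clm_comp (c := fun s : ℝ => (x + s • u, z)) (t := 0)
      (by simpa using hd) (hline'.prodMk (hasDerivAt_const 0 z)) (0, w)
    have c2 : (fun s : ℝ => G.logDeriv Ψ (x + s • u, z) (0, w)) =ᶠ[𝓝 0]
        fun _ => G.logDeriv Φ z w := by
      have : ∀ᶠ s in 𝓝 (0 : ℝ), x + s • u ∈ U :=
        hline'.continuousAt.preimage_mem_nhds (hU.mem_nhds (by simpa using hx))
      filter_upwards [this] with s hs using hsnd _ ⟨hs, hy⟩ w
    exact c1.unique ((hasDerivAt_const (0 : ℝ) _).congr_of_eventuallyEq c2)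
  rw [e2, sub_zero, hsnd _ hp, hfst _ hp] at mc
  rw [eq_neg_of_add_eq_zero_left mc] at e1
  refine e1.congr_of_eventuallyEq ?_
  have : ∀ᶠ s in 𝓝 t, y + s • w ∈ U := hline.continuousAt.preimage_mem_nhds (hU.mem_nhds hy)
  filter_upwards [this] with s hs using (hfst (x, y + s • w) ⟨hx, hs⟩ u).symm

theorem contMDiffAt_chart_symm {p : G.carrier} {x : E3} (hx : x ∈ (chartAt E3 p).target) :
    ContMDiffAt (𝓡 3) (𝓡 3) ∞ (chartAt E3 p).symm x :=
  (contMDiffOn_chart_symm (n := ∞)).contMDiffAt ((chartAt E3 p).open_target.mem_nhds hx)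

theorem logDeriv_chart_symm_bijective {p : G.carrier} {x : E3} (hx : x ∈ (chartAt E3 p).target) :
    Function.Bijective (G.logDeriv (chartAt E3 p).symm x) := by
  set c := chartAt E3 p
  have h := (hasLogDerivAt_logDeriv ((contMDiffAt_chart_symm hx).mdifferentiableAt
    (by simp))).hasFDerivAt_chart (p := p) (c.map_target hx)
  have hid : (fun y => chartAt E3 p (c.symm y)) =ᶠ[𝓝 x] id := by
    filter_upwards [c.open_target.mem_nhds hx] with y hy using c.right_inv hy
  have e := h.unique ((hasFDerivAt_id x).congr_of_eventuallyEq hid)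
  have hinj : Function.Injective (G.logDeriv c.symm x : E3 →ₗ[ℝ] E3) :=
    Function.LeftInverse.injective (g := G.chartFrame p (chartAt E3 p (c.symm x)))
      fun v => DFunLike.congr_fun e v
  exact ⟨hinj, LinearMap.injective_iff_surjective.1 hinj⟩

theorem trace_neg_br (G : LieGroup3.{u}) (v : E3) :
    LinearMap.trace ℝ E3 ((-G.br v : E3 →L[ℝ] E3) : E3 →ₗ[ℝ] E3) = -adTrace G.Lie v :=
  map_neg (LinearMap.trace ℝ E3) (G.br v : E3 →ₗ[ℝ] E3)

/-- A connected Lie group is unimodular if and only if the adjoint representation of its Lie algebra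
is traceless. -/
theorem isUnimodular_iff (G : LieGroup3.{u}) : G.IsUnimodular ↔ adTrace G.Lie = 0 := by
  set c := chartAt E3 (1 : G.carrier) with hc
  have h1 : (1 : G.carrier) ∈ c.source := mem_chart_source _ _
  have hcs : ∀ x ∈ c.target, ContMDiffAt (𝓡 3) (𝓡 3) ∞ c.symm x := fun x hx =>
    contMDiffAt_chart_symm hx
  have hlog : ∀ x ∈ c.target, Function.Bijective (G.logDeriv c.symm x) := fun x hx =>
    logDeriv_chart_symm_bijective hx
  set x₀ := c 1 with hx₀
  have hx₀t : x₀ ∈ c.target := c.map_source h1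
  have hcx₀ : c.symm x₀ = 1 := c.left_inv h1
  -- the derivative of `det Ad` along lines in the chart
  have hder : ∀ (w : E3) (t : ℝ), x₀ + t • w ∈ c.target →
      HasDerivAt (fun s => (G.Ad (c.symm (x₀ + s • w))⁻¹).det)
        (-adTrace G.Lie (G.logDeriv c.symm (x₀ + t • w) w) * (G.Ad (c.symm (x₀ + t • w))⁻¹).det)
        t := by
    intro w t ht
    have := hasDerivAt_det (A := fun s => G.Ad (c.symm (x₀ + s • w))⁻¹)
      (B := -G.br (G.logDeriv c.symm (x₀ + t • w) w)) (t := t)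
      (fun v => hasDerivAt_Ad_inv c.open_target hcs hx₀t (hlog x₀ hx₀t).2 x₀ w ht v)
    exact this.congr_deriv (congrArg (· * _) (G.trace_neg_br _))
  have hdet1 : (G.Ad 1).det = 1 := by
    rw [Ad_one]; exact LinearMap.det_id
  constructor
  · intro h
    refine LinearMap.ext fun v => ?_
    obtain ⟨w, hw⟩ := (hlog x₀ hx₀t).2 v
    have d := hder w 0 (by simpa using hx₀t)
    rw [zero_smul, add_zero, hcx₀, inv_one, hdet1, hw, mul_one] at d
    -- the square of the determinant is constant, and its derivative is `-2 tr (ad v)` at `0`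
    have d2 := d.mul d
    have e : (fun s : ℝ => (G.Ad (c.symm (x₀ + s • w))⁻¹).det) *
        (fun s : ℝ => (G.Ad (c.symm (x₀ + s • w))⁻¹).det) = fun _ => 1 := by
      ext s
      rw [Pi.mul_apply, ← abs_mul_abs_self, h, one_mul]
    rw [e, zero_smul, add_zero, hcx₀, inv_one, hdet1] at d2
    have := d2.unique (hasDerivAt_const 0 1)
    change adTrace G.Lie v = 0
    linarith
  · intro h
    have hmul : ∀ g h : G.carrier, (G.Ad (g * h)).det = (G.Ad g).det * (G.Ad h).det := fun g h => by
      rw [Ad_mul]; exact LinearMap.det_comp _ _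
    -- a subgroup that contains a neighbourhood of the identity, hence the whole connected group
    let K : Subgroup G.carrier :=
      { carrier := {g | (G.Ad g).det = 1}
        mul_mem' := fun {a b} ha hb => by
          rw [mem_ofPred_eq] at *
          rw [hmul, ha, hb, one_mul]
        one_mem' := hdet1
        inv_mem' := fun {a} ha => by
          rw [mem_ofPred_eq] at *
          have := hmul a a⁻¹
          rw [mul_inv_cancel, hdet1, ha, one_mul] at this
          exact this.symm }
    have hK : (K : Set G.carrier) ∈ 𝓝 (1 : G.carrier) := by
      obtain ⟨ε, hε, hball⟩ := Metric.isOpen_iff.1 c.open_target x₀ hx₀t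
      have hn : c ⁻¹' Metric.ball x₀ ε ∈ 𝓝 (1 : G.carrier) :=
        (c.continuousAt h1).preimage_mem_nhds (Metric.ball_mem_nhds _ hε)
      filter_upwards [hn, c.open_source.mem_nhds h1] with g hg hgs
      set w := c g - x₀ with hw
      have hmem : ∀ s ∈ Icc (0 : ℝ) 1, x₀ + s • w ∈ c.target := fun s hs => hball (by
        have hg' : ‖w‖ < ε := by simpa [dist_eq_norm] using hg
        rw [Metric.mem_ball, dist_eq_norm, add_sub_cancel_left, norm_smul, Real.norm_of_nonneg hs.1]
        nlinarith [norm_nonneg w, hs.2])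
      have d : ∀ s ∈ Icc (0 : ℝ) 1,
          HasDerivAt (fun s => (G.Ad (c.symm (x₀ + s • w))⁻¹).det) 0 s := fun s hs => by
        have := hder w s (hmem s hs)
        refine this.congr_deriv ?_
        rw [h]
        exact (congrArg (· * _) neg_zero).trans (zero_mul _)
      have hconst := constant_of_has_deriv_right_zero
        (fun s hs => (d s hs).continuousAt.continuousWithinAt)
        (fun s hs => (d s ⟨hs.1, hs.2.le⟩).hasDerivWithinAt) 1 (by simp)
      simp only [one_smul, zero_smul, add_zero, hcx₀, inv_one, hdet1, hw, add_sub_cancel,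
        c.left_inv hgs] at hconst
      have : g⁻¹ ∈ K := hconst
      exact inv_mem_iff.1 this
    have hKo := K.isOpen_of_mem_nhds hK
    have huniv := IsClopen.eq_univ ⟨K.isClosed_of_isOpen hKo, hKo⟩ ⟨1, K.one_mem⟩
    intro g
    have : g ∈ (K : Set G.carrier) := huniv ▸ mem_univ g
    rw [show (G.Ad g).det = 1 from this, abs_one]

end LieGroup3

end

/-! ### The Lie algebra of a group with a matrix representation -/

noncomputable section

open Set Filter Topology

namespace LieGroup3

section Representation

variable {G : LieGroup3.{u}} {A : Type*} [NormedRing A] [NormedAlgebra ℝ A] {ρ : G.carrier → A}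

theorem mfderiv_dL_of_map_mul (hρ : ContMDiff (𝓡 3) 𝓘(ℝ, A) ∞ ρ)
    (hmul : ∀ g h, ρ (g * h) = ρ g * ρ h)
    {g : G.carrier} {D Dg : E3 →L[ℝ] A} (hD : D = mfderiv (𝓡 3) 𝓘(ℝ, A) ρ 1)
    (hDg : Dg = mfderiv (𝓡 3) 𝓘(ℝ, A) ρ g) (v : E3) : Dg (G.dL g v) = ρ g * D v := by
  have h1 : HasMFDerivAt (𝓡 3) 𝓘(ℝ, A) ρ 1 D := by
    rw [hD]
    exact ((hρ 1).mdifferentiableAt (by simp)).hasMFDerivAt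
  have h2 : HasMFDerivAt (𝓡 3) 𝓘(ℝ, A) ρ (g * 1) Dg := by
    rw [mul_one, hDg]
    exact ((hρ g).mdifferentiableAt (by simp)).hasMFDerivAt
  have hg : HasMFDerivAt (𝓡 3) (𝓡 3) (fun x : G.carrier => g * x) 1 (G.dL g) :=
    (G.mdifferentiable_mul_left g 1).hasMFDerivAt
  have e1 := h2.comp (1 : G.carrier) hg
  have e2 := ((ContinuousLinearMap.mul ℝ A (ρ g)).hasMFDerivAt).comp (1 : G.carrier) h1
  have e3 : (ρ ∘ fun x : G.carrier => g * x) = ContinuousLinearMap.mul ℝ A (ρ g) ∘ ρ :=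
    funext fun x => hmul g x
  rw [e3] at e1
  exact DFunLike.congr_fun (hasMFDerivAt_unique e1 e2) v

/-- The differential of a smooth representation is a homomorphism of Lie algebras. -/
theorem mfderiv_br_of_map_mul (hρ : ContMDiff (𝓡 3) 𝓘(ℝ, A) ∞ ρ) (h1 : ρ 1 = 1)
    (hmul : ∀ g h, ρ (g * h) = ρ g * ρ h) {D : E3 →L[ℝ] A} (hD : D = mfderiv (𝓡 3) 𝓘(ℝ, A) ρ 1)
    (a b : E3) : D (G.br a b) = D a * D b - D b * D a := by
  set c := chartAt E3 (1 : G.carrier) with hc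
  have hs : (1 : G.carrier) ∈ c.source := mem_chart_source _ _
  set x₀ := c 1
  have hx₀ : x₀ ∈ c.target := c.map_source hs
  obtain ⟨u, rfl⟩ := (logDeriv_chart_symm_bijective hx₀).2 a
  obtain ⟨v, rfl⟩ := (logDeriv_chart_symm_bijective hx₀).2 b
  set θ := G.logDeriv c.symm
  have hlog : ∀ x ∈ c.target, G.HasLogDerivAt c.symm (θ x) x := fun x hx =>
    hasLogDerivAt_logDeriv ((contMDiffAt_chart_symm hx).mdifferentiableAt (by simp))
  set P : E3 → A := fun x => ρ (c.symm x) with hP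
  have hP1 : P x₀ = 1 := by rw [hP]; simp only [x₀, c.left_inv hs, h1]
  have hPs : ∀ x ∈ c.target, ContDiffAt ℝ ∞ P x := fun x hx => by
    rw [← contMDiffAt_iff_contDiffAt]
    exact (hρ (c.symm x)).comp x (contMDiffAt_chart_symm hx)
  have hPd : ∀ x ∈ c.target, fderiv ℝ P x = (ContinuousLinearMap.mul ℝ A (P x)) ∘L (D ∘L θ x) := by
    intro x hx
    obtain ⟨Dg, hDg⟩ : ∃ Dg : E3 →L[ℝ] A, Dg = mfderiv (𝓡 3) 𝓘(ℝ, A) ρ (c.symm x) := ⟨_, rfl⟩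
    have e : HasMFDerivAt (𝓡 3) 𝓘(ℝ, A) ρ (c.symm x) Dg := by
      rw [hDg]
      exact ((hρ (c.symm x)).mdifferentiableAt (by simp)).hasMFDerivAt
    have e' : HasFDerivAt P (Dg ∘L (G.dL (c.symm x) ∘L θ x)) x :=
      hasMFDerivAt_iff_hasFDerivAt.1 (HasMFDerivAt.comp x e (hlog x hx))
    refine e'.fderiv.trans ?_
    ext1 w
    exact mfderiv_dL_of_map_mul hρ hmul hD hDg _
  have hθd : HasFDerivAt θ (fderiv ℝ θ x₀) x₀ :=
    ((contDiffAt_logDeriv (contMDiffAt_chart_symm hx₀)).differentiableAt (by simp)).hasFDerivAt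
  have mc := maurerCartan (by
    filter_upwards [c.open_target.mem_nhds hx₀] with x hx using hlog x hx) hθd u v
  -- the symmetry of the second derivative, compared with the Maurer–Cartan equation
  have second : ∀ u v, fderiv ℝ (fderiv ℝ P) x₀ v u =
      D (θ x₀ v) * D (θ x₀ u) + D (fderiv ℝ θ x₀ v u) := by
    intro u v
    have e1 : (fun x => fderiv ℝ P x u) =ᶠ[𝓝 x₀] fun x => P x * D (θ x u) := by
      filter_upwards [c.open_target.mem_nhds hx₀] with x hx
      rw [hPd x hx]
      rfl
    have e2 : HasFDerivAt (fderiv ℝ P) (fderiv ℝ (fderiv ℝ P) x₀) x₀ :=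
      (((hPs x₀ hx₀).fderiv_right (m := 1) (by
        simpa [one_add_one_eq_two] using two_le_infty)).differentiableAt (by simp)).hasFDerivAt
    have e3 := e2.clm_apply (hasFDerivAt_const u x₀)
    have e4 := ((hPs x₀ hx₀).differentiableAt (by simp)).hasFDerivAt.mul'
      (D.hasFDerivAt.comp x₀ (hθd.clm_apply (hasFDerivAt_const u x₀)))
    have := DFunLike.congr_fun (e3.unique (e4.congr_of_eventuallyEq e1)) v
    rw [hPd x₀ hx₀] at this
    simpa [hP1, add_comm] using this
  have hsymm : fderiv ℝ (fderiv ℝ P) x₀ v u = fderiv ℝ (fderiv ℝ P) x₀ u v :=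
    ((hPs x₀ hx₀).isSymmSndFDerivAt (by simpa using two_le_infty)) v u
  rw [second, second] at hsymm
  have e5 : G.br (θ x₀ u) (θ x₀ v) = fderiv ℝ θ x₀ v u - fderiv ℝ θ x₀ u v := by
    rw [← sub_eq_zero, ← mc]
    abel
  rw [e5, map_sub, sub_eq_sub_iff_add_eq_add, add_comm, hsymm]

end Representation

/-- A smooth representation whose tangent vectors at the identity include three independent `X i`
embeds the Lie algebra of `G` into a normed algebra, with commutators as brackets and with the `X i`
as the images of a basis. The `X i` are given as velocities of curves, so that no differential of a
representation has to be computed in a chart. -/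
theorem exists_basis_of_rep {G : LieGroup3.{u}} {A : Type*} [NormedRing A] [NormedAlgebra ℝ A]
    {ρ : G.carrier → A} (hρ : ContMDiff (𝓡 3) 𝓘(ℝ, A) ∞ ρ) (h1 : ρ 1 = 1)
    (hmul : ∀ g h, ρ (g * h) = ρ g * ρ h) {X : Fin 3 → A} (hX : LinearIndependent ℝ X)
    (hγ : ∀ i, ∃ γ : ℝ → G.carrier, γ 0 = 1 ∧ MDifferentiableAt 𝓘(ℝ, ℝ) (𝓡 3) γ 0 ∧
      HasDerivAt (fun t => ρ (γ t)) (X i) 0) :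
    ∃ (b : Module.Basis (Fin 3) ℝ G.Lie) (D : G.Lie →ₗ[ℝ] A), (∀ i, D (b i) = X i) ∧
      Function.Injective D ∧ ∀ v w, D ⁅v, w⁆ = D v * D w - D w * D v := by
  obtain ⟨D, hD⟩ : ∃ D : E3 →L[ℝ] A, D = mfderiv (𝓡 3) 𝓘(ℝ, A) ρ 1 := ⟨_, rfl⟩
  have hsurj : ∀ i, ∃ v : G.Lie, D v = X i := by
    intro i
    obtain ⟨γ, h0, hγ, hd⟩ := hγ i
    obtain ⟨γ', hγ'⟩ : ∃ γ' : ℝ →L[ℝ] E3, γ' = mfderiv 𝓘(ℝ, ℝ) (𝓡 3) γ 0 := ⟨_, rfl⟩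
    refine ⟨γ' 1, ?_⟩
    have e0 : HasMFDerivAt (𝓡 3) 𝓘(ℝ, A) ρ (γ 0) D := by
      rw [h0, hD]
      exact ((hρ 1).mdifferentiableAt (by simp)).hasMFDerivAt
    have e1 : HasFDerivAt (fun t => ρ (γ t)) (D ∘L γ') 0 := by
      refine hasMFDerivAt_iff_hasFDerivAt.1 (HasMFDerivAt.comp (0 : ℝ) e0 ?_)
      rw [hγ']
      exact hγ.hasMFDerivAt
    have := DFunLike.congr_fun (e1.unique hd.hasFDerivAt) (1 : ℝ)
    exact this.trans (by simp)
  obtain ⟨D', hD'⟩ : ∃ D' : G.Lie →ₗ[ℝ] A, ∀ v : G.Lie, D' v = D v :=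
    ⟨(D : E3 →ₗ[ℝ] A), fun _ => rfl⟩
  choose v hv using hsurj
  have hli : LinearIndependent ℝ v := by
    refine LinearIndependent.of_comp D' ?_
    rwa [show D' ∘ v = X from funext fun i => (hD' _).trans (hv i)]
  let b := basisOfLinearIndependentOfCardEqFinrank hli (by simp [LeftInvariantSR.finrank_lie])
  have hb : ∀ i, D' (b i) = X i := fun i => by
    rw [show b i = v i by simp [b], hD']
    exact hv i
  refine ⟨b, D', hb, ?_, fun v w => ?_⟩
  · refine LinearMap.ker_eq_bot.1 (LinearMap.ker_eq_bot'.2 fun x hx => ?_)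
    rw [← b.sum_repr x, map_sum] at hx
    simp only [map_smul, hb] at hx
    have := Fintype.linearIndependent_iff.1 hX _ hx
    rw [← b.sum_repr x]
    simp [this]
  · rw [hD', hD', hD']
    exact mfderiv_br_of_map_mul hρ h1 hmul hD v w

end LieGroup3

end

/-! ### Lifting a Lie group to another universe -/

noncomputable section

open Set Filter Topology

section ULift

variable {M : Type} [TopologicalSpace M]

instance [ChartedSpace E3 M] : ChartedSpace E3 (ULift.{u} M) where
  atlas := (fun e => Homeomorph.ulift.transOpenPartialHomeomorph e) '' atlas E3 M
  chartAt x := Homeomorph.ulift.transOpenPartialHomeomorph (chartAt E3 x.down)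
  mem_chart_source x := mem_chart_source E3 x.down
  chart_mem_atlas x := ⟨_, chart_mem_atlas E3 x.down, rfl⟩

variable [ChartedSpace E3 M]

instance [IsManifold (𝓡 3) ∞ M] : IsManifold (𝓡 3) ∞ (ULift.{u} M) where
  compatible := by
    rintro _ _ ⟨e, he, rfl⟩ ⟨e', he', rfl⟩
    have := StructureGroupoid.compatible (H := E3) (M := M) (contDiffGroupoid ∞ (𝓡 3)) he he'
    exact this

theorem contMDiff_down [IsManifold (𝓡 3) ∞ M] :
    ContMDiff (𝓡 3) (𝓡 3) ∞ (ULift.down : ULift.{u} M → M) := by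
  intro x
  rw [contMDiffAt_iff]
  exact ⟨continuous_uliftDown.continuousAt, (contMDiffAt_iff.1 (contMDiffAt_id (x := x.down))).2⟩

theorem contMDiff_up [IsManifold (𝓡 3) ∞ M] :
    ContMDiff (𝓡 3) (𝓡 3) ∞ (ULift.up : M → ULift.{u} M) := by
  intro x
  rw [contMDiffAt_iff]
  exact ⟨continuous_uliftUp.continuousAt, (contMDiffAt_iff.1 (contMDiffAt_id (x := x))).2⟩

variable [Group M] [LieGroup (𝓡 3) ∞ M]

instance : LieGroup (𝓡 3) ∞ (ULift.{u} M) where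
  contMDiff_mul :=
    contMDiff_up.comp ((contMDiff_mul (𝓡 3) ∞).comp
      ((contMDiff_down.comp contMDiff_fst).prodMk (contMDiff_down.comp contMDiff_snd)))
  contMDiff_inv := contMDiff_up.comp ((contMDiff_inv (𝓡 3) ∞).comp contMDiff_down)

variable (M) in
/-- A Lie group, with its underlying set lifted to a given universe. -/
def LieGroup3.lift [T2Space M] [SecondCountableTopology M] [ConnectedSpace M] :
    LieGroup3.{u} where
  carrier := ULift.{u} M
  secondCountable := Homeomorph.ulift.secondCountableTopology
  connected := Homeomorph.ulift.symm.surjective.connectedSpace Homeomorph.ulift.symm.continuous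

variable [T2Space M] [SecondCountableTopology M] [ConnectedSpace M]

theorem LieGroup3.exists_basis_of_rep_lift {A : Type*} [NormedRing A] [NormedAlgebra ℝ A]
    {ρ : M → A} (hρ : ContMDiff (𝓡 3) 𝓘(ℝ, A) ∞ ρ) (h1 : ρ 1 = 1)
    (hmul : ∀ g h, ρ (g * h) = ρ g * ρ h) {X : Fin 3 → A} (hX : LinearIndependent ℝ X)
    (hγ : ∀ i, ∃ γ : ℝ → M, γ 0 = 1 ∧ MDifferentiableAt 𝓘(ℝ, ℝ) (𝓡 3) γ 0 ∧
      HasDerivAt (fun t => ρ (γ t)) (X i) 0) :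
    ∃ (b : Module.Basis (Fin 3) ℝ (LieGroup3.lift.{u} M).Lie)
      (D : (LieGroup3.lift.{u} M).Lie →ₗ[ℝ] A), (∀ i, D (b i) = X i) ∧
      Function.Injective D ∧ ∀ v w, D ⁅v, w⁆ = D v * D w - D w * D v := by
  refine exists_basis_of_rep (G := LieGroup3.lift.{u} M) (ρ := fun x => ρ x.down)
    (hρ.comp contMDiff_down) h1 (fun g h => hmul _ _) hX fun i => ?_
  obtain ⟨γ, h0, h2, h3⟩ := hγ i
  refine ⟨fun t => ULift.up (γ t), congrArg _ h0, ?_, h3⟩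
  exact (contMDiff_up.mdifferentiableAt (by simp)).comp (0 : ℝ) h2

end ULift

end

/-! ### Groups with a global chart, and the solvable models -/

noncomputable section

open Set Filter Topology

/-- A smooth group law on a three-dimensional real vector space `W`, with neutral element `0`.
The coordinates serve as a global chart. -/
structure SmoothGroupLaw (W : Type) [NormedAddCommGroup W] [NormedSpace ℝ W] where
  coords : E3 ≃L[ℝ] W
  mul : W → W → W
  inv : W → W
  mul_assoc : ∀ x y z, mul (mul x y) z = mul x (mul y z)
  zero_mul : ∀ x, mul 0 x = x
  inv_mul : ∀ x, mul (inv x) x = 0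
  contDiff_mul : ContDiff ℝ ∞ fun p : W × W => mul p.1 p.2
  contDiff_inv : ContDiff ℝ ∞ inv

namespace SmoothGroupLaw

variable {W : Type} [NormedAddCommGroup W] [NormedSpace ℝ W] (L : SmoothGroupLaw W)

/-- The Lie group with the law `L`. Its underlying manifold is the coordinate space, so that the
identity is its only chart. -/
def Carrier (_L : SmoothGroupLaw W) : Type := E3

/-- The vector of `W` with given coordinates. -/
def toVec (x : L.Carrier) : W := L.coords x

/-- The group element that is a given vector of `W`. -/
def ofVec (w : W) : L.Carrier := L.coords.symm w

theorem toVec_ofVec (w : W) : L.toVec (L.ofVec w) = w := L.coords.apply_symm_apply w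

instance : TopologicalSpace L.Carrier := inferInstanceAs (TopologicalSpace E3)
instance : T2Space L.Carrier := inferInstanceAs (T2Space E3)
instance : SecondCountableTopology L.Carrier := inferInstanceAs (SecondCountableTopology E3)
instance : ConnectedSpace L.Carrier := inferInstanceAs (ConnectedSpace E3)
instance : ChartedSpace E3 L.Carrier := inferInstanceAs (ChartedSpace E3 E3)
instance : IsManifold (𝓡 3) ∞ L.Carrier := inferInstanceAs (IsManifold (𝓡 3) ∞ E3)

instance : Mul L.Carrier := ⟨fun x y => L.ofVec (L.mul (L.toVec x) (L.toVec y))⟩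
instance : Inv L.Carrier := ⟨fun x => L.ofVec (L.inv (L.toVec x))⟩
instance : One L.Carrier := ⟨L.ofVec 0⟩

theorem toVec_mul (x y : L.Carrier) : L.toVec (x * y) = L.mul (L.toVec x) (L.toVec y) :=
  L.toVec_ofVec _

theorem toVec_inv (x : L.Carrier) : L.toVec x⁻¹ = L.inv (L.toVec x) := L.toVec_ofVec _

theorem toVec_one : L.toVec 1 = 0 := L.toVec_ofVec _

theorem toVec_injective : Function.Injective L.toVec := L.coords.injective

instance : Group L.Carrier := by
  refine Group.ofLeftAxioms (fun x y z => ?_) (fun x => ?_) (fun x => ?_) <;>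
    apply L.toVec_injective <;> simp only [toVec_mul, toVec_inv, toVec_one]
  exacts [L.mul_assoc _ _ _, L.zero_mul _, L.inv_mul _]

instance : LieGroup (𝓡 3) ∞ L.Carrier where
  contMDiff_mul := by
    have h : ContDiff ℝ ∞ fun p : E3 × E3 => L.coords.symm (L.mul (L.coords p.1) (L.coords p.2)) :=
      L.coords.symm.contDiff.comp (L.contDiff_mul.comp
        ((L.coords.contDiff.comp contDiff_fst).prodMk (L.coords.contDiff.comp contDiff_snd)))
    have h := h.contMDiff
    rw [modelWithCornersSelf_prod, ← chartedSpaceSelf_prod] at h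
    exact h
  contMDiff_inv := (L.coords.symm.contDiff.comp
    (L.contDiff_inv.comp L.coords.contDiff)).contMDiff

theorem exists_basis_of_rep {A : Type*} [NormedRing A] [NormedAlgebra ℝ A] {f : W → A}
    (hf : ContDiff ℝ ∞ f) (h0 : f 0 = 1) (hmul : ∀ x y, f (L.mul x y) = f x * f y)
    {X : Fin 3 → A} (hX : LinearIndependent ℝ X)
    (hw : ∀ i, ∃ w, HasDerivAt (fun t : ℝ => f (t • w)) (X i) 0) :
    ∃ (b : Module.Basis (Fin 3) ℝ (LieGroup3.lift.{u} L.Carrier).Lie)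
      (D : (LieGroup3.lift.{u} L.Carrier).Lie →ₗ[ℝ] A), (∀ i, D (b i) = X i) ∧
      Function.Injective D ∧ ∀ v w, D ⁅v, w⁆ = D v * D w - D w * D v := by
  refine LieGroup3.exists_basis_of_rep_lift (M := L.Carrier) (ρ := fun x => f (L.toVec x)) ?_ ?_ ?_
    hX fun i => ?_
  · exact (hf.comp L.coords.contDiff).contMDiff
  · simp only [toVec_one, h0]
  · simp only [toVec_mul, hmul, implies_true]
  · obtain ⟨w, hw⟩ := hw i
    refine ⟨fun t => L.ofVec (t • w), ?_, ?_, ?_⟩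
    · simp only [zero_smul]
      rfl
    · have : DifferentiableAt ℝ (fun t : ℝ => L.coords.symm (t • w)) 0 := by fun_prop
      exact this.mdifferentiableAt
    · simpa only [toVec_ofVec] using hw

end SmoothGroupLaw

section Solvable

/-- The operator on `ℝ²` in companion form, of trace `t` and determinant `d`. -/
def companion (t d : ℝ) : ℝ × ℝ →L[ℝ] ℝ × ℝ :=
  (-d • ContinuousLinearMap.snd ℝ ℝ ℝ).prod
    (ContinuousLinearMap.fst ℝ ℝ ℝ + t • ContinuousLinearMap.snd ℝ ℝ ℝ)

variable {V : Type} [NormedAddCommGroup V] [NormedSpace ℝ V] [CompleteSpace V]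

theorem contDiff_exp_smul (B : V →L[ℝ] V) : ContDiff ℝ ∞ fun t : ℝ => NormedSpace.exp (t • B) := by
  have h : AnalyticOnNhd ℝ (NormedSpace.exp : (V →L[ℝ] V) → V →L[ℝ] V) univ := fun x _ =>
    NormedSpace.exp_analytic x
  exact (contDiffOn_univ.1 (h.contDiffOn uniqueDiffOn_univ)).comp (by fun_prop)

theorem exp_add_smul_apply (B : V →L[ℝ] V) (s t : ℝ) (v : V) :
    NormedSpace.exp ((s + t) • B) v = NormedSpace.exp (s • B) (NormedSpace.exp (t • B) v) := by
  have h : NormedSpace.exp ((s + t) • B) = NormedSpace.exp (s • B) * NormedSpace.exp (t • B) := by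
    rw [add_smul]
    let := NormedAlgebra.restrictScalars ℚ ℝ (V →L[ℝ] V)
    exact NormedSpace.exp_add_of_commute (((Commute.refl B).smul_left s).smul_right t)
  rw [h]
  rfl

/-- The semidirect product of `ℝ` with `ℝ²`, in which `t` acts by `exp (t B)`. -/
def semidirectLaw (B : ℝ × ℝ →L[ℝ] ℝ × ℝ) : SmoothGroupLaw (ℝ × ℝ × ℝ) where
  coords := ContinuousLinearEquiv.ofFinrankEq (by simp)
  mul x y := (x.1 + y.1, x.2 + NormedSpace.exp (x.1 • B) y.2)
  inv x := (-x.1, -NormedSpace.exp (-x.1 • B) x.2)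
  mul_assoc x y z := by
    ext1
    · exact add_assoc _ _ _
    · simp only [exp_add_smul_apply, map_add, add_assoc]
  zero_mul x := by simp
  inv_mul x := by simp
  contDiff_mul := by
    have h := contDiff_exp_smul B
    have h1 : ContDiff ℝ ∞ fun p : (ℝ × ℝ × ℝ) × (ℝ × ℝ × ℝ) => NormedSpace.exp (p.1.1 • B) :=
      h.comp (by fun_prop : ContDiff ℝ ∞ fun p : (ℝ × ℝ × ℝ) × (ℝ × ℝ × ℝ) => p.1.1)
    exact (contDiff_fst.fst.add contDiff_snd.fst).prodMk
      (contDiff_fst.snd.add (h1.clm_apply contDiff_snd.snd))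
  contDiff_inv := by
    have h1 : ContDiff ℝ ∞ fun p : ℝ × ℝ × ℝ => NormedSpace.exp (-p.1 • B) :=
      (contDiff_exp_smul B).comp (by fun_prop : ContDiff ℝ ∞ fun p : ℝ × ℝ × ℝ => -p.1)
    exact contDiff_fst.neg.prodMk (h1.clm_apply contDiff_snd).neg

/-- The block operator `(v, s) ↦ (P v + s w, r s)` on `ℝ² × ℝ`. -/
def blockOp (P : ℝ × ℝ →L[ℝ] ℝ × ℝ) (w : ℝ × ℝ) (r : ℝ) :
    (ℝ × ℝ) × ℝ →L[ℝ] (ℝ × ℝ) × ℝ :=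
  ContinuousLinearMap.inl ℝ (ℝ × ℝ) ℝ ∘L P ∘L ContinuousLinearMap.fst ℝ (ℝ × ℝ) ℝ +
    (ContinuousLinearMap.snd ℝ (ℝ × ℝ) ℝ).smulRight (w, r)

theorem blockOp_apply (P : ℝ × ℝ →L[ℝ] ℝ × ℝ) (w : ℝ × ℝ) (r : ℝ) (x : (ℝ × ℝ) × ℝ) :
    blockOp P w r x = (P x.1 + x.2 • w, x.2 * r) := by
  simp [blockOp]

theorem contDiff_blockOp {E : Type*} [NormedAddCommGroup E] [NormedSpace ℝ E]
    {P : E → ℝ × ℝ →L[ℝ] ℝ × ℝ} {w : E → ℝ × ℝ} (hP : ContDiff ℝ ∞ P) (hw : ContDiff ℝ ∞ w)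
    (r : ℝ) : ContDiff ℝ ∞ fun x => blockOp (P x) (w x) r := by
  unfold blockOp
  exact (contDiff_const.clm_comp (hP.clm_comp contDiff_const)).add
    (contDiff_const.smulRight (hw.prodMk contDiff_const))

theorem hasDerivAt_blockOp {P : ℝ → ℝ × ℝ →L[ℝ] ℝ × ℝ} {w : ℝ → ℝ × ℝ} {P' w'} {s : ℝ}
    (hP : HasDerivAt P P' s) (hw : HasDerivAt w w' s) (r : ℝ) :
    HasDerivAt (fun x => blockOp (P x) (w x) r) (blockOp P' w' 0) s := by
  have h1 := (hasDerivAt_const s (ContinuousLinearMap.inl ℝ (ℝ × ℝ) ℝ)).clm_comp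
    (hP.clm_comp (hasDerivAt_const s (ContinuousLinearMap.fst ℝ (ℝ × ℝ) ℝ)))
  have h2 := ((ContinuousLinearMap.smulRightL ℝ ((ℝ × ℝ) × ℝ) ((ℝ × ℝ) × ℝ)
    (ContinuousLinearMap.snd ℝ (ℝ × ℝ) ℝ)).hasFDerivAt).comp_hasDerivAt s
    (hw.prodMk (hasDerivAt_const s r))
  refine (h1.add h2).congr_deriv ?_
  simp [blockOp]

/-- The semidirect product acts on the plane by affine maps, which are represented by block operators
on `ℝ² × ℝ`. -/
theorem exists_isSolvAlg (t d : ℝ) : ∃ G : LieGroup3.{u}, IsSolvAlg G.Lie t d := by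
  set B := companion t d
  let L := semidirectLaw B
  let f : ℝ × ℝ × ℝ → ((ℝ × ℝ) × ℝ →L[ℝ] (ℝ × ℝ) × ℝ) := fun p =>
    blockOp (NormedSpace.exp (p.1 • B)) p.2 1
  have hB : HasDerivAt (fun s : ℝ => NormedSpace.exp (s • B)) B 0 := by
    simpa using hasDerivAt_exp_smul_const (𝕂 := ℝ) B (0 : ℝ)
  have hf : ContDiff ℝ ∞ f :=
    contDiff_blockOp ((contDiff_exp_smul B).comp contDiff_fst) contDiff_snd 1
  obtain ⟨b, D, hb, hinj, hbr⟩ := L.exists_basis_of_rep hf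
    (ContinuousLinearMap.ext fun x => by simp [f, blockOp_apply])
    (fun x y => ContinuousLinearMap.ext fun z => by
      simp [f, blockOp_apply, L, semidirectLaw, exp_add_smul_apply]
      abel)
    (X := ![blockOp B 0 0, blockOp 0 (1, 0) 0, blockOp 0 (0, 1) 0])
    (Fintype.linearIndependent_iff.2 fun g hg => by
      have h1 := DFunLike.congr_fun hg ((1, 0), 0)
      have h2 := DFunLike.congr_fun hg ((0, 0), 1)
      simp [Fin.sum_univ_three, blockOp_apply, B, companion] at h1 h2
      intro i
      fin_cases i
      exacts [h1, h2.1, h2.2])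
    (fun i => by
      refine ⟨![((1 : ℝ), (0 : ℝ), (0 : ℝ)), (0, 1, 0), (0, 0, 1)] i, ?_⟩
      have h := fun v : ℝ × ℝ => (hasDerivAt_id (0 : ℝ)).smul_const v
      fin_cases i
      · simpa [f] using hasDerivAt_blockOp hB (hasDerivAt_const (0 : ℝ) ((0 : ℝ), (0 : ℝ))) 1
      · simpa [f] using hasDerivAt_blockOp (hasDerivAt_const (0 : ℝ) 1) (h (1, 0)) 1
      · simpa [f] using hasDerivAt_blockOp (hasDerivAt_const (0 : ℝ) 1) (h (0, 1)) 1)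
  refine ⟨LieGroup3.lift.{u} L.Carrier, b, hinj ?_, hinj ?_, hinj ?_⟩ <;>
    simp only [hbr, hb, map_add, map_smul, map_zero] <;>
    refine ContinuousLinearMap.ext fun x => ?_ <;>
    simp [blockOp_apply, B, companion]

end Solvable

end

/-! ### The simple models -/

noncomputable section

open Set Filter Topology

section UnitQuaternions

open scoped Quaternion
open Metric

instance : Fact (Module.finrank ℝ ℍ[ℝ] = 3 + 1) := ⟨Quaternion.finrank_eq_four⟩

instance : LieGroup (𝓡 3) ∞ (sphere (0 : ℍ[ℝ]) 1) where
  contMDiff_mul := by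
    apply ContMDiff.codRestrict_sphere
    let c : sphere (0 : ℍ[ℝ]) 1 → ℍ[ℝ] := (↑)
    have h₂ : ContMDiff (𝓘(ℝ, ℍ[ℝ]).prod 𝓘(ℝ, ℍ[ℝ])) 𝓘(ℝ, ℍ[ℝ]) ∞
        fun z : ℍ[ℝ] × ℍ[ℝ] => z.1 * z.2 := by
      rw [contMDiff_iff]
      exact ⟨continuous_mul, fun x y => contDiff_mul.contDiffOn⟩
    suffices h₁ : ContMDiff ((𝓡 3).prod (𝓡 3)) (𝓘(ℝ, ℍ[ℝ]).prod 𝓘(ℝ, ℍ[ℝ])) ∞ (Prod.map c c) from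
      h₂.comp h₁
    apply ContMDiff.prodMap <;> exact contMDiff_coe_sphere
  contMDiff_inv := by
    apply ContMDiff.codRestrict_sphere
    intro x
    have h0 : (x : ℍ[ℝ]) ≠ 0 := ne_zero_of_mem_unit_sphere x
    have h1 : ContDiffAt ℝ ∞ (fun y : ℍ[ℝ] => y⁻¹) x := by
      have := contDiffAt_ringInverse ℝ (n := ∞) (Units.mk0 (x : ℍ[ℝ]) h0)
      rwa [Ring.inverse_eq_inv'] at this
    exact h1.contMDiffAt.comp x (contMDiff_coe_sphere x)

instance : ConnectedSpace (sphere (0 : ℍ[ℝ]) 1) :=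
  isConnected_iff_connectedSpace.1 (isConnected_sphere
    (by rw [← Module.finrank_eq_rank, Quaternion.finrank_eq_four]; norm_num) 0 zero_le_one)

/-- The one-parameter group `exp (s q)`, for an imaginary quaternion `q` of length `1 / 2`. -/
theorem exists_curve_sphere {q : ℍ[ℝ]} (hre : q.re = 0) (hq : Quaternion.normSq q = 1 / 4) :
    ∃ γ : ℝ → sphere (0 : ℍ[ℝ]) 1, γ 0 = 1 ∧ MDifferentiableAt 𝓘(ℝ, ℝ) (𝓡 3) γ 0 ∧
      HasDerivAt (fun s => (γ s : ℍ[ℝ])) q 0 := by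
  have hmem : ∀ s : ℝ, Real.cos (s / 2) • (1 : ℍ[ℝ]) + (2 * Real.sin (s / 2)) • q ∈
      sphere (0 : ℍ[ℝ]) 1 := fun s => by
    have : Quaternion.normSq (Real.cos (s / 2) • (1 : ℍ[ℝ]) + (2 * Real.sin (s / 2)) • q) = 1 := by
      rw [Quaternion.normSq_def', hre, zero_pow two_ne_zero, zero_add] at hq
      rw [Quaternion.normSq_def']
      simp [hre]
      linear_combination 4 * (Real.sin (s / 2)) ^ 2 * hq + Real.sin_sq_add_cos_sq (s / 2)
    rw [Quaternion.normSq_eq_norm_mul_self] at this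
    rw [mem_sphere_zero_iff_norm]
    nlinarith [norm_nonneg (Real.cos (s / 2) • (1 : ℍ[ℝ]) + (2 * Real.sin (s / 2)) • q)]
  refine ⟨fun s => ⟨_, hmem s⟩, Subtype.ext (by simp), ?_, ?_⟩
  · have h : ContDiff ℝ ∞ fun s : ℝ =>
        Real.cos (s / 2) • (1 : ℍ[ℝ]) + (2 * Real.sin (s / 2)) • q := by
      fun_prop
    exact (h.contMDiff.codRestrict_sphere hmem).mdifferentiableAt (by simp)
  · have h : HasDerivAt (fun s : ℝ => s / 2) 2⁻¹ 0 := by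
      simpa using (hasDerivAt_id (0 : ℝ)).div_const 2
    refine ((h.cos.smul_const (1 : ℍ[ℝ])).add ((h.sin.const_mul 2).smul_const q)).congr_deriv ?_
    simp

/-- The halves of the imaginary units `k`, `j`, `i` have the brackets of a diagonal form. -/
theorem exists_isDiagAlg_su2 : ∃ G : LieGroup3.{u}, IsDiagAlg G.Lie 1 (-1) := by
  obtain ⟨q, h0, hi, hj, hk⟩ : ∃ q : Fin 3 → ℍ[ℝ], (∀ i, (q i).re = 0) ∧
      (∀ i, (q i).imI = ![0, 0, 1 / 2] i) ∧ (∀ i, (q i).imJ = ![0, 1 / 2, 0] i) ∧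
      ∀ i, (q i).imK = ![1 / 2, 0, 0] i :=
    ⟨fun i => ⟨0, _, _, _⟩, fun _ => rfl, fun _ => rfl, fun _ => rfl, fun _ => rfl⟩
  obtain ⟨b, D, hb, hinj, hbr⟩ := LieGroup3.exists_basis_of_rep_lift.{u}
    (ρ := fun x : sphere (0 : ℍ[ℝ]) 1 => (x : ℍ[ℝ])) (contMDiff_coe_sphere (m := ∞)) rfl
    (fun _ _ => rfl) (X := q)
    (Fintype.linearIndependent_iff.2 fun g hg => by
      rw [Fin.sum_univ_three, Quaternion.ext_iff] at hg
      simp [hi, hj, hk, h0] at hg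
      intro i
      fin_cases i
      exacts [hg.2.2, hg.2.1, hg.1])
    (fun i => exists_curve_sphere (h0 i) (by
      rw [Quaternion.normSq_def', h0, hi, hj, hk]
      fin_cases i <;> simp <;> norm_num))
  refine ⟨LieGroup3.lift.{u} (sphere (0 : ℍ[ℝ]) 1), b, hinj ?_, hinj ?_, hinj ?_⟩ <;>
    simp only [hbr, hb, map_smul] <;> ext <;> simp [h0, hi, hj, hk] <;> norm_num

end UnitQuaternions

section CoverSU11

open Complex ComplexConjugate

/-- For `p = (ω, b)`, the upper left entry `√(1 + |b|²) e^{iω}` of a matrix of `SU(1,1)` whose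
upper right entry is `b`. -/
def cornerEntry (p : ℝ × ℂ) : ℂ := (√(1 + normSq p.2) : ℝ) * exp (p.1 * I)

theorem normSq_cornerEntry (p : ℝ × ℂ) : normSq (cornerEntry p) = 1 + normSq p.2 := by
  have h : 0 ≤ 1 + normSq p.2 := by linarith [normSq_nonneg p.2]
  rw [cornerEntry, map_mul, normSq_ofReal, Real.mul_self_sqrt h, normSq_eq_norm_sq (exp _),
    norm_exp_ofReal_mul_I]
  ring

theorem cornerEntry_ne_zero (p : ℝ × ℂ) : cornerEntry p ≠ 0 := by
  rw [← normSq_pos, normSq_cornerEntry]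
  linarith [normSq_nonneg p.2]

theorem contDiff_normSq : ContDiff ℝ ∞ normSq := by
  have : (normSq : ℂ → ℝ) = fun z => z.re * z.re + z.im * z.im := funext normSq_apply
  rw [this]
  exact (reCLM.contDiff.mul reCLM.contDiff).add (imCLM.contDiff.mul imCLM.contDiff)

theorem contDiff_cornerEntry : ContDiff ℝ ∞ cornerEntry := by
  have h1 : ContDiff ℝ ∞ fun p : ℝ × ℂ => √(1 + normSq p.2) :=
    (contDiff_const.add (contDiff_normSq.comp contDiff_snd)).sqrt fun p =>
      (show 0 < 1 + normSq p.2 by linarith [normSq_nonneg p.2]).ne'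
  have h2 : ContDiff ℝ ∞ fun p : ℝ × ℂ => exp (p.1 * I) :=
    ((ofRealCLM.contDiff.comp contDiff_fst).mul contDiff_const).cexp
  exact (ofRealCLM.contDiff.comp h1).mul h2

/-- The upper left entry of a product of matrices of `SU(1,1)` is the product of the upper left
entries of the factors times this number, which lies in the right half plane. -/
def cornerRatio (p q : ℝ × ℂ) : ℂ := 1 + p.2 * conj q.2 / (cornerEntry p * cornerEntry q)

theorem cornerRatio_re_pos (p q : ℝ × ℂ) : 0 < (cornerRatio p q).re := by
  have h : ‖p.2 * conj q.2 / (cornerEntry p * cornerEntry q)‖ < 1 := by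
    rw [norm_div, norm_mul, norm_mul, div_lt_one (by
      have := norm_pos_iff.2 (cornerEntry_ne_zero p)
      have := norm_pos_iff.2 (cornerEntry_ne_zero q)
      positivity), norm_conj]
    have key : ∀ p : ℝ × ℂ, ‖p.2‖ < ‖cornerEntry p‖ := fun p => by
      have := normSq_cornerEntry p
      rw [normSq_eq_norm_sq, normSq_eq_norm_sq] at this
      nlinarith [norm_nonneg p.2, norm_nonneg (cornerEntry p)]
    exact mul_lt_mul'' (key p) (key q) (norm_nonneg _) (norm_nonneg _)
  have := (abs_re_le_norm _).trans_lt h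
  rw [cornerRatio, add_re, one_re]
  linarith [(abs_lt.1 this).1]

theorem contDiff_arg_cornerRatio :
    ContDiff ℝ ∞ fun p : (ℝ × ℂ) × (ℝ × ℂ) => arg (cornerRatio p.1 p.2) := by
  have h0 : ContDiff ℝ ∞ fun p : (ℝ × ℂ) × (ℝ × ℂ) => cornerRatio p.1 p.2 := by
    simp only [cornerRatio, div_eq_mul_inv]
    refine contDiff_const.add (ContDiff.mul ?_ (ContDiff.inv ?_ fun p =>
      mul_ne_zero (cornerEntry_ne_zero p.1) (cornerEntry_ne_zero p.2)))
    · exact contDiff_fst.snd.mul (conjCLE.contDiff.comp contDiff_snd.snd)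
    · exact (contDiff_cornerEntry.comp contDiff_fst).mul (contDiff_cornerEntry.comp contDiff_snd)
  rw [contDiff_iff_contDiffAt]
  intro p
  have h1 : ContDiffAt ℝ ∞ log (cornerRatio p.1 p.2) :=
    (contDiffAt_log (Or.inl (cornerRatio_re_pos _ _))).restrict_scalars ℝ
  have h2 := imCLM.contDiff.contDiffAt.comp p (h1.comp p h0.contDiffAt)
  exact h2.congr_of_eventuallyEq (Eventually.of_forall fun q => (log_im _).symm)

/-- The product in the universal covering group of `SU(1,1)`. The lifts of the arguments add up to a
lift of the argument of the product after a correction by the argument of `cornerRatio`, which is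
smooth because that number avoids the cut of the logarithm. -/
def coverMul (p q : ℝ × ℂ) : ℝ × ℂ :=
  (p.1 + q.1 + arg (cornerRatio p q), cornerEntry p * q.2 + p.2 * conj (cornerEntry q))

theorem cornerEntry_coverMul (p q : ℝ × ℂ) :
    cornerEntry (coverMul p q) = cornerEntry p * cornerEntry q + p.2 * conj q.2 := by
  set z := cornerEntry p * cornerEntry q + p.2 * conj q.2 with hz
  have h1 : z = cornerEntry p * cornerEntry q * cornerRatio p q := by
    have := cornerEntry_ne_zero p
    have := cornerEntry_ne_zero q
    rw [hz, cornerRatio]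
    field_simp
  have hn : 1 + normSq (coverMul p q).2 = normSq z := by
    have hp := normSq_cornerEntry p
    have hq := normSq_cornerEntry q
    rw [hz]
    simp only [coverMul, normSq_apply, add_re, add_im, mul_re, mul_im, conj_re, conj_im] at hp hq ⊢
    linear_combination -((cornerEntry q).re * (cornerEntry q).re +
      (cornerEntry q).im * (cornerEntry q).im - (q.2.re * q.2.re + q.2.im * q.2.im)) * hp - hq
  have hs : √(1 + normSq (coverMul p q).2) =
      ‖cornerEntry p‖ * ‖cornerEntry q‖ * ‖cornerRatio p q‖ := by
    rw [hn, normSq_eq_norm_sq, Real.sqrt_sq (norm_nonneg _), h1, norm_mul, norm_mul]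
  have hpol : ∀ p : ℝ × ℂ, (‖cornerEntry p‖ : ℂ) * exp (p.1 * I) = cornerEntry p := fun p => by
    have : ‖cornerEntry p‖ = √(1 + normSq p.2) := by
      rw [← normSq_cornerEntry, normSq_eq_norm_sq, Real.sqrt_sq (norm_nonneg _)]
    rw [this]
    rfl
  rw [cornerEntry, hs, h1, ← hpol p, ← hpol q, ← norm_mul_exp_arg_mul_I (cornerRatio p q)]
  simp only [coverMul, ofReal_add, ofReal_mul, add_mul, exp_add, norm_mul, norm_real, norm_norm,
    norm_exp_ofReal_mul_I, mul_one]
  ring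

/-- The corner entry determines `ω` modulo `2π`. -/
theorem coverMul_ext {p q : ℝ × ℂ} (h2 : p.2 = q.2) (h : cornerEntry p = cornerEntry q)
    (h1 : |p.1 - q.1| < 2 * Real.pi) : p = q := by
  refine Prod.ext ?_ h2
  rw [cornerEntry, cornerEntry, h2] at h
  have h0 : ((√(1 + normSq q.2) : ℝ) : ℂ) ≠ 0 := by
    rw [ofReal_ne_zero, Real.sqrt_ne_zero']
    linarith [normSq_nonneg q.2]
  obtain ⟨n, hn⟩ := exp_eq_exp_iff_exists_int.1 (mul_left_cancel₀ h0 h)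
  have hn' : p.1 = q.1 + n * (2 * Real.pi) := by
    have := congrArg im hn
    simpa using this
  have hpi := Real.pi_pos
  rw [hn', add_sub_cancel_left, abs_mul, abs_of_pos (by positivity : 0 < 2 * Real.pi)] at h1
  have h3 : |(n : ℝ)| < 1 := by
    by_contra! h4
    nlinarith
  have h5 : n = 0 := by
    rw [← Int.abs_lt_one_iff]
    exact_mod_cast h3
  rw [hn', h5]
  simp

/-- The universal covering group of `SU(1,1)`. The coordinate `ω` of `(ω, b)` is a lift of the
argument of the upper left entry of the matrix. -/
def coverSU11 : SmoothGroupLaw (ℝ × ℂ) where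
  coords := ContinuousLinearEquiv.ofFinrankEq (by simp)
  mul := coverMul
  inv p := (-p.1, -p.2)
  mul_assoc x y z := by
    refine coverMul_ext ?_ ?_ ?_
    · change cornerEntry (coverMul x y) * z.2 + (coverMul x y).2 * conj (cornerEntry z) =
        cornerEntry x * (coverMul y z).2 + x.2 * conj (cornerEntry (coverMul y z))
      rw [cornerEntry_coverMul, cornerEntry_coverMul]
      simp only [coverMul, map_add, map_mul, conj_conj]
      ring
    · rw [cornerEntry_coverMul, cornerEntry_coverMul, cornerEntry_coverMul, cornerEntry_coverMul]
      simp only [coverMul, map_add, map_mul, conj_conj]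
      ring
    -- the two lifts of the argument differ by four arguments, each of absolute value below `π / 2`
    · have h : ∀ p q, |arg (cornerRatio p q)| < Real.pi / 2 := fun p q =>
        abs_arg_lt_pi_div_two_iff.2 (Or.inl (cornerRatio_re_pos p q))
      have h1 := abs_lt.1 (h x y)
      have h2 := abs_lt.1 (h (coverMul x y) z)
      have h3 := abs_lt.1 (h y z)
      have h4 := abs_lt.1 (h x (coverMul y z))
      change |x.1 + y.1 + arg (cornerRatio x y) + z.1 + arg (cornerRatio (coverMul x y) z) -
        (x.1 + (y.1 + z.1 + arg (cornerRatio y z)) + arg (cornerRatio x (coverMul y z)))| < _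
      rw [abs_lt]
      constructor <;> linarith [h1.1, h1.2, h2.1, h2.2, h3.1, h3.2, h4.1, h4.2]
  zero_mul x := by simp [coverMul, cornerRatio, cornerEntry]
  inv_mul x := by
    have hc : cornerEntry (-x.1, -x.2) = conj (cornerEntry x) := by
      simp [cornerEntry, ← exp_conj]
    have h1 : cornerRatio (-x.1, -x.2) x = ((1 + normSq x.2)⁻¹ : ℝ) := by
      have h0 : (1 + normSq x.2 : ℂ) ≠ 0 := by
        have : 1 + normSq x.2 ≠ 0 := by linarith [normSq_nonneg x.2]
        exact_mod_cast this
      rw [cornerRatio, hc, neg_mul, mul_conj, ← normSq_eq_conj_mul_self, normSq_cornerEntry]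
      push_cast
      field_simp
      ring
    refine Prod.ext ?_ ?_
    · simp only [coverMul, h1]
      rw [arg_ofReal_of_nonneg (by have := normSq_nonneg x.2; positivity)]
      simp
    · simp only [coverMul, hc]
      simp [mul_comm]
  contDiff_mul := by
    refine ((contDiff_fst.fst.add contDiff_snd.fst).add contDiff_arg_cornerRatio).prodMk ?_
    exact ((contDiff_cornerEntry.comp contDiff_fst).mul contDiff_snd.snd).add
      (contDiff_fst.snd.mul (conjCLE.contDiff.comp (contDiff_cornerEntry.comp contDiff_snd)))
  contDiff_inv := by fun_prop

/-- The operator `z ↦ a z + b z̄` of the real vector space `ℂ`. -/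
def affConj (a b : ℂ) : ℂ →L[ℝ] ℂ :=
  ContinuousLinearMap.mul ℝ ℂ a + ContinuousLinearMap.mul ℝ ℂ b ∘L conjCLE

theorem affConj_apply (a b z : ℂ) : affConj a b z = a * z + b * conj z := rfl

/-- The covering group is represented by `SU(1,1)`, in its action on `ℂ` by `z ↦ a z + b z̄`. -/
theorem exists_isDiagAlg_sl2 : ∃ G : LieGroup3.{u}, IsDiagAlg G.Lie 1 1 := by
  let f : ℝ × ℂ → (ℂ →L[ℝ] ℂ) := fun p => affConj (cornerEntry p) p.2
  have hf : ContDiff ℝ ∞ f := by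
    have h1 : ContDiff ℝ ∞ fun p : ℝ × ℂ => ContinuousLinearMap.mul ℝ ℂ (cornerEntry p) :=
      (ContinuousLinearMap.mul ℝ ℂ).contDiff.comp contDiff_cornerEntry
    have h2 : ContDiff ℝ ∞ fun p : ℝ × ℂ => ContinuousLinearMap.mul ℝ ℂ p.2 :=
      (ContinuousLinearMap.mul ℝ ℂ).contDiff.comp contDiff_snd
    exact h1.add (h2.clm_comp contDiff_const)
  obtain ⟨b, D, hb, hinj, hbr⟩ := coverSU11.exists_basis_of_rep.{u} hf
    (ContinuousLinearMap.ext fun z => by simp [f, affConj_apply, cornerEntry])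
    (fun x y => ContinuousLinearMap.ext fun z => by
      have h : f (coverSU11.mul x y) z = (cornerEntry x * cornerEntry y + x.2 * conj y.2) * z +
          (cornerEntry x * y.2 + x.2 * conj (cornerEntry y)) * conj z := by
        rw [← cornerEntry_coverMul]
        rfl
      rw [h, mul_apply_eq_comp]
      simp only [f, affConj_apply, map_add, map_mul, conj_conj]
      ring)
    (X := ![affConj 0 (-I / 2), affConj (I / 2) 0, affConj 0 (1 / 2)])
    (Fintype.linearIndependent_iff.2 fun g hg => by
      have h1 := DFunLike.congr_fun hg 1
      have h2 := DFunLike.congr_fun hg I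
      simp [Fin.sum_univ_three, affConj_apply, Complex.ext_iff] at h1 h2
      intro i
      fin_cases i <;> simp <;> linarith [h1.1, h1.2, h2.1, h2.2])
    (fun i => by
      refine ⟨![((0 : ℝ), -I / 2), (1 / 2, 0), (0, 1 / 2)] i, ?_⟩
      have hM : ∀ {a b : ℝ → ℂ} {a' b' : ℂ}, HasDerivAt a a' 0 → HasDerivAt b b' 0 →
          HasDerivAt (fun t => affConj (a t) (b t)) (affConj a' b') 0 := fun ha hb =>
        ((ContinuousLinearMap.mul ℝ ℂ).hasFDerivAt.comp_hasDerivAt 0 ha).add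
          ((((ContinuousLinearMap.compL ℝ ℂ ℂ ℂ).flip (conjCLE : ℂ →L[ℝ] ℂ) ∘L
            ContinuousLinearMap.mul ℝ ℂ)).hasFDerivAt.comp_hasDerivAt 0 hb)
      have hlin : ∀ w : ℂ, HasDerivAt (fun t : ℝ => t • w) w 0 := fun w => by
        simpa using (hasDerivAt_id (0 : ℝ)).smul_const w
      have hb' : ∀ w : ℂ, HasDerivAt (fun t : ℝ => f (t • ((0 : ℝ), w))) (affConj 0 w) 0 := by
        intro w
        have h1 : HasDerivAt (fun t : ℝ => √(1 + t ^ 2 * normSq w)) 0 0 := by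
          have h := ((((hasDerivAt_id (0 : ℝ)).pow 2).mul_const (normSq w)).const_add 1).sqrt
            (by simp)
          simpa using h
        have h2 : (fun t : ℝ => f (t • ((0 : ℝ), w))) =
            fun t : ℝ => affConj (√(1 + t ^ 2 * normSq w) : ℝ) (t • w) := by
          funext t
          simp [f, cornerEntry, sq]
        rw [h2]
        simpa using hM h1.ofReal_comp (hlin w)
      fin_cases i
      · exact hb' _
      · have h1 : HasDerivAt (fun t : ℝ => exp (t • (I / 2))) (I / 2) 0 := by
          simpa using (hlin (I / 2)).cexp
        have h2 : (fun t : ℝ => f (t • ((1 / 2 : ℝ), (0 : ℂ)))) =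
            fun t : ℝ => affConj (exp (t • (I / 2))) 0 := by
          funext t
          simp [f, cornerEntry]
          ring_nf
        exact h2 ▸ hM h1 (hasDerivAt_const 0 0)
      · exact hb' _)
  refine ⟨LieGroup3.lift.{u} coverSU11.Carrier, b, hinj ?_, hinj ?_, hinj ?_⟩ <;>
    simp only [hbr, hb, map_smul] <;> refine ContinuousLinearMap.ext fun z => ?_ <;>
    simp [affConj_apply, Complex.ext_iff, conj_ofNat] <;> constructor <;> ring

end CoverSU11

end

/-! ### Realization of all points -/

noncomputable section

open Set Filter Topology

theorem IsDiagAlg.cyclic_symm {L : Type*} [LieRing L] [LieAlgebra ℝ L] (h : IsDiagAlg L 1 1) :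
    IsDiagAlg L (-1) 1 := by
  obtain ⟨b, h₁₀, h₂₀, h₂₁⟩ := h
  have hli : LinearIndependent ℝ ![b 1, b 2, -b 0] := by
    rw [Fintype.linearIndependent_iff]
    intro g hg
    rw [Fin.sum_univ_three] at hg
    have e0 := congrArg (fun v => b.repr v 0) hg
    have e1 := congrArg (fun v => b.repr v 1) hg
    have e2 := congrArg (fun v => b.repr v 2) hg
    simp at e0 e1 e2
    intro i
    fin_cases i
    exacts [e1, e2, e0]
  obtain ⟨b', hb'⟩ := exists_basis_of_linearIndependent b hli
  refine ⟨b', ?_, ?_, ?_⟩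
  · simp [hb', h₂₁]
  · simp [hb', ← lie_skew (b 0) (b 1), h₁₀]
  · simp [hb', ← lie_skew (b 0) (b 2), h₂₀]

theorem IsSolvAlg.adTrace_ne_zero {L : Type*} [LieRing L] [LieAlgebra ℝ L] {t d : ℝ}
    (h : IsSolvAlg L t d) (ht : t ≠ 0) : adTrace L ≠ 0 := by
  obtain ⟨l, ⟨x, hx⟩, -, hτ, -⟩ := h.forms
  intro h0
  have := hτ x
  rw [h0, hx, mul_one] at this
  exact ht this.symm

section Frame

variable {L : Type*} [LieRing L] [LieAlgebra ℝ L] (b : Module.Basis (Fin 3) ℝ L)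

theorem finrank_span_pair_basis : Module.finrank ℝ (Submodule.span ℝ {b 1, b 2}) = 2 := by
  have h : LinearIndependent ℝ ![b 1, b 2] := by
    have := b.linearIndependent.comp ![1, 2] (by decide)
    rwa [show b ∘ ![1, 2] = ![b 1, b 2] by ext i; fin_cases i <;> rfl] at this
  have := finrank_span_eq_card h
  rwa [Matrix.range_cons, Matrix.range_cons, Matrix.range_empty, union_empty,
    singleton_union, Fintype.card_fin] at this

theorem lieSpan_pair_basis {a₁ a₂ : ℝ} (h₂₁ : ⁅b 2, b 1⁆ = a₁ • b 1 + a₂ • b 2 + b 0) :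
    LieSubalgebra.lieSpan ℝ L (Submodule.span ℝ {b 1, b 2} : Set L) = ⊤ := by
  set K := LieSubalgebra.lieSpan ℝ L (Submodule.span ℝ {b 1, b 2} : Set L)
  have k₁ : b 1 ∈ K := LieSubalgebra.subset_lieSpan (Submodule.subset_span (by simp))
  have k₂ : b 2 ∈ K := LieSubalgebra.subset_lieSpan (Submodule.subset_span (by simp))
  have k₀ : b 0 ∈ K := by
    have : b 0 = ⁅b 2, b 1⁆ - (a₁ • b 1 + a₂ • b 2) := by rw [h₂₁]; abel
    rw [this]
    exact K.sub_mem (K.lie_mem k₂ k₁) (K.add_mem (K.smul_mem _ k₁) (K.smul_mem _ k₂))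
  refine eq_top_iff.2 fun v _ => ?_
  rw [← b.sum_repr v, Fin.sum_univ_three]
  exact K.add_mem (K.add_mem (K.smul_mem _ k₀) (K.smul_mem _ k₁)) (K.smul_mem _ k₂)

/-- The inner product on the plane of `b 1` and `b 2` for which these vectors are orthonormal. -/
def planeMetric : Submodule.span ℝ {b 1, b 2} →ₗ[ℝ] Submodule.span ℝ {b 1, b 2} →ₗ[ℝ] ℝ :=
  (LinearMap.mk₂ ℝ (fun v w => b.coord 1 v * b.coord 1 w + b.coord 2 v * b.coord 2 w)
    (fun _ _ _ => by simp; ring) (fun _ _ _ => by simp; ring) (fun _ _ _ => by simp; ring)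
    (fun _ _ _ => by simp; ring) : L →ₗ[ℝ] L →ₗ[ℝ] ℝ).domRestrict₁₂ _ _

theorem planeMetric_apply (v w : Submodule.span ℝ {b 1, b 2}) : planeMetric b v w =
    b.coord 1 (v : L) * b.coord 1 (w : L) + b.coord 2 (v : L) * b.coord 2 (w : L) := rfl

theorem planeMetric_pos (v : Submodule.span ℝ {b 1, b 2}) (hv : v ≠ 0) :
    0 < planeMetric b v v := by
  obtain ⟨v, hv'⟩ := v
  obtain ⟨x, y, rfl⟩ := Submodule.mem_span_pair.1 hv'
  have hxy : x ≠ 0 ∨ y ≠ 0 := by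
    by_contra! hc
    exact hv (by simp [hc.1, hc.2])
  have : planeMetric b ⟨x • b 1 + y • b 2, hv'⟩ ⟨x • b 1 + y • b 2, hv'⟩ = x * x + y * y := by
    simp [planeMetric_apply]
  rw [this]
  rcases hxy with hx | hy
  · nlinarith [mul_self_pos.2 hx, mul_self_nonneg y]
  · nlinarith [mul_self_pos.2 hy, mul_self_nonneg x]

end Frame

namespace LeftInvariantSR

open LieGroup3

variable {G : LieGroup3.{u}} {H : LieGroup3.{v}} {S : LeftInvariantSR G} {T : LeftInvariantSR H}
  {κ χ w a₁ a₂ : ℝ}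

/-- A basis with the brackets of a canonical frame is a canonical frame of some structure: of the
one for which its last two vectors are orthonormal. -/
theorem exists_isCanonicalFrame {b : Module.Basis (Fin 3) ℝ G.Lie}
    (h₁₀ : ⁅b 1, b 0⁆ = (χ + w) • b 2) (h₂₀ : ⁅b 2, b 0⁆ = (χ - w) • b 1)
    (h₂₁ : ⁅b 2, b 1⁆ = a₁ • b 1 + a₂ • b 2 + b 0) :
    ∃ S : LeftInvariantSR G, S.IsCanonicalFrame b χ w a₁ a₂ := by
  have m₁ : b 1 ∈ Submodule.span ℝ {b 1, b 2} := Submodule.subset_span (by simp)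
  have m₂ : b 2 ∈ Submodule.span ℝ {b 1, b 2} := Submodule.subset_span (by simp)
  refine ⟨⟨Submodule.span ℝ {b 1, b 2}, finrank_span_pair_basis b, planeMetric b, fun v w => ?_,
    planeMetric_pos b, lieSpan_pair_basis b h₂₁⟩, m₁, m₂, ?_, ?_, ?_, h₁₀, h₂₀, h₂₁⟩ <;>
    simp [planeMetric_apply, mul_comm]

/-- The substitution in `IsCanonicalFrame.isSolvAlg_plus` is inverted on a solvable model. -/
theorem exists_isCanonicalFrame_plus (χ a : ℝ) : ∃ (G : LieGroup3.{u}) (S : LeftInvariantSR G)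
    (b : Module.Basis (Fin 3) ℝ G.Lie), S.IsCanonicalFrame b χ χ 0 a := by
  obtain ⟨G, b, h₀₁, h₀₂, h₁₂⟩ := exists_isSolvAlg.{u} (-a) (2 * χ)
  have hli : LinearIndependent ℝ ![-b 2 - a • b 1, b 0, b 1] := by
    rw [Fintype.linearIndependent_iff]
    intro g hg
    rw [Fin.sum_univ_three] at hg
    have e0 := congrArg (fun v => b.repr v 0) hg
    have e1 := congrArg (fun v => b.repr v 1) hg
    have e2 := congrArg (fun v => b.repr v 2) hg
    simp at e0 e1 e2
    rw [e2] at e1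
    intro i
    fin_cases i
    exacts [e2, e0, by simpa using e1]
  obtain ⟨b', hb'⟩ := exists_basis_of_linearIndependent b hli
  obtain ⟨S, hS⟩ := exists_isCanonicalFrame (χ := χ) (w := χ) (a₁ := 0) (a₂ := a) (b := b')
    (by
      simp only [hb', Matrix.cons_val]
      rw [lie_sub, lie_neg, lie_smul, h₀₁, h₀₂]
      module)
    (by
      simp only [hb', Matrix.cons_val]
      rw [lie_sub, lie_neg, lie_smul, h₁₂, lie_self]
      simp)
    (by
      simp only [hb', Matrix.cons_val]
      rw [← lie_skew, h₀₁]
      module)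
  exact ⟨G, S, b', hS⟩

/-- The substitution in `IsCanonicalFrame.isSolvAlg_minus` is inverted on a solvable model. -/
theorem exists_isCanonicalFrame_minus (χ a : ℝ) : ∃ (G : LieGroup3.{u}) (S : LeftInvariantSR G)
    (b : Module.Basis (Fin 3) ℝ G.Lie), S.IsCanonicalFrame b χ (-χ) a 0 := by
  obtain ⟨G, b, h₀₁, h₀₂, h₁₂⟩ := exists_isSolvAlg.{u} a (-(2 * χ))
  have hli : LinearIndependent ℝ ![b 2 - a • b 1, b 1, b 0] := by
    rw [Fintype.linearIndependent_iff]
    intro g hg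
    rw [Fin.sum_univ_three] at hg
    have e0 := congrArg (fun v => b.repr v 0) hg
    have e1 := congrArg (fun v => b.repr v 1) hg
    have e2 := congrArg (fun v => b.repr v 2) hg
    simp at e0 e1 e2
    rw [e2] at e1
    intro i
    fin_cases i
    exacts [e2, by simpa using e1, e0]
  obtain ⟨b', hb'⟩ := exists_basis_of_linearIndependent b hli
  obtain ⟨S, hS⟩ := exists_isCanonicalFrame (χ := χ) (w := -χ) (a₁ := a) (a₂ := 0) (b := b')
    (by
      simp only [hb', Matrix.cons_val]
      rw [lie_sub, lie_smul, h₁₂, lie_self]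
      simp)
    (by
      simp only [hb', Matrix.cons_val]
      rw [lie_sub, lie_smul, h₀₁, h₀₂]
      module)
    (by
      simp only [hb', Matrix.cons_val]
      rw [h₀₁]
      module)
  exact ⟨G, S, b', hS⟩

/-- The unimodular structures: on `SL(2)` and `SU(2)` the frame is rescaled, and the boundary cases
`w = ± χ` are those of a solvable model of trace zero. -/
theorem exists_isCanonicalFrame_middle (hχ : 0 ≤ χ) (w : ℝ) :
    ∃ (G : LieGroup3.{u}) (S : LeftInvariantSR G) (b : Module.Basis (Fin 3) ℝ G.Lie),
      S.IsCanonicalFrame b χ w 0 0 := by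
  have key : (∃ G : LieGroup3.{u}, IsDiagAlg G.Lie (χ + w) (χ - w)) →
      ∃ (G : LieGroup3.{u}) (S : LeftInvariantSR G) (b : Module.Basis (Fin 3) ℝ G.Lie),
        S.IsCanonicalFrame b χ w 0 0 := by
    rintro ⟨G, b, h₁₀, h₂₀, h₂₁⟩
    obtain ⟨S, hS⟩ := exists_isCanonicalFrame (a₁ := 0) (a₂ := 0) h₁₀ h₂₀ (by simp [h₂₁])
    exact ⟨G, S, b, hS⟩
  have hne : ∀ x : ℝ, 0 < x → √x ≠ 0 := fun x hx => by positivity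
  rcases lt_trichotomy w χ with h1 | rfl | h1
  · have hβ : 0 < χ - w := by linarith
    obtain ⟨G, hG⟩ := exists_isDiagAlg_sl2.{u}
    rcases lt_trichotomy w (-χ) with h2 | rfl | h2
    · have hα : 0 < -(χ + w) := by linarith
      have := hG.cyclic_symm.scale (hne _ hα) (hne _ hβ)
      rw [Real.sq_sqrt hα.le, Real.sq_sqrt hβ.le] at this
      exact key ⟨G, by convert this using 1 <;> ring⟩
    · exact exists_isCanonicalFrame_minus χ 0
    · have hα : 0 < χ + w := by linarith
      have := hG.scale (hne _ hα) (hne _ hβ)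
      rw [Real.sq_sqrt hα.le, Real.sq_sqrt hβ.le] at this
      exact key ⟨G, by convert this using 1 <;> ring⟩
  · exact exists_isCanonicalFrame_plus w 0
  · have hα : 0 < χ + w := by linarith
    have hβ : 0 < -(χ - w) := by linarith
    obtain ⟨G, hG⟩ := exists_isDiagAlg_su2.{u}
    have := hG.scale (hne _ hα) (hne _ hβ)
    rw [Real.sq_sqrt hα.le, Real.sq_sqrt hβ.le] at this
    exact key ⟨G, by convert this using 1 <;> ring⟩

theorem IsCanonicalFrame.isUnimodular {b : Module.Basis (Fin 3) ℝ G.Lie}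
    (h : S.IsCanonicalFrame b χ w 0 0) : G.IsUnimodular :=
  (isUnimodular_iff G).2 (IsDiagAlg.forms h.lie₁₀ h.lie₂₀ (by simp [h.lie₂₁])).1

/-- The other normal forms have an adjoint representation that is not traceless. -/
theorem HasInvariants.exists_isCanonicalFrame_of_isUnimodular (h : S.HasInvariants κ χ)
    (hG : G.IsUnimodular) : ∃ b, S.IsCanonicalFrame b χ κ 0 0 := by
  have h0 := (isUnimodular_iff G).1 hG
  obtain ⟨arc, harc⟩ := h.exists_isOnArc
  cases arc with
  | middle =>
    rcases harc with h | ⟨-, b, a, ha, -, hb⟩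
    · exact h
    · exact absurd h0 (hb.isSolvAlg_plus.adTrace_ne_zero (neg_ne_zero.2 ha))
  | plus =>
    obtain ⟨-, b, a, ha, -, hb⟩ := harc
    exact absurd h0 (hb.isSolvAlg_plus.adTrace_ne_zero (neg_ne_zero.2 ha))
  | minus =>
    obtain ⟨-, b, a, ha, -, hb⟩ := harc
    exact absurd h0 (hb.isSolvAlg_minus.adTrace_ne_zero ha)

theorem HasInvariants.locallyIsometric_of_isUnimodular (hS : S.HasInvariants κ χ)
    (hT : T.HasInvariants κ χ) (hG : G.IsUnimodular) (hH : H.IsUnimodular) :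
    S.LocallyIsometric T :=
  IsOnArc.locallyIsometric (arc := .middle)
    (.inl (hS.exists_isCanonicalFrame_of_isUnimodular hG))
    (.inl (hT.exists_isCanonicalFrame_of_isUnimodular hH))

theorem exists_isUnimodular (κ : ℝ) (hχ : 0 ≤ χ) :
    ∃ (G : LieGroup3.{u}) (S : LeftInvariantSR G), G.IsUnimodular ∧ S.HasInvariants κ χ := by
  obtain ⟨G, S, b, hb⟩ := exists_isCanonicalFrame_middle.{u} hχ κ
  exact ⟨G, S, hb.isUnimodular, by simpa using hb.hasInvariants hχ⟩

theorem IsCanonicalFrame.not_hasLabel_affR {b : Module.Basis (Fin 3) ℝ G.Lie}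
    (h : S.IsCanonicalFrame b χ w 0 0) : ¬S.HasLabel .AffR := fun hl => by
  obtain ⟨t, ht, hs⟩ := isAffAlg_iff.1 hl
  exact hs.adTrace_ne_zero ht ((isUnimodular_iff G).1 h.isUnimodular)

/-- Apart from `AffR`, which shares the half line `χ = 0`, `κ < 0` of the middle arc with `SLe2`, a
label is determined by its arc and by a point over which it occurs. -/
theorem _root_.Label.eq_of_occursAt {l l' : Label} (h : l.OccursAt κ χ) (h' : l'.OccursAt κ χ)
    (harc : l.arc = l'.arc) (hl : l ≠ .AffR) (hl' : l' ≠ .AffR) : l = l' := by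
  cases l <;> cases l' <;> first
    | rfl
    | exact absurd rfl hl
    | exact absurd rfl hl'
    | (simp [Label.arc] at harc; done)
    | (simp only [Label.OccursAt] at h h'; grind)

/-- A unimodular structure over the given point has the right label, because no other label of the
middle arc occurs there, except `AffR`. -/
theorem _root_.Label.exists_hasLabel {l : Label} (h : l.OccursAt κ χ) :
    ∃ (G : LieGroup3.{u}) (S : LeftInvariantSR G), S.HasInvariants κ χ ∧ S.HasLabel l := by
  have middle : 0 ≤ χ → l.arc = .middle → l ≠ .AffR →
      ∃ (G : LieGroup3.{u}) (S : LeftInvariantSR G), S.HasInvariants κ χ ∧ S.HasLabel l := by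
    intro hχ harc hl
    obtain ⟨G, S, b, hb⟩ := exists_isCanonicalFrame_middle.{u} hχ κ
    obtain ⟨l', hl', ho, harc'⟩ := hb.exists_hasLabel hχ
    have : l' ≠ .AffR := fun e => hb.not_hasLabel_affR (e ▸ hl')
    rw [Label.eq_of_occursAt h ho (harc.trans harc'.symm) hl this]
    exact ⟨G, S, by simpa using hb.hasInvariants hχ, hl'⟩
  cases l with
  | AffR =>
    obtain ⟨h1, rfl⟩ := h
    obtain ⟨G, S, b, hb⟩ := exists_isCanonicalFrame_plus.{u} 0 (√(-κ))
    have hs : √(-κ) ≠ 0 := by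
      have := neg_pos.2 h1
      positivity
    refine ⟨G, S, ?_, ?_⟩
    · have := hb.hasInvariants le_rfl
      rwa [Real.sq_sqrt (by linarith), show 0 - (0 ^ 2 + -κ) = κ by ring] at this
    · have := hb.isSolvAlg_plus
      rw [mul_zero] at this
      exact isAffAlg_iff.2 ⟨_, neg_ne_zero.2 hs, this⟩
  | SolvPlus =>
    obtain ⟨h1, h2⟩ := h
    obtain ⟨G, S, b, hb⟩ := exists_isCanonicalFrame_plus.{u} χ (√(χ - κ))
    have hs : √(χ - κ) ≠ 0 := by
      have := sub_pos.2 h2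
      positivity
    refine ⟨G, S, ?_, ?_⟩
    · have := hb.hasInvariants h1.le
      rwa [Real.sq_sqrt (by linarith), show χ - (0 ^ 2 + (χ - κ)) = κ by ring] at this
    · have := hasLabel_solvLabel (S := S) hb.isSolvAlg_plus
      rwa [solvLabel_of_pos (neg_ne_zero.2 hs) (by positivity)] at this
  | SolvMinus =>
    obtain ⟨h1, h2⟩ := h
    obtain ⟨G, S, b, hb⟩ := exists_isCanonicalFrame_minus.{u} χ (√(-χ - κ))
    have hs : √(-χ - κ) ≠ 0 := by
      have := sub_pos.2 h2
      positivity
    refine ⟨G, S, ?_, ?_⟩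
    · have := hb.hasInvariants h1.le
      rwa [Real.sq_sqrt (by linarith), show -χ - (-χ - κ + 0 ^ 2) = κ by ring] at this
    · have := hasLabel_solvLabel (S := S) hb.isSolvAlg_minus
      rwa [solvLabel_of_neg hs (by linarith)] at this
  | H3 => exact middle h.2.ge rfl nofun
  | SE2 => exact middle h.1.le rfl nofun
  | SH2 => exact middle h.1.le rfl nofun
  | SLe2 => exact middle h.1 rfl nofun
  | SLh2 => exact middle h.1.le rfl nofun
  | SU2 => exact middle h.1 rfl nofun

section Heisenberg

attribute [local instance] Matrix.linftyOpNormedRing Matrix.linftyOpNormedAlgebra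

/-- The unitriangular matrices represent the Lie algebra of the Heisenberg group. -/
theorem isHeisenbergAlg_heisenbergGroup : IsHeisenbergAlg heisenbergGroup.Lie := by
  let E : Fin 3 → Matrix (Fin 3) (Fin 3) ℝ :=
    ![Matrix.single 0 1 1, Matrix.single 1 2 1, Matrix.single 0 2 1]
  let f : E3 → Matrix (Fin 3) (Fin 3) ℝ := fun x => 1 + x 0 • E 0 + x 1 • E 1 + x 2 • E 2
  have hf : ContDiff ℝ ∞ f := by
    have h : ∀ i, ContDiff ℝ ∞ fun x : E3 => x i := fun i => by fun_prop
    exact ((contDiff_const.add ((h 0).smul contDiff_const)).add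
      ((h 1).smul contDiff_const)).add ((h 2).smul contDiff_const)
  obtain ⟨b, D, hb, hinj, hbr⟩ := exists_basis_of_rep (G := heisenbergGroup) (ρ := f)
    hf.contMDiff (show f 0 = 1 by simp [f])
    (show ∀ x y : E3, f (Heis.mulFun x y) = f x * f y by
      intro x y
      ext i j
      fin_cases i <;> fin_cases j <;>
        simp [f, E, Heis.mulFun, Matrix.mul_apply, Fin.sum_univ_three, Matrix.single_apply] <;> ring)
    (X := E)
    (Fintype.linearIndependent_iff.2 fun g hg => by
      have h := fun i j => congrFun (congrFun hg i) j
      have h0 := h 0 1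
      have h1 := h 1 2
      have h2 := h 0 2
      simp [Fin.sum_univ_three, E] at h0 h1 h2
      intro i
      fin_cases i
      exacts [h0, h1, h2])
    (fun i => by
      refine ⟨fun t => (t • EuclideanSpace.single i (1 : ℝ) : E3), ?_, ?_, ?_⟩
      · exact zero_smul ℝ (EuclideanSpace.single i (1 : ℝ) : E3)
      · have : DifferentiableAt ℝ (fun t : ℝ => t • EuclideanSpace.single i (1 : ℝ)) 0 := by
          fun_prop
        exact this.mdifferentiableAt
      · have : (fun t : ℝ => f (t • EuclideanSpace.single i (1 : ℝ))) = fun t => 1 + t • E i := by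
          funext t
          fin_cases i <;> simp [f]
        rw [this]
        simpa using ((hasDerivAt_id (0 : ℝ)).smul_const (E i)).const_add 1)
  refine ⟨b, hinj ?_, hinj ?_, hinj ?_⟩ <;> simp [hbr, hb, E]

end Heisenberg

theorem nonempty_heisenbergGroup : Nonempty (LeftInvariantSR heisenbergGroup) := by
  obtain ⟨b, h₀₁, h₀₂, h₁₂⟩ := isHeisenbergAlg_heisenbergGroup
  obtain ⟨S, -⟩ := exists_isCanonicalFrame (χ := 0) (w := 0) (a₁ := 0) (a₂ := 0)
    (b := b.reindex (Equiv.swap 0 2))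
    (by simp [Equiv.swap_apply_of_ne_of_ne (x := (1 : Fin 3)) (a := 0) (b := 2), h₁₂])
    (by simp [h₀₂]) (by simp [Equiv.swap_apply_of_ne_of_ne (x := (1 : Fin 3)) (a := 0) (b := 2), h₀₁])
  exact ⟨S⟩

theorem hasInvariants_of_heisenberg (T : LeftInvariantSR heisenbergGroup) :
    T.HasInvariants 0 0 := by
  obtain ⟨κ, χ, h⟩ := T.exists_hasInvariants
  obtain ⟨l, hl, ho, hu⟩ := h.existsUnique_hasLabel
  obtain rfl : Label.H3 = l := hu _ isHeisenbergAlg_heisenbergGroup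
  obtain ⟨rfl, rfl⟩ := ho
  exact h

theorem HasInvariants.locallyIsometric_heisenberg (h : S.HasInvariants 0 0)
    (T : LeftInvariantSR heisenbergGroup) : S.LocallyIsometric T := by
  obtain ⟨l, hl, ho, -⟩ := h.existsUnique_hasLabel
  have hm : l.arc = Label.H3.arc := by
    cases l with
    | SolvPlus => exact absurd ho.1 (lt_irrefl 0)
    | SolvMinus => exact absurd ho.1 (lt_irrefl 0)
    | _ => rfl
  exact (HasLabel.locallyIsometric_iff h (hasInvariants_of_heisenberg T) hl
    (show T.HasLabel .H3 from isHeisenbergAlg_heisenbergGroup)).2 ⟨rfl, rfl, hm⟩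

theorem hasLabel_dilate {c : ℝ} (hc : 0 < c) {l : Label} :
    (S.dilate c hc).HasLabel l ↔ S.HasLabel l := by
  cases l <;> exact Iff.rfl

theorem IsNormalized.locallyIsometric_of_dilate (hS : S.IsNormalized) (hT : T.IsNormalized) {c : ℝ}
    (hc : 0 < c) (h : (S.dilate c hc).LocallyIsometric T) : S.LocallyIsometric T := by
  obtain ⟨κ, χ, hκ, -⟩ := id hS
  have hκ' := hS.hasInvariants_dilate hT hc h hκ
  obtain ⟨l, hl, -, -⟩ := hκ.existsUnique_hasLabel
  obtain ⟨l', hl', -, -⟩ := hκ'.existsUnique_hasLabel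
  have := (HasLabel.locallyIsometric_iff (hκ.dilate hc) hκ' ((hasLabel_dilate hc).2 hl) hl').1 h
  exact (HasLabel.locallyIsometric_iff hκ hκ' hl hl').2 ⟨rfl, rfl, this.2.2⟩

end LeftInvariantSR

end

theorem theorem1 :
    -- every structure has exactly one pair of invariants
    (∀ (G : LieGroup3.{u}) (S : LeftInvariantSR G), ∃! p : ℝ × ℝ, S.HasInvariants p.1 p.2) ∧
    -- every structure has a normalized dilation
    (∀ (G : LieGroup3.{u}) (S : LeftInvariantSR G), ∃ (c : ℝ) (hc : 0 < c),
      (S.dilate c hc).IsNormalized) ∧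
    -- for normalized structures, dilations do not enlarge the local isometry classes
    (∀ (G H : LieGroup3.{u}) (S : LeftInvariantSR G) (T : LeftInvariantSR H),
      S.IsNormalized → T.IsNormalized → ∀ (c : ℝ) (hc : 0 < c),
        (S.dilate c hc).LocallyIsometric T → S.LocallyIsometric T) ∧
    -- every structure has exactly one label of the picture, and lies where that label occurs
    (∀ (G : LieGroup3.{u}) (S : LeftInvariantSR G) (κ χ : ℝ), S.HasInvariants κ χ →
      ∃ l : Label, S.HasLabel l ∧ l.OccursAt κ χ ∧ ∀ l' : Label, S.HasLabel l' → l' = l) ∧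
    -- every point of the picture is realized
    (∀ (l : Label) (κ χ : ℝ), l.OccursAt κ χ →
      ∃ (G : LieGroup3.{u}) (S : LeftInvariantSR G), S.HasInvariants κ χ ∧ S.HasLabel l) ∧
    -- two structures are locally isometric iff they are the same point of the picture
    (∀ (G H : LieGroup3.{u}) (S : LeftInvariantSR G) (T : LeftInvariantSR H) (κ χ κ' χ' : ℝ)
      (l l' : Label), S.HasInvariants κ χ → T.HasInvariants κ' χ' → S.HasLabel l → T.HasLabel l' →
        (S.LocallyIsometric T ↔ κ = κ' ∧ χ = χ' ∧ l.arc = l'.arc)) ∧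
    -- (i)
    (Nonempty (LeftInvariantSR heisenbergGroup) ∧
      ∀ (G : LieGroup3.{u}) (S : LeftInvariantSR G), S.HasInvariants 0 0 →
        ∀ T : LeftInvariantSR heisenbergGroup, S.LocallyIsometric T) ∧
    -- (ii)
    (∀ κ χ : ℝ, 0 ≤ χ → χ ^ 2 + κ ^ 2 = 1 →
      (∀ (G : Fin 4 → LieGroup3.{u}) (S : ∀ i, LeftInvariantSR (G i)),
        (∀ i, (S i).HasInvariants κ χ) → ∃ i j, i ≠ j ∧ (S i).LocallyIsometric (S j)) ∧
      (∃ (G : LieGroup3.{u}) (S : LeftInvariantSR G), G.IsUnimodular ∧ S.HasInvariants κ χ) ∧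
      ∀ (G H : LieGroup3.{u}) (S : LeftInvariantSR G) (T : LeftInvariantSR H),
        G.IsUnimodular → H.IsUnimodular → S.HasInvariants κ χ → T.HasInvariants κ χ →
          S.LocallyIsometric T) ∧
    -- (iii)
    (∀ (G H : LieGroup3.{u}) (S : LeftInvariantSR G) (T : LeftInvariantSR H) (κ χ : ℝ),
      S.HasInvariants κ χ → T.HasInvariants κ χ → (χ ≠ 0 ∨ (χ = 0 ∧ 0 ≤ κ)) →
        (S.LocallyIsometric T ↔ Nonempty (G.Lie ≃ₗ⁅ℝ⁆ H.Lie))) := 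
  ⟨fun _ S => S.existsUnique_hasInvariants,
    fun _ S => S.exists_dilate_isNormalized,
    fun _ _ _ _ hS hT _ hc h => hS.locallyIsometric_of_dilate hT hc h,
    fun _ _ _ _ h => h.existsUnique_hasLabel,
    fun _ _ _ h => Label.exists_hasLabel h,
    fun _ _ _ _ _ _ _ _ _ _ hS hT hl hl' =>
      LeftInvariantSR.HasLabel.locallyIsometric_iff hS hT hl hl',
    ⟨LeftInvariantSR.nonempty_heisenbergGroup, fun _ _ h T => h.locallyIsometric_heisenberg T⟩,
    fun κ _ hχ _ => ⟨fun _ _ h => LeftInvariantSR.exists_ne_locallyIsometric h,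
      LeftInvariantSR.exists_isUnimodular κ hχ,
      fun _ _ _ _ hG hH hS hT => hS.locallyIsometric_of_isUnimodular hT hG hH⟩,
    fun _ _ _ _ _ _ hS hT h0 => hS.locallyIsometric_iff_nonempty_lieEquiv hT h0⟩
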